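/- **Setting.** All manifolds and tensors are smooth. A $G_2$-structure on a $7$-manifold $M$ is a $3$-form $\varphi$ which at every point has, in a suitable coframe, the form $$\varphi=e^{127}+e^{347}+e^{567}+e^{135}-e^{146}-e^{236}-e^{245};$$ such coframes are orthonormal for a metric $g_\varphi$ and define an orientation and a Hodge star $*_7$. A $\mathrm{Spin}(7)$-structure on an $8$-manifold $N$ is a $4$-form $\phi$ which at every point has, in a suitable coframe, the form $$\phi=e^{1278}+e^{3478}+e^{5678}+e^{1358}-e^{1468}-e^{2368}-e^{2458}+e^{1234}+e^{1256}+e^{3456}+e^{1367}+e^{1457}+e^{2357}-e^{2467};$$ such coframes are orthonormal for a metric $g_\phi$. Its torsion forms are the $1$-form $\lambda_1$ and the $5$-form $\lambda_5$ determined by $d\phi=\lambda_1\wedge\phi+\lambda_5$, where $\lambda_5$ is pointwise $g_\phi$-orthogonal to all $\alpha\wedge\phi$ with $\alpha$ a $1$-form (equivalently, $\phi\wedge *_8\lambda_5=0$). The structure is strictly of type $\mathcal P$ if $\lambda_1\equiv0$, $\lambda_5\equiv0$; strictly of type $\mathcal Y_1$ if $\lambda_1\not\equiv0$, $\lambda_5\equiv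 0$; strictly of type $\mathcal Y_2$ (balanced, not parallel) if $\lambda_1\equiv0$, $\lambda_5\not\equiv0$; strictly of type $\mathcal Y_1\oplus\mathcal Y_2$ if $\lambda_1\not\equiv0$, $\lambda_5\not\equiv0$. A warped $\mathrm{Spin}(7)$-structure is one of the form $\phi=f^3\varphi\wedge dt+f^4*_7\varphi$ on $N=I\times M$, where $(M,\varphi)$ is a $7$-manifold with a $G_2$-structure (the fiber), $I\subset\mathbb R$ is a nonempty open interval with coordinate $t$, and $f:I\to\mathbb R$ is smooth, nowhere zero and not constant; its metric is $g_\phi=f^2g_\varphi+dt^2$. It is called Einstein if $\mathrm{Ric}(g_\phi)=c\,g_\phi$ with a constant $c$. A type is called admissible for a given sign of the scalar curvature if the formula $$\mathrm{Scal}(g_\phi)=\tfrac{21}{8}|\lambda_1|^2-\tfrac12|\lambda_5|^2+\tfrac72\,d^*\lambda_1$$ does not exclude that a structure strictly of this type has scalar curvature of that sign. Thus the admissible strict types are $\mathcal P,\mathcal Y_1,\mathcal Y_1\oplus\mathcal Y_2$ for zero, $\mathcal Y_1,\mathcal Y_1\oplus\mathcal Y_2$ for positive, and $\mathcal Y_1,\mathcal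 Y_2,\mathcal Y_1\oplus\mathcal Y_2$ for negative scalar curvature. **Theorem 7.7.** For Einstein warped $\mathrm{Spin}(7)$-structures: (i) For every strict type that is admissible for zero scalar curvature there is a Ricci-flat warped $\mathrm{Spin}(7)$-structure strictly of this type, with connected fiber. (ii) For every strict type that is admissible for positive scalar curvature there is an Einstein warped $\mathrm{Spin}(7)$-structure with positive scalar curvature strictly of this type, with connected fiber. (iii) For every strict type other than $\mathcal Y_2$ that is admissible for negative scalar curvature there is an Einstein warped $\mathrm{Spin}(7)$-structure with negative scalar curvature strictly of this type, with connected fiber. No Einstein warped $\mathrm{Spin}(7)$-structure with negative scalar curvature is strictly of type $\mathcal Y_2$. -/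

import Mathlib

open scoped Manifold ContDiff

set_option maxSynthPendingDepth 3

noncomputable section

namespace WarpedSpin7

/-! ### Linear algebra of alternating forms -/

/-- Euclidean `n`-space. -/
abbrev Euc (n : ℕ) := EuclideanSpace ℝ (Fin n)

/-- The constant form `dx^{i 0} ∧ ⋯ ∧ dx^{i (k-1)}` on `ℝⁿ` (coordinates are numbered from `0`):
its value on `v` is the determinant of the matrix with entries `dx^{i b} (v a)`. -/
def dx {n k : ℕ} (i : Fin k → Fin n) : Euc n [⋀^Fin k]→L[ℝ] ℝ :=
  { (Matrix.detRowAlternating (R := ℝ) (n := Fin k)).compLinearMap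
      (LinearMap.pi fun b => (EuclideanSpace.proj (𝕜 := ℝ) (i b)).toLinearMap) with
    cont := by
      change Continuous fun v : Fin k → Euc n =>
        Matrix.det (Matrix.of fun a b => v a (i b))
      fun_prop }

theorem dx_apply {n k : ℕ} (i : Fin k → Fin n) (v : Fin k → Euc n) :
    dx i v = Matrix.det (Matrix.of fun a b => v a (i b)) := rfl

/-- The model `G₂` three-form
`e¹²⁷ + e³⁴⁷ + e⁵⁶⁷ + e¹³⁵ - e¹⁴⁶ - e²³⁶ - e²⁴⁵` on `ℝ⁷`. -/
def phi0 : Euc 7 [⋀^Fin 3]→L[ℝ] ℝ :=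
  dx ![0, 1, 6] + dx ![2, 3, 6] + dx ![4, 5, 6] + dx ![0, 2, 4]
    - dx ![0, 3, 5] - dx ![1, 2, 5] - dx ![1, 3, 4]

/-- The four-form `e¹²³⁴ + e¹²⁵⁶ + e³⁴⁵⁶ + e¹³⁶⁷ + e¹⁴⁵⁷ + e²³⁵⁷ - e²⁴⁶⁷` on `ℝ⁷`; it is the
Hodge dual of `phi0`, see `phi0_psi0_mem_hodgeGraph`. -/
def psi0 : Euc 7 [⋀^Fin 4]→L[ℝ] ℝ :=
  dx ![0, 1, 2, 3] + dx ![0, 1, 4, 5] + dx ![2, 3, 4, 5] + dx ![0, 2, 5, 6]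
    + dx ![0, 3, 4, 6] + dx ![1, 2, 4, 6] - dx ![1, 3, 5, 6]

/-- The graph of the Hodge star operator from `k`-forms to `m`-forms on oriented Euclidean space of
dimension `k + m`: the linear map with `*e^{σ(1)⋯σ(k)} = sgn(σ) e^{σ(k+1)⋯σ(k+m)}` for every
permutation `σ`. -/
def hodgeGraph (k m : ℕ) :
    Submodule ℝ ((Euc (k + m) [⋀^Fin k]→L[ℝ] ℝ) × (Euc (k + m) [⋀^Fin m]→L[ℝ] ℝ)) :=
  Submodule.span ℝ (Set.range fun σ : Equiv.Perm (Fin (k + m)) =>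
    (dx fun a => σ (Fin.castAdd m a), (Equiv.Perm.sign σ : ℝ) • dx fun b => σ (Fin.natAdd k b)))

theorem mem_hodgeGraph_of_perm {k m : ℕ} (i : Fin k → Fin (k + m)) (j : Fin m → Fin (k + m))
    (σ : Equiv.Perm (Fin (k + m))) (s : ℤˣ) (hi : ∀ a, σ (Fin.castAdd m a) = i a)
    (hj : ∀ b, σ (Fin.natAdd k b) = j b) (hs : Equiv.Perm.sign σ = s) :
    (dx i, (s : ℝ) • dx j) ∈ hodgeGraph k m := by
  refine Submodule.subset_span ⟨σ, ?_⟩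
  simp only [hi, hj, hs]

/-- The four-form `psi0` is the Hodge dual of `phi0`. -/
theorem phi0_psi0_mem_hodgeGraph : (phi0, psi0) ∈ hodgeGraph 3 4 := by
  have h1 := mem_hodgeGraph_of_perm (k := 3) (m := 4) ![0, 1, 6] ![2, 3, 4, 5]
    ⟨![0, 1, 6, 2, 3, 4, 5], ![0, 1, 3, 4, 5, 6, 2], by decide, by decide⟩ (1) (by decide) (by decide) (by decide)
  have h2 := mem_hodgeGraph_of_perm (k := 3) (m := 4) ![2, 3, 6] ![0, 1, 4, 5]
    ⟨![2, 3, 6, 0, 1, 4, 5], ![3, 4, 0, 1, 5, 6, 2], by decide, by decide⟩ (1) (by decide) (by decide) (by decide)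
  have h3 := mem_hodgeGraph_of_perm (k := 3) (m := 4) ![4, 5, 6] ![0, 1, 2, 3]
    ⟨![4, 5, 6, 0, 1, 2, 3], ![3, 4, 5, 6, 0, 1, 2], by decide, by decide⟩ (1) (by decide) (by decide) (by decide)
  have h4 := mem_hodgeGraph_of_perm (k := 3) (m := 4) ![0, 2, 4] ![1, 3, 5, 6]
    ⟨![0, 2, 4, 1, 3, 5, 6], ![0, 3, 1, 4, 2, 5, 6], by decide, by decide⟩ (-1) (by decide) (by decide) (by decide)
  have h5 := mem_hodgeGraph_of_perm (k := 3) (m := 4) ![0, 3, 5] ![1, 2, 4, 6]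
    ⟨![0, 3, 5, 1, 2, 4, 6], ![0, 3, 4, 1, 5, 2, 6], by decide, by decide⟩ (-1) (by decide) (by decide) (by decide)
  have h6 := mem_hodgeGraph_of_perm (k := 3) (m := 4) ![1, 2, 5] ![0, 3, 4, 6]
    ⟨![1, 2, 5, 0, 3, 4, 6], ![3, 0, 1, 4, 5, 2, 6], by decide, by decide⟩ (-1) (by decide) (by decide) (by decide)
  have h7 := mem_hodgeGraph_of_perm (k := 3) (m := 4) ![1, 3, 4] ![0, 2, 5, 6]
    ⟨![1, 3, 4, 0, 2, 5, 6], ![3, 0, 4, 1, 2, 5, 6], by decide, by decide⟩ (-1) (by decide) (by decide) (by decide)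
  have h := (hodgeGraph 3 4).sub_mem ((hodgeGraph 3 4).sub_mem ((hodgeGraph 3 4).sub_mem
    ((hodgeGraph 3 4).add_mem ((hodgeGraph 3 4).add_mem ((hodgeGraph 3 4).add_mem h1 h2) h3) h4)
    h5) h6) h7
  convert h using 1
  simp only [Prod.mk_add_mk, Prod.mk_sub_mk, Prod.mk.injEq]
  refine ⟨rfl, ?_⟩
  simp only [psi0, Units.val_one, Units.val_neg, Int.cast_one, Int.cast_neg, one_smul, neg_smul]
  abel

/-- The model `Spin(7)` four-form on `ℝ⁸`,
`e¹²⁷⁸ + e³⁴⁷⁸ + e⁵⁶⁷⁸ + e¹³⁵⁸ - e¹⁴⁶⁸ - e²³⁶⁸ - e²⁴⁵⁸`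
`+ e¹²³⁴ + e¹²⁵⁶ + e³⁴⁵⁶ + e¹³⁶⁷ + e¹⁴⁵⁷ + e²³⁵⁷ - e²⁴⁶⁷`. -/
def Phi0 : Euc 8 [⋀^Fin 4]→L[ℝ] ℝ :=
  dx ![0, 1, 6, 7] + dx ![2, 3, 6, 7] + dx ![4, 5, 6, 7] + dx ![0, 2, 4, 7]
    - dx ![0, 3, 5, 7] - dx ![1, 2, 5, 7] - dx ![1, 3, 4, 7]
    + dx ![0, 1, 2, 3] + dx ![0, 1, 4, 5] + dx ![2, 3, 4, 5] + dx ![0, 2, 5, 6]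
    + dx ![0, 3, 4, 6] + dx ![1, 2, 4, 6] - dx ![1, 3, 5, 6]

section Linear

variable {E : Type*} [NormedAddCommGroup E] [NormedSpace ℝ E]

/-- The wedge product `α ∧ η` of a one-form with a `k`-form,
`(α ∧ η)(v₀, …, v_k) = ∑ᵢ (-1)ⁱ α(vᵢ) η(v₀, …, v̂ᵢ, …, v_k)`. -/
def wedge {k : ℕ} (α : E →L[ℝ] ℝ) (η : E [⋀^Fin k]→L[ℝ] ℝ) : E [⋀^Fin (k + 1)]→L[ℝ] ℝ :=
  ContinuousAlternatingMap.alternatizeUncurryFin (α.smulRight η)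

/-- The wedge product `η ∧ α = (-1)ᵏ α ∧ η` of a `k`-form with a one-form. -/
def wedgeRight {k : ℕ} (η : E [⋀^Fin k]→L[ℝ] ℝ) (α : E →L[ℝ] ℝ) : E [⋀^Fin (k + 1)]→L[ℝ] ℝ :=
  (-1 : ℝ) ^ k • wedge α η

/-- `b` is an orthonormal basis for the scalar product `g`. -/
def IsOrthonormalBasis {n : ℕ} (g : E →L[ℝ] E →L[ℝ] ℝ) (b : Module.Basis (Fin n) ℝ E) : Prop :=
  ∀ i j, g (b i) (b j) = if i = j then 1 else 0

/-- The scalar product of two `k`-forms, computed in the basis `b`: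
`∑_{i₁ < ⋯ < i_k} α(b_{i₁}, …, b_{i_k}) β(b_{i₁}, …, b_{i_k})`, written as a sum over all
multi-indices. For an orthonormal `b` it is the scalar product induced by the metric. -/
def formInner {n k : ℕ} (b : Module.Basis (Fin n) ℝ E) (α β : E [⋀^Fin k]→L[ℝ] ℝ) : ℝ :=
  (1 / (k.factorial : ℝ)) * ∑ i : Fin k → Fin n, α (fun a => b (i a)) * β (fun a => b (i a))

/-- The space `Λ⁵₄₈` of five-forms: the orthogonal complement (for the scalar product induced
by `g`) of `Λ⁵₈ = {α ∧ Φ}`; equivalently `Φ ∧ *γ = 0`. -/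
def MemLambda48 (g : E →L[ℝ] E →L[ℝ] ℝ) (Φ : E [⋀^Fin 4]→L[ℝ] ℝ)
    (γ : E [⋀^Fin 5]→L[ℝ] ℝ) : Prop :=
  ∀ b : Module.Basis (Fin 8) ℝ E, IsOrthonormalBasis g b →
    ∀ α : E →L[ℝ] ℝ, formInner b (wedge α Φ) γ = 0

/-! ### Curvature of a metric on a vector space (that is, in a coordinate chart) -/

/-- The tensor `K(u, v)(w) = ½ (D_u g(v, w) + D_v g(u, w) - D_w g(u, v))`. -/
def koszul (g : E → E →L[ℝ] E →L[ℝ] ℝ) (y : E) : E →L[ℝ] E →L[ℝ] E →L[ℝ] ℝ :=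
  let D : E →L[ℝ] E →L[ℝ] E →L[ℝ] ℝ := fderiv ℝ g y
  let F : (E →L[ℝ] E →L[ℝ] ℝ) →L[ℝ] (E →L[ℝ] E →L[ℝ] ℝ) :=
    (ContinuousLinearMap.flipₗᵢ ℝ E E ℝ).toContinuousLinearEquiv
  (1 / 2 : ℝ) • (D + D.flip - F.comp D.flip)

/-- The Christoffel symbol `Γ(u, v)` of the Levi-Civita connection of `g`, determined by
`g(Γ(u, v), w) = K(u, v)(w)`. -/
def christoffel (g : E → E →L[ℝ] E →L[ℝ] ℝ) (y : E) : E →L[ℝ] E →L[ℝ] E :=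
  (ContinuousLinearMap.compL ℝ E (E →L[ℝ] ℝ) E (g y).inverse).comp (koszul g y)

/-- The curvature tensor `R(u, v) w = ∇_u ∇_v w - ∇_v ∇_u w - ∇_{[u, v]} w`. -/
def curvature (g : E → E →L[ℝ] E →L[ℝ] ℝ) (y u v w : E) : E :=
  fderiv ℝ (christoffel g) y u v w - fderiv ℝ (christoffel g) y v u w
    + christoffel g y u (christoffel g y v w) - christoffel g y v (christoffel g y u w)

/-- The endomorphism `u ↦ R(u, v) w`. -/
def curvatureEnd (g : E → E →L[ℝ] E →L[ℝ] ℝ) (y v w : E) : E →ₗ[ℝ] E where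
  toFun u := curvature g y u v w
  map_add' a b := by simp only [curvature, map_add, add_apply]; abel
  map_smul' c a := by
    simp only [curvature, map_smul, smul_apply, RingHom.id_apply, smul_sub,
      smul_add]

/-- The Ricci tensor `Ric(v, w) = tr (u ↦ R(u, v) w)`. -/
def ricci (g : E → E →L[ℝ] E →L[ℝ] ℝ) (y v w : E) : ℝ :=
  LinearMap.trace ℝ E (curvatureEnd g y v w)

/-- The scalar curvature, the trace `∑ g^{ij} Ric_{ij}` of the Ricci tensor. -/
def scalarCurvature [FiniteDimensional ℝ E] (g : E → E →L[ℝ] E →L[ℝ] ℝ) (y : E) : ℝ :=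
  ∑ i, ricci g y (Module.finBasis ℝ E i)
    ((g y).inverse (LinearMap.toContinuousLinearMap ((Module.finBasis ℝ E).coord i)))

theorem koszul_apply (g : E → E →L[ℝ] E →L[ℝ] ℝ) (y u v w : E) :
    koszul g y u v w =
      (1 / 2) * (fderiv ℝ g y u v w + fderiv ℝ g y v u w - fderiv ℝ g y w u v) := rfl

end Linear

/-! ### Tensor fields on manifolds -/

section Manifold

variable {E : Type*} [NormedAddCommGroup E] [NormedSpace ℝ E]
  {H : Type*} [TopologicalSpace H] (I : ModelWithCorners ℝ E H)
  {X : Type*} [TopologicalSpace X] [ChartedSpace H X]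

/-! The tangent space `TangentSpace I x` of `X` at `x` is, by definition, the model vector space
`E`, identified with it through the preferred chart at `x`. Tensor fields are therefore written
as functions of `x` whose values are tensors on `E`. -/

/-- Fields of alternating `k`-forms on the tangent spaces of `X`. -/
abbrev FormField (E : Type*) [NormedAddCommGroup E] [NormedSpace ℝ E] (X : Type*) (k : ℕ) :=
  X → E [⋀^Fin k]→L[ℝ] ℝ

/-- Fields of bilinear forms on the tangent spaces of `X`. -/
abbrev BilinField (E : Type*) [NormedAddCommGroup E] [NormedSpace ℝ E] (X : Type*) :=
  X → E →L[ℝ] E →L[ℝ] ℝ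

/-- The coordinate expression of a form in the preferred chart at `x`: its pullback under the
inverse of this chart. -/
def localForm {k : ℕ} (η : FormField E X k) (x : X) (y : E) : E [⋀^Fin k]→L[ℝ] ℝ :=
  (η ((extChartAt I x).symm y)).compContinuousLinearMap
    (mfderiv 𝓘(ℝ, E) I (extChartAt I x).symm y)

/-- The coordinate expression of a bilinear form in the preferred chart at `x`. -/
def localBilin (g : BilinField E X) (x : X) (y : E) : E →L[ℝ] E →L[ℝ] ℝ :=
  ContinuousLinearMap.bilinearComp (F := E) (E' := E) (F' := E)
    (g ((extChartAt I x).symm y))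
    (mfderiv 𝓘(ℝ, E) I (extChartAt I x).symm y) (mfderiv 𝓘(ℝ, E) I (extChartAt I x).symm y)

/-- Smoothness of a form on the open set `U`. -/
def SmoothFormOn {k : ℕ} (η : FormField E X k) (U : Set X) : Prop :=
  ∀ x ∈ U, ContDiffAt ℝ ∞ (localForm I η x) (extChartAt I x x)

/-- Smoothness of a field of bilinear forms on the open set `U`. -/
def SmoothBilinOn (g : BilinField E X) (U : Set X) : Prop :=
  ∀ x ∈ U, ContDiffAt ℝ ∞ (localBilin I g x) (extChartAt I x x)

/-- The exterior derivative, computed at `x` in the preferred chart at `x`. The tangent space at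
`x` is, by definition, the model space `E`, identified through this chart. -/
def dForm {k : ℕ} (η : FormField E X k) : FormField E X (k + 1) := fun x =>
  extDeriv (localForm I η x) (extChartAt I x x)

/-- The Ricci tensor at `x` of the metric `g`. -/
def ricciAt (g : BilinField E X) (x : X) (v w : E) : ℝ :=
  ricci (localBilin I g x) (extChartAt I x x) v w

/-- The scalar curvature at `x` of the metric `g`. -/
def scalAt [FiniteDimensional ℝ E] (g : BilinField E X) (x : X) : ℝ :=
  scalarCurvature (localBilin I g x) (extChartAt I x x)

/-- The metric `g` is Einstein on `U`: `Ric = c g` with a constant `c`. -/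
def IsEinsteinOn (g : BilinField E X) (U : Set X) : Prop :=
  ∃ c : ℝ, ∀ x ∈ U, ∀ v w : E, ricciAt I g x v w = c * g x v w

/-! ### `Spin(7)`-structures and their torsion -/

/-- The four-form `Φ` is a `Spin(7)`-structure on the open set `U` and `g` is its Riemannian
metric: at every point some coframe puts `Φ` in the model form and is orthonormal for `g`. -/
def IsSpin7StructureOn (Φ : FormField E X 4) (g : BilinField E X) (U : Set X) : Prop :=
  SmoothFormOn I Φ U ∧ SmoothBilinOn I g U ∧
    ∀ x ∈ U, ∃ u : E ≃L[ℝ] Euc 8,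
      Φ x = Phi0.compContinuousLinearMap (u : E →L[ℝ] Euc 8) ∧
        ∀ v w, g x v w = inner ℝ (u v) (u w)

/-- `l₁`, `l₅` are the torsion forms on `U` of the `Spin(7)`-structure `Φ` with metric `g`:
`dΦ = l₁ ∧ Φ + l₅` with `l₅` a section of `Λ⁵₄₈`. -/
def IsTorsionOn (Φ : FormField E X 4) (g : BilinField E X) (U : Set X)
    (l₁ : (x : X) → E →L[ℝ] ℝ) (l₅ : FormField E X 5) : Prop :=
  ∀ x ∈ U, dForm I Φ x = wedge (l₁ x) (Φ x) + l₅ x ∧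
    MemLambda48 (g x) (Φ x) (l₅ x)

end Manifold

/-- The classes of `Spin(7)`-structures: parallel, locally conformal parallel, balanced, and the
general class `𝒴₁ ⊕ 𝒴₂`. -/
inductive Spin7Class
  | P
  | Y1
  | Y2
  | Y

/-- The strict type in terms of the torsion: a structure is strictly of type `c` if it belongs to
the class `c` and to no smaller one. Here `h₁`, `h₅` say that `λ₁`, resp. `λ₅`, is not zero. -/
def Spin7Class.IsStrict (c : Spin7Class) (h₁ h₅ : Prop) : Prop :=
  match c with
  | .P => ¬h₁ ∧ ¬h₅
  | .Y1 => h₁ ∧ ¬h₅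
  | .Y2 => ¬h₁ ∧ h₅
  | .Y => h₁ ∧ h₅

/-- The class `c` is admissible for scalar curvature of sign `s`: the formula
`Scal = 21/8 |λ₁|² - 1/2 |λ₅|² + 7/2 d^*λ₁` does not exclude that a structure strictly of type `c`
has scalar curvature of sign `s`. The numbers `a`, `b`, `d` stand for `|λ₁|²`, `|λ₅|²`, `d^*λ₁`;
the last vanishes if the class has `λ₁ = 0`, and is otherwise unrestricted. -/
def Spin7Class.Admissible (c : Spin7Class) (s : SignType) : Prop :=
  ∃ a b d : ℝ, 0 ≤ a ∧ 0 ≤ b ∧ c.IsStrict (a ≠ 0) (b ≠ 0) ∧ (a = 0 → d = 0) ∧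
    SignType.sign (21 / 8 * a - 1 / 2 * b + 7 / 2 * d) = s

/-! ### `G₂`-structures and warped `Spin(7)`-structures -/

/-- A `G₂`-structure on a `7`-manifold: a smooth three-form `φ` which some coframe at every point
puts in the model form, together with the metric `g_φ` and the Hodge dual `*φ` that it determines
(the adapted coframe is orthonormal and positively oriented). -/
structure G2Structure (M : Type*) [TopologicalSpace M] [ChartedSpace (Euc 7) M] where
  /-- the three-form `φ` -/
  form : FormField (Euc 7) M 3
  /-- the metric `g_φ` -/
  metric : BilinField (Euc 7) M
  /-- the four-form `*φ` -/
  dual : FormField (Euc 7) M 4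
  smooth_form : SmoothFormOn (𝓡 7) form Set.univ
  smooth_metric : SmoothBilinOn (𝓡 7) metric Set.univ
  smooth_dual : SmoothFormOn (𝓡 7) dual Set.univ
  adapted : ∀ x, ∃ u : Euc 7 ≃L[ℝ] Euc 7,
    form x = phi0.compContinuousLinearMap (u : Euc 7 →L[ℝ] Euc 7) ∧
      dual x = psi0.compContinuousLinearMap (u : Euc 7 →L[ℝ] Euc 7) ∧
        ∀ v w, metric x v w = inner ℝ (u v) (u w)

/-- `J` is a nonempty open interval and `f` a smooth, nowhere vanishing, nonconstant function
on `J`. -/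
structure IsWarping (J : Set ℝ) (f : ℝ → ℝ) : Prop where
  isOpen : IsOpen J
  ordConnected : J.OrdConnected
  nonempty : J.Nonempty
  smooth : ContDiffOn ℝ ∞ f J
  ne_zero : ∀ t ∈ J, f t ≠ 0
  nonconstant : ¬∃ c, ∀ t ∈ J, f t = c

section Warped

variable {M : Type*} [TopologicalSpace M] [ChartedSpace (Euc 7) M]

/-- The model of the `8`-manifold `ℝ × M`. -/
abbrev modelN : ModelWithCorners ℝ (ℝ × Euc 7) (ModelProd ℝ (Euc 7)) :=
  (𝓘(ℝ, ℝ)).prod (𝓡 7)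

/-- The one-form `dt` on `ℝ × M`, the differential of the projection to `ℝ`. -/
def dt (p : ℝ × M) : ℝ × Euc 7 →L[ℝ] ℝ :=
  mfderiv modelN 𝓘(ℝ, ℝ) (Prod.fst : ℝ × M → ℝ) p

/-- The differential of the projection `ℝ × M → M`. -/
def dsnd (p : ℝ × M) : ℝ × Euc 7 →L[ℝ] Euc 7 :=
  mfderiv modelN (𝓡 7) (Prod.snd : ℝ × M → M) p

/-- The pullback of a form on `M` under the projection `ℝ × M → M`. -/
def pullForm {k : ℕ} (η : FormField (Euc 7) M k) : FormField (ℝ × Euc 7) (ℝ × M) k := fun p =>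
  (η p.2).compContinuousLinearMap (dsnd p)

/-- The four-form `f³ φ ∧ dt + f⁴ *φ`. -/
def warpedForm (S : G2Structure M) (f : ℝ → ℝ) : FormField (ℝ × Euc 7) (ℝ × M) 4 := fun p =>
  f p.1 ^ 3 • wedgeRight (pullForm S.form p) (dt p) +
    f p.1 ^ 4 • pullForm S.dual p

/-- The warped product metric `f² g_φ + dt²`. -/
def warpedMetric (S : G2Structure M) (f : ℝ → ℝ) : BilinField (ℝ × Euc 7) (ℝ × M) := fun p =>
  f p.1 ^ 2 • (S.metric p.2).bilinearComp (dsnd p) (dsnd p) + (dt p).smulRight (dt p)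

/-- On the open submanifold `N = J × M` of `ℝ × M`, the form `f³ φ ∧ dt + f⁴ *φ` is a warped
`Spin(7)`-structure with metric `f² g_φ + dt²`, this metric is Einstein with scalar curvature of
sign `s`, and the structure is strictly of type `c`. -/
def IsEinsteinWarpedSpin7 (S : G2Structure M) (J : Set ℝ) (f : ℝ → ℝ) (c : Spin7Class)
    (s : SignType) : Prop :=
  IsWarping J f ∧
  IsSpin7StructureOn modelN (warpedForm S f) (warpedMetric S f) (J ×ˢ Set.univ) ∧
  IsEinsteinOn modelN (warpedMetric S f) (J ×ˢ Set.univ) ∧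
  (∀ p ∈ J ×ˢ (Set.univ : Set M), SignType.sign (scalAt modelN (warpedMetric S f) p) = s) ∧
  ∃ (l₁ : (p : ℝ × M) → ℝ × Euc 7 →L[ℝ] ℝ) (l₅ : FormField (ℝ × Euc 7) (ℝ × M) 5),
    IsTorsionOn modelN (warpedForm S f) (warpedMetric S f) (J ×ˢ Set.univ) l₁ l₅ ∧
    c.IsStrict (∃ p ∈ J ×ˢ (Set.univ : Set M), l₁ p ≠ 0)
      (∃ p ∈ J ×ˢ (Set.univ : Set M), l₅ p ≠ 0)

end Warped

/-- Some connected smooth `7`-manifold with a `G₂`-structure is the fiber of an Einstein warped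
`Spin(7)`-structure strictly of type `c`, with scalar curvature of sign `s`. -/
def ExistsEinsteinWarped (c : Spin7Class) (s : SignType) : Prop :=
  ∃ (M : Type) (_ : TopologicalSpace M) (_ : ChartedSpace (Euc 7) M)
    (_ : IsManifold (𝓡 7) ∞ M) (_ : T2Space M) (_ : SecondCountableTopology M)
    (_ : ConnectedSpace M) (S : G2Structure M) (J : Set ℝ) (f : ℝ → ℝ),
    IsEinsteinWarpedSpin7 S J f c s

end WarpedSpin7

end

/-! Write `ψ = *φ`. Everything is read off from the identity `dΦ = dt ∧ (f³ dφ + 4 f³ f' ψ) + f⁴ dψ`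
for `Φ = f³ φ ∧ dt + f⁴ ψ` (`extDeriv_coneForm`).

Nonexistence. If `λ₁ = 0`, then `dΦ = λ₅` is orthogonal to `dt ∧ Φ`. At a fixed point of the fiber
this reads `⟨ψ, dφ⟩ + 4 f' |ψ|² = 0`, and neither scalar product depends on `t`; hence `f'` is
constant (`sum_dual_dForm_of_torsion`). An affine warping function has `Ric(∂t, ∂t) = -7 f''/f = 0`
(`ricci_coneMetric_dt_dt`), so the Einstein constant is zero and the scalar curvature cannot be
negative.

Existence. In all examples the fiber is `ℝ⁷` with the round metric in stereographic coordinates. If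
`f'' = -K f` and `f'² + K f² = 1`, the warped metric has constant curvature `K`
(`curvature_coneMetric_round`); the functions `±t`, `sin`, `sinh` give `K = 0, 1, -1`. The type then
depends only on `f` and on the `G₂`-structure chosen among those with this metric, and two choices
suffice. For the nearly parallel `sphereG2`, `dφ = 4ψ` and `dψ = 0`, so `dΦ = (4(1 + f')/f) dt ∧ Φ`.
Thus `λ₅ = 0`, and `λ₁` vanishes exactly where `f' = -1`: the function `-t` gives type `P`, the
others `Y1`. For `conformalG2`, with `φ = h³ φ₀` and `ψ = h⁴ ψ₀`, the same one-form enters `dφ` with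
factor 3 and `dψ` with factor 4, whereas `λ₅ = 0` would force equal factors. So `λ₅ ≠ 0`; at the
origin `dφ = 0`, so `f' ≠ 0` forces `λ₁ ≠ 0`. This gives type `Y`.

The main algebraic work is to show that the explicit form `sphereForm` is a `G₂`-structure with the
round metric. This rests on `exists_orthogonal_phi0_psi0`, which produces it from `phi0` by a
rotation of a single plane. -/

noncomputable section

namespace WarpedSpin7

open ContinuousAlternatingMap

/-! ### Wedging with a one-form, and the exterior derivative of the cone form. -/

section Wedge

variable {E F : Type*} [NormedAddCommGroup E] [NormedSpace ℝ E]
  [NormedAddCommGroup F] [NormedSpace ℝ F] {k : ℕ}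

theorem wedge_apply (α : E →L[ℝ] ℝ) (η : E [⋀^Fin k]→L[ℝ] ℝ) (v : Fin (k + 1) → E) :
    wedge α η v = ∑ i : Fin (k + 1), (-1) ^ (i : ℕ) * (α (v i) * η (i.removeNth v)) := by
  simp [wedge, alternatizeUncurryFin_apply]

theorem wedge_add_right (α : E →L[ℝ] ℝ) (η ζ : E [⋀^Fin k]→L[ℝ] ℝ) :
    wedge α (η + ζ) = wedge α η + wedge α ζ := by
  ext v
  simp only [wedge_apply, ContinuousAlternatingMap.add_apply, ← Finset.sum_add_distrib, mul_add]

theorem wedge_smul_right (α : E →L[ℝ] ℝ) (c : ℝ) (η : E [⋀^Fin k]→L[ℝ] ℝ) :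
    wedge α (c • η) = c • wedge α η := by
  ext v
  simp only [wedge_apply, ContinuousAlternatingMap.smul_apply, smul_eq_mul, Finset.mul_sum]
  exact Finset.sum_congr rfl fun i _ => by ring

theorem wedge_add_left (α β : E →L[ℝ] ℝ) (η : E [⋀^Fin k]→L[ℝ] ℝ) :
    wedge (α + β) η = wedge α η + wedge β η := by
  ext v
  simp only [wedge_apply, ContinuousAlternatingMap.add_apply, ← Finset.sum_add_distrib,
    _root_.add_apply, add_mul, mul_add]

theorem wedge_smul_left (c : ℝ) (α : E →L[ℝ] ℝ) (η : E [⋀^Fin k]→L[ℝ] ℝ) :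
    wedge (c • α) η = c • wedge α η := by
  ext v
  simp only [wedge_apply, ContinuousAlternatingMap.smul_apply, smul_eq_mul, Finset.mul_sum,
    _root_.smul_apply]
  exact Finset.sum_congr rfl fun i _ => by ring

theorem wedge_compContinuousLinearMap (α : F →L[ℝ] ℝ) (η : F [⋀^Fin k]→L[ℝ] ℝ) (T : E →L[ℝ] F) :
    (wedge α η).compContinuousLinearMap T =
      wedge (α.comp T) (η.compContinuousLinearMap T) := by
  ext v
  simp only [wedge_apply, compContinuousLinearMap_apply, ContinuousLinearMap.comp_apply,
    Function.comp_apply]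
  rfl

/-- Wedging with a fixed one-form as a continuous linear map. -/
def wedgeCLM (k : ℕ) (α : E →L[ℝ] ℝ) : (E [⋀^Fin k]→L[ℝ] ℝ) →L[ℝ] E [⋀^Fin (k + 1)]→L[ℝ] ℝ :=
  (alternatizeUncurryFinCLM ℝ E ℝ).comp (ContinuousLinearMap.smulRightL ℝ E _ α)

@[simp]
theorem wedgeCLM_apply (α : E →L[ℝ] ℝ) (η : E [⋀^Fin k]→L[ℝ] ℝ) :
    wedgeCLM k α η = wedge α η := rfl

/-- This is `d(α ∧ η) = -α ∧ dη` for constant `α`, with `B` in the role of the derivative of `η`.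
The bilinear map `α(y) B(x) + α(x) B(y)` is symmetric, so alternating it twice gives zero, by the
algebra behind `d² = 0`; its two summands give the two sides. -/
theorem alternatizeUncurryFin_wedgeCLM_comp (α : E →L[ℝ] ℝ) (B : E →L[ℝ] E [⋀^Fin k]→L[ℝ] ℝ) :
    alternatizeUncurryFin ((wedgeCLM k α).comp B) = -wedge α (alternatizeUncurryFin B) := by
  let f₁ : E →L[ℝ] E →L[ℝ] E [⋀^Fin k]→L[ℝ] ℝ := (ContinuousLinearMap.smulRightL ℝ E _ α).comp B
  let f₂ : E →L[ℝ] E →L[ℝ] E [⋀^Fin k]→L[ℝ] ℝ := α.smulRight B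
  have h := alternatizeUncurryFin_alternatizeUncurryFinCLM_comp_of_symmetric (f := f₁ + f₂)
    (fun x y => by simp [f₁, f₂, add_comm])
  rw [ContinuousLinearMap.comp_add, alternatizeUncurryFin_add] at h
  have h₁ : (alternatizeUncurryFinCLM ℝ E ℝ).comp f₁ = (wedgeCLM k α).comp B := rfl
  have h₂ : (alternatizeUncurryFinCLM ℝ E ℝ).comp f₂ = α.smulRight (alternatizeUncurryFin B) := by
    ext x : 1
    simp [f₂]
  rw [h₁, h₂] at h
  exact eq_neg_of_add_eq_zero_left h

/-- The previous identity for `B = α ⊗ η` says that this form equals its own negative. -/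
theorem wedge_wedge_self (α : E →L[ℝ] ℝ) (η : E [⋀^Fin k]→L[ℝ] ℝ) :
    wedge α (wedge α η) = 0 := by
  have h := alternatizeUncurryFin_wedgeCLM_comp α (α.smulRight η)
  have h' : (wedgeCLM k α).comp (α.smulRight η) = α.smulRight (wedge α η) := by
    ext x : 1
    simp
  rw [h'] at h
  change wedge α (wedge α η) = -wedge α (wedge α η) at h
  ext v
  have hv := congrArg (fun η => η v) h
  change _ = (0 : ℝ)
  simp only [ContinuousAlternatingMap.neg_apply] at hv
  linarith

theorem alternatizeUncurryFin_compContinuousLinearMapCLM_comp (T : E →L[ℝ] F)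
    (B : F →L[ℝ] F [⋀^Fin k]→L[ℝ] ℝ) :
    alternatizeUncurryFin (((compContinuousLinearMapCLM T).comp B).comp T) =
      (alternatizeUncurryFin B).compContinuousLinearMap T := by
  ext v
  simp only [alternatizeUncurryFin_apply, compContinuousLinearMap_apply,
    ContinuousLinearMap.comp_apply, Function.comp_apply]
  rfl

/-- The form `f³ φ ∧ dt + f⁴ ψ` on `ℝ × E`. -/
def coneForm (f : ℝ → ℝ) (φ : E → E [⋀^Fin 3]→L[ℝ] ℝ) (ψ : E → E [⋀^Fin 4]→L[ℝ] ℝ)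
    (y : ℝ × E) : (ℝ × E) [⋀^Fin 4]→L[ℝ] ℝ :=
  f y.1 ^ 3 • wedgeRight ((φ y.2).compContinuousLinearMap (.snd ℝ ℝ E)) (.fst ℝ ℝ E) +
    f y.1 ^ 4 • (ψ y.2).compContinuousLinearMap (.snd ℝ ℝ E)

theorem coneForm_eq (f : ℝ → ℝ) (φ : E → E [⋀^Fin 3]→L[ℝ] ℝ) (ψ : E → E [⋀^Fin 4]→L[ℝ] ℝ) :
    coneForm f φ ψ = fun y : ℝ × E =>
      (-(f y.1 ^ 3)) • wedgeCLM 3 (.fst ℝ ℝ E) (compContinuousLinearMapCLM (.snd ℝ ℝ E) (φ y.2)) +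
        f y.1 ^ 4 • compContinuousLinearMapCLM (.snd ℝ ℝ E) (ψ y.2) := by
  funext y
  simp only [coneForm, wedgeRight, wedgeCLM_apply]
  rw [smul_smul]
  norm_num

/-- The derivative of `f³` contributes `dt ∧ φ ∧ dt = 0`, and `dφ ∧ dt = dt ∧ dφ` because `dφ` has
even degree. -/
theorem extDeriv_coneForm {f : ℝ → ℝ} {φ : E → E [⋀^Fin 3]→L[ℝ] ℝ}
    {ψ : E → E [⋀^Fin 4]→L[ℝ] ℝ} {t : ℝ} {x : E} {f' : ℝ} (hf : HasDerivAt f f' t)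
    (hφ : DifferentiableAt ℝ φ x) (hψ : DifferentiableAt ℝ ψ x) :
    extDeriv (coneForm f φ ψ) (t, x) =
      wedge (.fst ℝ ℝ E)
        ((f t ^ 3 • extDeriv φ x + (4 * f t ^ 3 * f') • ψ x).compContinuousLinearMap
          (.snd ℝ ℝ E)) +
      f t ^ 4 • (extDeriv ψ x).compContinuousLinearMap (.snd ℝ ℝ E) := by
  have hf1 : HasFDerivAt (fun y : ℝ × E => f y.1) (f' • ContinuousLinearMap.fst ℝ ℝ E) (t, x) :=
    hf.comp_hasFDerivAt (t, x) hasFDerivAt_fst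
  have hφ1 : HasFDerivAt (fun y : ℝ × E => φ y.2)
      ((fderiv ℝ φ x).comp (.snd ℝ ℝ E)) (t, x) :=
    HasFDerivAt.comp (t, x) (f := Prod.snd) (g := φ) hφ.hasFDerivAt hasFDerivAt_snd
  have hψ1 : HasFDerivAt (fun y : ℝ × E => ψ y.2)
      ((fderiv ℝ ψ x).comp (.snd ℝ ℝ E)) (t, x) :=
    HasFDerivAt.comp (t, x) (f := Prod.snd) (g := ψ) hψ.hasFDerivAt hasFDerivAt_snd
  have h1 := (hf1.pow 3).neg.smul
    (((wedgeCLM 3 (.fst ℝ ℝ E)).comp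
      (compContinuousLinearMapCLM (F := ℝ) (.snd ℝ ℝ E))).hasFDerivAt.comp (t, x) hφ1)
  have h2 := (hf1.pow 4).smul
    ((compContinuousLinearMapCLM (F := ℝ) (.snd ℝ ℝ E)).hasFDerivAt.comp (t, x) hψ1)
  have hd : HasFDerivAt (coneForm f φ ψ)
      ((-(f t ^ 3)) • ((wedgeCLM 3 (.fst ℝ ℝ E)).comp
          (compContinuousLinearMapCLM (F := ℝ) (.snd ℝ ℝ E))).comp
            ((fderiv ℝ φ x).comp (.snd ℝ ℝ E)) +
        (-(3 * f t ^ 2 * f')) • (ContinuousLinearMap.fst ℝ ℝ E).smulRight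
          (wedge (.fst ℝ ℝ E) ((φ x).compContinuousLinearMap (.snd ℝ ℝ E))) +
        (f t ^ 4 • (compContinuousLinearMapCLM (F := ℝ) (.snd ℝ ℝ E)).comp
            ((fderiv ℝ ψ x).comp (.snd ℝ ℝ E)) +
          (4 * f t ^ 3 * f') • (ContinuousLinearMap.fst ℝ ℝ E).smulRight
            ((ψ x).compContinuousLinearMap (.snd ℝ ℝ E)))) (t, x) := by
    rw [coneForm_eq]
    refine (h1.add h2).congr_fderiv ?_
    congr 2
    · refine ContinuousLinearMap.ext fun v => ?_
      simp [smul_smul, mul_comm, mul_left_comm]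
    · refine ContinuousLinearMap.ext fun v => ?_
      simp [smul_smul, mul_comm, mul_left_comm]
  rw [extDeriv, hd.fderiv]
  simp only [alternatizeUncurryFin_add, alternatizeUncurryFin_smul]
  have e1 : alternatizeUncurryFin
      (((wedgeCLM 3 (.fst ℝ ℝ E)).comp (compContinuousLinearMapCLM (F := ℝ) (.snd ℝ ℝ E))).comp
        ((fderiv ℝ φ x).comp (.snd ℝ ℝ E))) =
      -wedge (.fst ℝ ℝ E) ((extDeriv φ x).compContinuousLinearMap (.snd ℝ ℝ E)) := by
    rw [ContinuousLinearMap.comp_assoc, alternatizeUncurryFin_wedgeCLM_comp]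
    rw [← ContinuousLinearMap.comp_assoc, alternatizeUncurryFin_compContinuousLinearMapCLM_comp]
    rfl
  have e2 : alternatizeUncurryFin
      ((compContinuousLinearMapCLM (F := ℝ) (.snd ℝ ℝ E)).comp
        ((fderiv ℝ ψ x).comp (.snd ℝ ℝ E))) =
      (extDeriv ψ x).compContinuousLinearMap (.snd ℝ ℝ E) := by
    rw [← ContinuousLinearMap.comp_assoc, alternatizeUncurryFin_compContinuousLinearMapCLM_comp]
    rfl
  have e3 : alternatizeUncurryFin ((ContinuousLinearMap.fst ℝ ℝ E).smulRight
      (wedge (.fst ℝ ℝ E) ((φ x).compContinuousLinearMap (.snd ℝ ℝ E)))) = 0 :=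
    wedge_wedge_self _ _
  have e4 : alternatizeUncurryFin ((ContinuousLinearMap.fst ℝ ℝ E).smulRight
      ((ψ x).compContinuousLinearMap (.snd ℝ ℝ E))) =
      wedge (.fst ℝ ℝ E) ((ψ x).compContinuousLinearMap (.snd ℝ ℝ E)) := rfl
  have e5 : (f t ^ 3 • extDeriv φ x + (4 * f t ^ 3 * f') • ψ x).compContinuousLinearMap
      (.snd ℝ ℝ E) = f t ^ 3 • (extDeriv φ x).compContinuousLinearMap (.snd ℝ ℝ E) +
        (4 * f t ^ 3 * f') • (ψ x).compContinuousLinearMap (.snd ℝ ℝ E) := rfl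
  rw [e1, e2, e3, e4, e5, wedge_add_right, wedge_smul_right, wedge_smul_right, smul_zero,
    smul_neg, neg_smul, neg_neg]
  abel

end Wedge

/-! ### Chart expressions at the centre of the chart. -/

section LocalExpressions

variable {E : Type*} [NormedAddCommGroup E] [NormedSpace ℝ E]
  {H : Type*} [TopologicalSpace H] (I : ModelWithCorners ℝ E H)
  {X : Type*} [TopologicalSpace X] [ChartedSpace H X]

theorem mdifferentiableAt_extChartAt_symm [I.Boundaryless] [IsManifold I 1 X] {x : X} {y : E}
    (hy : y ∈ (extChartAt I x).target) :
    MDifferentiableAt 𝓘(ℝ, E) I (extChartAt I x).symm y := by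
  have h := mdifferentiableWithinAt_extChartAt_symm (I := I) hy
  rwa [I.range_eq_univ, mdifferentiableWithinAt_univ] at h

/-- The tangent space at `x` is identified with `E` through the very chart that is being inverted.
Hence a tensor and its chart expression agree at the centre. -/
theorem mfderiv_extChartAt_symm_self [I.Boundaryless] [IsManifold I 1 X] (x : X) :
    mfderiv 𝓘(ℝ, E) I (extChartAt I x).symm (extChartAt I x x) = ContinuousLinearMap.id ℝ E := by
  have h := mdifferentiableAt_extChartAt_symm I (mem_extChartAt_target (I := I) x)
  have heq : writtenInExtChartAt 𝓘(ℝ, E) I (extChartAt I x x) (extChartAt I x).symm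
      =ᶠ[nhds (extChartAt I x x)] id := by
    filter_upwards [extChartAt_target_mem_nhds (I := I) x] with z hz
    simp only [writtenInExtChartAt, extChartAt_to_inv, extChartAt_model_space_eq_id,
      PartialEquiv.refl_symm, PartialEquiv.refl_coe, Function.comp_apply, id]
    exact (extChartAt I x).right_inv hz
  have hd : HasFDerivWithinAt
      (writtenInExtChartAt 𝓘(ℝ, E) I (extChartAt I x x) (extChartAt I x).symm)
      (ContinuousLinearMap.id ℝ E) (Set.range 𝓘(ℝ, E))
      (extChartAt 𝓘(ℝ, E) (extChartAt I x x) (extChartAt I x x)) := by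
    simp only [extChartAt_model_space_eq_id, PartialEquiv.refl_coe, id]
    exact ((hasFDerivAt_id _).congr_of_eventuallyEq heq).hasFDerivWithinAt
  exact HasMFDerivAt.mfderiv ⟨h.continuousAt, hd⟩

theorem localForm_self [I.Boundaryless] [IsManifold I 1 X] {k : ℕ} (η : FormField E X k) (x : X) :
    localForm I η x (extChartAt I x x) = η x := by
  rw [localForm, mfderiv_extChartAt_symm_self, extChartAt_to_inv]
  rfl

theorem localBilin_self [I.Boundaryless] [IsManifold I 1 X] (g : BilinField E X) (x : X) :
    localBilin I g x (extChartAt I x x) = g x := by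
  rw [localBilin, mfderiv_extChartAt_symm_self, extChartAt_to_inv]
  rfl

end LocalExpressions

/-! ### The warped form and metric in the product charts of `ℝ × M`. -/

section Product

variable {M : Type*} [TopologicalSpace M] [ChartedSpace (Euc 7) M]

theorem dt_eq (p : ℝ × M) : dt p = ContinuousLinearMap.fst ℝ ℝ (Euc 7) :=
  mfderiv_fst

theorem dsnd_eq (p : ℝ × M) : dsnd p = ContinuousLinearMap.snd ℝ ℝ (Euc 7) :=
  mfderiv_snd

theorem extChartAt_modelN (p : ℝ × M) :
    extChartAt modelN p = (PartialEquiv.refl ℝ).prod (extChartAt (𝓡 7) p.2) := by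
  rw [extChartAt_prod, extChartAt_model_space_eq_id]

theorem mfderiv_extChartAt_modelN_symm [IsManifold (𝓡 7) 1 M] (p : ℝ × M) (y : ℝ × Euc 7)
    (hy : y.2 ∈ (extChartAt (𝓡 7) p.2).target) :
    mfderiv 𝓘(ℝ, ℝ × Euc 7) modelN (extChartAt modelN p).symm y =
      (ContinuousLinearMap.fst ℝ ℝ (Euc 7)).prod
        (ContinuousLinearMap.comp (M₂ := Euc 7) (M₃ := Euc 7)
          (mfderiv (𝓡 7) (𝓡 7) (extChartAt (𝓡 7) p.2).symm y.2)
          (ContinuousLinearMap.snd ℝ ℝ (Euc 7))) := by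
  have h1 : HasMFDerivAt 𝓘(ℝ, ℝ × Euc 7) 𝓘(ℝ, ℝ) (Prod.fst : ℝ × Euc 7 → ℝ) y
      (ContinuousLinearMap.fst ℝ ℝ (Euc 7)) := hasFDerivAt_fst.hasMFDerivAt
  have h2 : HasMFDerivAt 𝓘(ℝ, ℝ × Euc 7) 𝓘(ℝ, Euc 7) (Prod.snd : ℝ × Euc 7 → Euc 7) y
      (ContinuousLinearMap.snd ℝ ℝ (Euc 7)) := hasFDerivAt_snd.hasMFDerivAt
  have h3 := (mdifferentiableAt_extChartAt_symm (𝓡 7) hy).hasMFDerivAt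
  have h4 := HasMFDerivAt.comp y h3 h2
  have h5 := (h1.prodMk h4).mfderiv
  rw [extChartAt_modelN]
  exact h5

theorem localForm_warpedForm [IsManifold (𝓡 7) 1 M] (S : G2Structure M) (f : ℝ → ℝ) (p : ℝ × M)
    (y : ℝ × Euc 7) (hy : y.2 ∈ (extChartAt (𝓡 7) p.2).target) :
    localForm modelN (warpedForm S f) p y =
      coneForm f (localForm (𝓡 7) S.form p.2) (localForm (𝓡 7) S.dual p.2) y := by
  rw [localForm, mfderiv_extChartAt_modelN_symm p y hy, extChartAt_modelN]
  simp only [warpedForm, pullForm, dt_eq, dsnd_eq, coneForm, wedgeRight]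
  set T := (ContinuousLinearMap.fst ℝ ℝ (Euc 7)).prod
        (ContinuousLinearMap.comp (M₂ := Euc 7) (M₃ := Euc 7)
          (mfderiv (𝓡 7) (𝓡 7) (extChartAt (𝓡 7) p.2).symm y.2)
          (ContinuousLinearMap.snd ℝ ℝ (Euc 7))) with hT
  have h := wedge_compContinuousLinearMap (ContinuousLinearMap.fst ℝ ℝ (Euc 7))
    ((S.form ((extChartAt (𝓡 7) p.2).symm y.2)).compContinuousLinearMap
      (ContinuousLinearMap.snd ℝ ℝ (Euc 7))) T
  ext v
  have h' := congrArg (fun η => η v) h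
  simp only [compContinuousLinearMap_apply, ContinuousAlternatingMap.add_apply,
    ContinuousAlternatingMap.smul_apply] at h' ⊢
  refine congrArg₂ (· + ·) (congrArg (fun r : ℝ => f y.1 ^ 3 • (-1 : ℝ) ^ 3 • r) h') rfl

/-- The metric `f² k + dt²` on `ℝ × E`. -/
def coneMetric {E : Type*} [NormedAddCommGroup E] [NormedSpace ℝ E] (f : ℝ → ℝ)
    (k : E → E →L[ℝ] E →L[ℝ] ℝ) (y : ℝ × E) : (ℝ × E) →L[ℝ] (ℝ × E) →L[ℝ] ℝ :=
  f y.1 ^ 2 • (k y.2).bilinearComp (.snd ℝ ℝ E) (.snd ℝ ℝ E) +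
    (ContinuousLinearMap.fst ℝ ℝ E).smulRight (ContinuousLinearMap.fst ℝ ℝ E)

theorem coneMetric_apply {E : Type*} [NormedAddCommGroup E] [NormedSpace ℝ E] (f : ℝ → ℝ)
    (k : E → E →L[ℝ] E →L[ℝ] ℝ) (y v w : ℝ × E) :
    coneMetric f k y v w = f y.1 ^ 2 * k y.2 v.2 w.2 + v.1 * w.1 := rfl

theorem localBilin_warpedMetric [IsManifold (𝓡 7) 1 M] (S : G2Structure M) (f : ℝ → ℝ)
    (p : ℝ × M) (y : ℝ × Euc 7) (hy : y.2 ∈ (extChartAt (𝓡 7) p.2).target) :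
    localBilin modelN (warpedMetric S f) p y =
      coneMetric f (localBilin (𝓡 7) S.metric p.2) y := by
  rw [localBilin, mfderiv_extChartAt_modelN_symm p y hy, extChartAt_modelN]
  simp only [warpedMetric, dt_eq, dsnd_eq, coneMetric]
  rfl

theorem eventually_mem_target (p : ℝ × M) :
    ∀ᶠ y in nhds (extChartAt modelN p p), y.2 ∈ (extChartAt (𝓡 7) p.2).target := by
  have h : (extChartAt modelN p p) = (p.1, extChartAt (𝓡 7) p.2 p.2) := by
    rw [extChartAt_modelN]; rfl
  rw [h]
  exact continuous_snd.continuousAt.preimage_mem_nhds (extChartAt_target_mem_nhds (I := 𝓡 7) p.2)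

theorem extChartAt_modelN_self (p : ℝ × M) :
    extChartAt modelN p p = (p.1, extChartAt (𝓡 7) p.2 p.2) := by
  rw [extChartAt_modelN]; rfl

theorem localForm_warpedForm_eventuallyEq [IsManifold (𝓡 7) 1 M] (S : G2Structure M)
    (f : ℝ → ℝ) (p : ℝ × M) :
    localForm modelN (warpedForm S f) p =ᶠ[nhds (p.1, extChartAt (𝓡 7) p.2 p.2)]
      coneForm f (localForm (𝓡 7) S.form p.2) (localForm (𝓡 7) S.dual p.2) := by
  rw [← extChartAt_modelN_self]
  filter_upwards [eventually_mem_target p] with y hy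
  exact localForm_warpedForm S f p y hy

theorem localBilin_warpedMetric_eventuallyEq [IsManifold (𝓡 7) 1 M] (S : G2Structure M)
    (f : ℝ → ℝ) (p : ℝ × M) :
    localBilin modelN (warpedMetric S f) p =ᶠ[nhds (p.1, extChartAt (𝓡 7) p.2 p.2)]
      coneMetric f (localBilin (𝓡 7) S.metric p.2) := by
  rw [← extChartAt_modelN_self]
  filter_upwards [eventually_mem_target p] with y hy
  exact localBilin_warpedMetric S f p y hy

theorem dForm_warpedForm [IsManifold (𝓡 7) 1 M] (S : G2Structure M) {f : ℝ → ℝ} {f' : ℝ}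
    (p : ℝ × M) (hf : HasDerivAt f f' p.1) :
    dForm modelN (warpedForm S f) p =
      wedge (.fst ℝ ℝ (Euc 7))
        ((f p.1 ^ 3 • dForm (𝓡 7) S.form p.2 + (4 * f p.1 ^ 3 * f') • S.dual p.2).compContinuousLinearMap
          (.snd ℝ ℝ (Euc 7))) +
      f p.1 ^ 4 • (dForm (𝓡 7) S.dual p.2).compContinuousLinearMap (.snd ℝ ℝ (Euc 7)) := by
  rw [dForm, extChartAt_modelN_self, (localForm_warpedForm_eventuallyEq S f p).extDeriv_eq,
    extDeriv_coneForm hf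
      ((S.smooth_form p.2 (Set.mem_univ _)).differentiableAt (by simp))
      ((S.smooth_dual p.2 (Set.mem_univ _)).differentiableAt (by simp)), localForm_self]
  rfl

theorem warpedForm_eq (S : G2Structure M) (f : ℝ → ℝ) (p : ℝ × M) :
    warpedForm S f p =
      f p.1 ^ 3 • wedgeRight ((S.form p.2).compContinuousLinearMap (.snd ℝ ℝ (Euc 7)))
        (.fst ℝ ℝ (Euc 7)) +
      f p.1 ^ 4 • (S.dual p.2).compContinuousLinearMap (.snd ℝ ℝ (Euc 7)) := by
  simp only [warpedForm, pullForm, dt_eq, dsnd_eq]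

theorem warpedMetric_apply (S : G2Structure M) (f : ℝ → ℝ) (p : ℝ × M) (v w : ℝ × Euc 7) :
    warpedMetric S f p v w = f p.1 ^ 2 * S.metric p.2 v.2 w.2 + v.1 * w.1 := by
  simp only [warpedMetric, dt_eq, dsnd_eq]
  rfl

end Product

/-! ### Scalar products of forms and the orthogonal splitting of five-forms. -/

section FormInner

variable {E : Type*} [NormedAddCommGroup E] [NormedSpace ℝ E] {n k : ℕ}

/-- Contraction is adjoint to wedging. All `k + 1` terms of the wedge product contribute equally,
since moving `b j` to the front of `γ` costs the sign that the term already carries; the factor `k +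
1` turns `1/(k+1)!` into `1/k!`. -/
theorem formInner_wedge (b : Module.Basis (Fin n) ℝ E) (α : E →L[ℝ] ℝ)
    (η : E [⋀^Fin k]→L[ℝ] ℝ) (γ : E [⋀^Fin (k + 1)]→L[ℝ] ℝ) :
    formInner b (wedge α η) γ = ∑ j, α (b j) * formInner b η (γ.curryLeft (b j)) := by
  have key : ∀ a : Fin (k + 1), (∑ i : Fin (k + 1) → Fin n, (-1) ^ (a : ℕ) *
      (α (b (i a)) * η (a.removeNth fun c => b (i c))) * γ (fun c => b (i c))) =
      ∑ j, α (b j) * ∑ i : Fin k → Fin n, η (fun c => b (i c)) *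
        γ.curryLeft (b j) (fun c => b (i c)) := by
    intro a
    rw [← (Fin.insertNthEquiv (fun _ => Fin n) a).sum_comp, Fintype.sum_prod_type]
    refine Finset.sum_congr rfl fun j _ => ?_
    rw [Finset.mul_sum]
    refine Finset.sum_congr rfl fun i _ => ?_
    have h1 : (fun c => b ((Fin.insertNthEquiv (fun _ => Fin n) a) (j, i) c)) =
        a.insertNth (b j) (fun c => b (i c)) := by
      funext c
      refine Fin.succAboveCases a ?_ (fun d => ?_) c <;> simp [Fin.insertNthEquiv]
    rw [h1, map_insertNth, curryLeft_apply_apply]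
    have h2 : ((-1 : ℝ) ^ (a : ℕ)) * (-1) ^ (a : ℕ) = 1 := by
      rw [← mul_pow]; norm_num
    simp only [Fin.insertNthEquiv_apply, Fin.insertNth_apply_same, Fin.removeNth_insertNth,
      zsmul_eq_mul]
    push_cast
    linear_combination (α (b j) * η (fun c => b (i c)) *
      γ (Matrix.vecCons (b j) fun c => b (i c))) * h2
  simp only [formInner, wedge_apply, Finset.sum_mul]
  rw [Finset.sum_comm, Finset.sum_congr rfl fun a _ => key a, Finset.sum_const, Finset.card_univ,
    Fintype.card_fin, nsmul_eq_mul, ← mul_assoc, Finset.mul_sum]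
  refine Finset.sum_congr rfl fun j _ => ?_
  have hk : (1 / ((k + 1).factorial : ℝ)) * ((k + 1 : ℕ) : ℝ) = 1 / (k.factorial : ℝ) := by
    have := Nat.factorial_ne_zero k
    rw [Nat.factorial_succ]
    push_cast
    field_simp
  rw [hk]
  ring

/-- The transition matrix `P` is orthogonal, hence so is the matrix of products of its entries that
transforms multi-index components. It follows that membership in `Λ⁵₄₈` can be tested in one
orthonormal basis. -/
theorem formInner_eq_of_isOrthonormalBasis {g : E →L[ℝ] E →L[ℝ] ℝ}
    {b b' : Module.Basis (Fin n) ℝ E} (hb : IsOrthonormalBasis g b) (hb' : IsOrthonormalBasis g b')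
    (α β : E [⋀^Fin k]→L[ℝ] ℝ) : formInner b' α β = formInner b α β := by
  set P := b.toMatrix b' with hP
  have hexp : ∀ j, b' j = ∑ i, P i j • b i := fun j => (b.sum_toMatrix_smul_self b' j).symm
  have hPP : P.transpose * P = 1 := by
    ext j l
    have h := hb' j l
    rw [hexp j, hexp l] at h
    simp only [_root_.map_sum, _root_.map_smul, _root_.sum_apply, _root_.smul_apply, hb _ _, smul_eq_mul,
      mul_ite, mul_one, mul_zero, Finset.sum_ite_eq', Finset.mem_univ,
      if_true] at h
    rw [Matrix.mul_apply, Matrix.one_apply, ← h]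
    exact Finset.sum_congr rfl fun i _ => by simp [mul_comm]
  have hPP' : P * P.transpose = 1 := mul_eq_one_comm.mp hPP
  have hrow : ∀ i i', ∑ j, P i j * P i' j = if i = i' then 1 else 0 := fun i i' => by
    have := congrFun (congrFun hPP' i) i'
    simpa [Matrix.mul_apply, Matrix.one_apply] using this
  have hα : ∀ (α : E [⋀^Fin k]→L[ℝ] ℝ) (j : Fin k → Fin n), α (fun a => b' (j a)) =
      ∑ i : Fin k → Fin n, (∏ a, P (i a) (j a)) * α (fun a => b (i a)) := by
    intro α j
    simp only [hexp]
    have := α.toMultilinearMap.map_sum (fun a (i : Fin n) => P i (j a) • b i)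
    refine this.trans (Finset.sum_congr rfl fun i _ => ?_)
    exact α.toMultilinearMap.map_smul_univ (fun a => P (i a) (j a)) (fun a => b (i a))
  have hprod : ∀ i i' : Fin k → Fin n,
      ∑ j : Fin k → Fin n, (∏ a, P (i a) (j a)) * (∏ a, P (i' a) (j a)) =
        if i = i' then 1 else 0 := by
    intro i i'
    simp only [← Finset.prod_mul_distrib]
    have := Finset.prod_univ_sum (fun _ : Fin k => (Finset.univ : Finset (Fin n)))
      (fun a j => P (i a) j * P (i' a) j)
    rw [Fintype.piFinset_univ] at this
    rw [← this]
    simp only [hrow]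
    by_cases h : i = i'
    · simp [h]
    · rw [if_neg h]
      obtain ⟨a, ha⟩ := Function.ne_iff.mp h
      exact Finset.prod_eq_zero (Finset.mem_univ a) (if_neg ha)
  rw [formInner, formInner]
  congr 1
  simp only [hα, Finset.sum_mul_sum]
  rw [Finset.sum_comm]
  refine Finset.sum_congr rfl fun i _ => ?_
  rw [Finset.sum_comm]
  calc ∑ i' : Fin k → Fin n, ∑ j : Fin k → Fin n, (∏ a, P (i a) (j a)) * α (fun a => b (i a)) *
        ((∏ a, P (i' a) (j a)) * β (fun a => b (i' a)))
      = ∑ i' : Fin k → Fin n, (if i = i' then 1 else 0) *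
          (α (fun a => b (i a)) * β (fun a => b (i' a))) := by
        refine Finset.sum_congr rfl fun i' _ => ?_
        rw [← hprod, Finset.sum_mul]
        exact Finset.sum_congr rfl fun j _ => by ring
    _ = _ := by simp

/-- Every five-form splits into a multiple of `Φ` by a one-form and a form in `Λ⁵₄₈`. -/
theorem exists_memLambda48 {g : E →L[ℝ] E →L[ℝ] ℝ} {b : Module.Basis (Fin 8) ℝ E}
    (hb : IsOrthonormalBasis g b) (Φ : E [⋀^Fin 4]→L[ℝ] ℝ) (γ : E [⋀^Fin 5]→L[ℝ] ℝ) :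
    ∃ α : E →L[ℝ] ℝ, MemLambda48 g Φ (γ - wedge α Φ) := by
  let T : (E [⋀^Fin 5]→L[ℝ] ℝ) →ₗ[ℝ] EuclideanSpace ℝ (Fin 5 → Fin 8) :=
    { toFun := fun η => WithLp.toLp 2 fun i => η fun a => b (i a)
      map_add' := fun _ _ => rfl
      map_smul' := fun _ _ => rfl }
  let L : (E →L[ℝ] ℝ) →ₗ[ℝ] (E [⋀^Fin 5]→L[ℝ] ℝ) :=
    { toFun := fun α => wedge α Φ
      map_add' := fun α β => wedge_add_left α β Φ
      map_smul' := fun c α => wedge_smul_left c α Φ }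
  let W := LinearMap.range (T.comp L)
  -- The components in `b` embed five-forms into a Euclidean space whose scalar product is `5!`
  -- times `formInner`, so `α` comes from the orthogonal projection to the image of `α ↦ α ∧ Φ`.
  obtain ⟨w, hw, z, hz, hwz⟩ := W.exists_add_mem_mem_orthogonal (T γ)
  obtain ⟨α, rfl⟩ := hw
  refine ⟨α, fun b' hb' β => ?_⟩
  rw [formInner_eq_of_isOrthonormalBasis hb hb', formInner]
  have h0 : inner ℝ (T (L β)) (T (γ - L α)) = 0 := by
    have : T (γ - L α) = z := by rw [map_sub, hwz]; simp
    rw [this]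
    exact hz _ ⟨β, rfl⟩
  rw [PiLp.inner_apply] at h0
  have h1 : ∑ i : Fin 5 → Fin 8, wedge β Φ (fun a => b (i a)) *
      (γ - wedge α Φ) (fun a => b (i a)) = 0 := by
    rw [← h0]
    refine Finset.sum_congr rfl fun i _ => ?_
    simp only [RCLike.inner_apply, conj_trivial]
    exact mul_comm _ _
  rw [h1, mul_zero]

end FormInner

/-! ### The model form on `ℝ⁸` along the splitting `ℝ × ℝ⁷`. -/

section Model

theorem dx_snoc {n k : ℕ} (i : Fin k → Fin n) (j : Fin n) :
    dx (Fin.snoc i j : Fin (k + 1) → Fin n) =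
      wedgeRight (dx i) (EuclideanSpace.proj (𝕜 := ℝ) j) := by
  ext v
  rw [dx_apply, Matrix.det_succ_column _ (Fin.last k)]
  simp only [wedgeRight, ContinuousAlternatingMap.smul_apply, wedge_apply, smul_eq_mul,
    Finset.mul_sum]
  refine Finset.sum_congr rfl fun a _ => ?_
  rw [dx_apply]
  have : ((Matrix.of fun a b => v a ((Fin.snoc i j : Fin (k + 1) → Fin n) b)).submatrix
      a.succAbove (Fin.last k).succAbove) = Matrix.of fun c b => a.removeNth v c (i b) := by
    ext c d
    simp [Fin.removeNth]
  rw [this]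
  simp [pow_add]
  ring

/-- The projection of `ℝ⁸` to the first seven coordinates. -/
def proj7 : Euc 8 →L[ℝ] Euc 7 :=
  LinearMap.toContinuousLinearMap
    { toFun := fun v => WithLp.toLp 2 fun i => v i.castSucc
      map_add' := fun _ _ => rfl
      map_smul' := fun _ _ => rfl }

theorem proj7_apply (v : Euc 8) (i : Fin 7) : proj7 v i = v i.castSucc := rfl

theorem dx_comp_proj7 {k : ℕ} (i : Fin k → Fin 7) :
    (dx i).compContinuousLinearMap proj7 = dx fun a => (i a).castSucc := rfl

theorem dx_snoc_seven {k : ℕ} (i : Fin k → Fin 7) :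
    wedgeRight ((dx i).compContinuousLinearMap proj7) (EuclideanSpace.proj (𝕜 := ℝ) (7 : Fin 8)) =
      dx (Fin.snoc (fun a => (i a).castSucc) 7 : Fin (k + 1) → Fin 8) := by
  rw [dx_snoc, dx_comp_proj7]

theorem Phi0_eq : Phi0 = wedgeRight (phi0.compContinuousLinearMap proj7)
      (EuclideanSpace.proj (𝕜 := ℝ) (7 : Fin 8)) + psi0.compContinuousLinearMap proj7 := by
  have h : ∀ i : Fin 3 → Fin 7, (-1 : ℝ) ^ 3 • wedgeCLM 3 (EuclideanSpace.proj (𝕜 := ℝ) (7 : Fin 8))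
      (compContinuousLinearMapCLM proj7 (dx i)) =
        dx (Fin.snoc (fun a => (i a).castSucc) 7 : Fin 4 → Fin 8) := fun i => dx_snoc_seven i
  have h' : ∀ i : Fin 4 → Fin 7, compContinuousLinearMapCLM proj7 (dx i) =
      dx fun a => (i a).castSucc := fun i => rfl
  have e1 : wedgeRight (phi0.compContinuousLinearMap proj7)
      (EuclideanSpace.proj (𝕜 := ℝ) (7 : Fin 8)) =
      (-1 : ℝ) ^ 3 • wedgeCLM 3 (EuclideanSpace.proj (𝕜 := ℝ) (7 : Fin 8))
        (compContinuousLinearMapCLM proj7 phi0) := rfl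
  have e2 : psi0.compContinuousLinearMap proj7 = compContinuousLinearMapCLM proj7 psi0 := rfl
  rw [e1, e2]
  simp only [phi0, psi0, map_add, map_sub, smul_add, smul_sub, h, h']
  have v3 : ∀ a b c : Fin 7, (Fin.snoc (fun x => (![a, b, c] x).castSucc) 7 : Fin 4 → Fin 8) =
      ![a.castSucc, b.castSucc, c.castSucc, 7] := by
    intro a b c; funext x; fin_cases x <;> rfl
  have v4 : ∀ a b c d : Fin 7, (fun x => (![a, b, c, d] x).castSucc) =
      ![a.castSucc, b.castSucc, c.castSucc, d.castSucc] := by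
    intro a b c d; funext x; fin_cases x <;> rfl
  simp only [v3, v4]
  rw [Phi0]
  simp only [Fin.reduceCastSucc]
  abel

/-- The linear isomorphism `(τ, v) ↦ (c u(v), τ)`. -/
def coneEquiv (u : Euc 7 ≃L[ℝ] Euc 7) (c : ℝ) (hc : c ≠ 0) : (ℝ × Euc 7) ≃L[ℝ] Euc 8 :=
  LinearEquiv.toContinuousLinearEquiv
    { toFun := fun v => WithLp.toLp 2 (Fin.snoc (α := fun _ => ℝ) (fun i => c * u v.2 i) v.1)
      invFun := fun w => (w 7, u.symm (c⁻¹ • proj7 w))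
      map_add' := fun v w => by
        ext i
        refine Fin.lastCases ?_ (fun i => ?_) i <;> simp [-Fin.reduceLast, mul_add]
      map_smul' := fun a v => by
        ext i
        refine Fin.lastCases ?_ (fun i => ?_) i <;> simp [-Fin.reduceLast, mul_left_comm]
      left_inv := fun v => by
        refine Prod.ext ?_ ?_
        · exact Fin.snoc_last (α := fun _ => ℝ) v.1 (fun i : Fin 7 => c * u v.2 i)
        · simp only
          rw [ContinuousLinearEquiv.symm_apply_eq]
          ext i
          simp [proj7_apply, hc]
      right_inv := fun w => by
        ext i
        refine Fin.lastCases ?_ (fun i => ?_) i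
        · simp
          rfl
        · simp [proj7_apply, hc] }

variable (u : Euc 7 ≃L[ℝ] Euc 7) (c : ℝ) (hc : c ≠ 0)

theorem coneEquiv_apply_castSucc (v : ℝ × Euc 7) (i : Fin 7) :
    coneEquiv u c hc v i.castSucc = c * u v.2 i :=
  Fin.snoc_castSucc (α := fun _ => ℝ) v.1 (fun i : Fin 7 => c * u v.2 i) i

theorem coneEquiv_apply_seven (v : ℝ × Euc 7) : coneEquiv u c hc v 7 = v.1 :=
  Fin.snoc_last (α := fun _ => ℝ) v.1 (fun i : Fin 7 => c * u v.2 i)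

theorem inner_coneEquiv (v w : ℝ × Euc 7) :
    inner ℝ (coneEquiv u c hc v) (coneEquiv u c hc w) =
      c ^ 2 * inner ℝ (u v.2) (u w.2) + v.1 * w.1 := by
  rw [PiLp.inner_apply, PiLp.inner_apply, Fin.sum_univ_castSucc, Finset.mul_sum]
  simp only [coneEquiv_apply_castSucc]
  have h7 : Fin.last 7 = (7 : Fin 8) := rfl
  rw [h7, coneEquiv_apply_seven, coneEquiv_apply_seven]
  simp only [RCLike.inner_apply, conj_trivial]
  congr 1
  · exact Finset.sum_congr rfl fun i _ => by ring
  · ring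

/-- Each fiber slot contributes one factor `c`, whence the exponents 3 and 4. Only `c ≠ 0` is
needed: the coframe `(c u, dt)` is adapted for negative `c` too, which the example `f = -t` relies
on. -/
theorem Phi0_comp_coneEquiv :
    Phi0.compContinuousLinearMap (coneEquiv u c hc : (ℝ × Euc 7) →L[ℝ] Euc 8) =
      c ^ 3 • wedgeRight ((phi0.compContinuousLinearMap (u : Euc 7 →L[ℝ] Euc 7)).compContinuousLinearMap
        (.snd ℝ ℝ (Euc 7))) (.fst ℝ ℝ (Euc 7)) +
      c ^ 4 • (psi0.compContinuousLinearMap (u : Euc 7 →L[ℝ] Euc 7)).compContinuousLinearMap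
        (.snd ℝ ℝ (Euc 7)) := by
  have hp : ∀ v, proj7 (coneEquiv u c hc v) = c • u v.2 := fun v => by
    ext i
    rw [proj7_apply, coneEquiv_apply_castSucc]
    rfl
  have hs : ∀ (k : ℕ) (η : Euc 7 [⋀^Fin k]→L[ℝ] ℝ) (v : Fin k → ℝ × Euc 7),
      η (fun a => c • u (v a).2) = c ^ k * η (fun a => u (v a).2) := fun k η v => by
    have := η.toMultilinearMap.map_smul_univ (fun _ => c) (fun a => u (v a).2)
    simpa using this
  ext v
  rw [Phi0_eq]
  have e1 := hs 4 psi0 v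
  simp only [compContinuousLinearMap_apply, ContinuousAlternatingMap.add_apply,
    ContinuousAlternatingMap.smul_apply, wedgeRight, wedge_apply, smul_eq_mul]
  congr 1
  · simp only [Finset.mul_sum]
    refine Finset.sum_congr rfl fun i _ => ?_
    have h3 : phi0 (⇑proj7 ∘ i.removeNth (⇑(coneEquiv u c hc : (ℝ × Euc 7) →L[ℝ] Euc 8) ∘ v)) =
        c ^ 3 * phi0 (fun a => u (i.removeNth v a).2) := by
      rw [← hs 3 phi0 (i.removeNth v)]
      exact congrArg phi0 (funext fun a => hp _)
    rw [h3]
    have h7 : (EuclideanSpace.proj (𝕜 := ℝ) (7 : Fin 8))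
        ((⇑(coneEquiv u c hc : (ℝ × Euc 7) →L[ℝ] Euc 8) ∘ v) i) = (v i).1 :=
      coneEquiv_apply_seven u c hc (v i)
    rw [h7]
    change _ = c ^ 3 * ((-1) ^ 3 * ((-1) ^ (i : ℕ) * ((v i).1 *
      phi0 (fun a => u (i.removeNth v a).2))))
    ring

/-- The basis of `ℝ × ℝ⁷` mapped to the standard basis by `coneEquiv`. -/
def coneBasis : Module.Basis (Fin 8) ℝ (ℝ × Euc 7) :=
  (EuclideanSpace.basisFun (Fin 8) ℝ).toBasis.map (coneEquiv u c hc).symm.toLinearEquiv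

theorem coneEquiv_coneBasis (i : Fin 8) :
    coneEquiv u c hc (coneBasis u c hc i) = EuclideanSpace.single i 1 := by
  simp [coneBasis]

theorem coneBasis_seven : coneBasis u c hc 7 = (1, 0) := by
  apply (coneEquiv u c hc).injective
  rw [coneEquiv_coneBasis]
  ext i
  refine Fin.lastCases ?_ (fun i => ?_) i
  · exact (coneEquiv_apply_seven u c hc _).symm ▸ (by simp)
  · rw [coneEquiv_apply_castSucc]
    simp [Fin.ext_iff, i.isLt.ne]

theorem coneBasis_castSucc (i : Fin 7) :
    coneBasis u c hc i.castSucc = (0, c⁻¹ • u.symm (EuclideanSpace.single i 1)) := by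
  apply (coneEquiv u c hc).injective
  rw [coneEquiv_coneBasis]
  ext j
  refine Fin.lastCases ?_ (fun j => ?_) j
  · exact (coneEquiv_apply_seven u c hc _).symm ▸ (by simp [Fin.ext_iff, i.isLt.ne'])
  · rw [coneEquiv_apply_castSucc]
    simp [hc]

end Model

/-! ### Warped structures are `Spin(7)`-structures; the `dt`-part of their torsion. -/

section Structure

variable {M : Type*} [TopologicalSpace M] [ChartedSpace (Euc 7) M]

theorem contDiffAt_coneForm {E : Type*} [NormedAddCommGroup E] [NormedSpace ℝ E] {f : ℝ → ℝ}
    {φ : E → E [⋀^Fin 3]→L[ℝ] ℝ} {ψ : E → E [⋀^Fin 4]→L[ℝ] ℝ} {y : ℝ × E}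
    (hf : ContDiffAt ℝ ∞ f y.1) (hφ : ContDiffAt ℝ ∞ φ y.2) (hψ : ContDiffAt ℝ ∞ ψ y.2) :
    ContDiffAt ℝ ∞ (coneForm f φ ψ) y := by
  have hf1 : ContDiffAt ℝ ∞ (fun y : ℝ × E => f y.1) y := hf.comp y contDiffAt_fst
  have hφ1 : ContDiffAt ℝ ∞ (fun y : ℝ × E => φ y.2) y := hφ.comp y contDiffAt_snd
  have hψ1 : ContDiffAt ℝ ∞ (fun y : ℝ × E => ψ y.2) y := hψ.comp y contDiffAt_snd
  rw [coneForm_eq]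
  refine ContDiffAt.add (ContDiffAt.smul (hf1.pow 3).neg ?_) (ContDiffAt.smul (hf1.pow 4) ?_)
  · exact ((wedgeCLM 3 (.fst ℝ ℝ E)).comp
      (compContinuousLinearMapCLM (F := ℝ) (.snd ℝ ℝ E))).contDiff.contDiffAt.comp y hφ1
  · exact (compContinuousLinearMapCLM (F := ℝ) (.snd ℝ ℝ E)).contDiff.contDiffAt.comp y hψ1

/-- Pulling back bilinear forms along the second projection, as a continuous linear map. -/
def pullBilin (E : Type*) [NormedAddCommGroup E] [NormedSpace ℝ E] :
    (E →L[ℝ] E →L[ℝ] ℝ) →L[ℝ] ((ℝ × E) →L[ℝ] (ℝ × E) →L[ℝ] ℝ) :=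
  (ContinuousLinearMap.precomp ((ℝ × E) →L[ℝ] ℝ) (.snd ℝ ℝ E)).comp
    (ContinuousLinearMap.postcomp E (ContinuousLinearMap.precomp ℝ (.snd ℝ ℝ E)))

theorem contDiffAt_coneMetric {E : Type*} [NormedAddCommGroup E] [NormedSpace ℝ E] {f : ℝ → ℝ}
    {k : E → E →L[ℝ] E →L[ℝ] ℝ} {y : ℝ × E}
    (hf : ContDiffAt ℝ ∞ f y.1) (hk : ContDiffAt ℝ ∞ k y.2) :
    ContDiffAt ℝ ∞ (coneMetric f k) y := by
  have hf1 : ContDiffAt ℝ ∞ (fun y : ℝ × E => f y.1) y := hf.comp y contDiffAt_fst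
  have hk1 : ContDiffAt ℝ ∞ (fun y : ℝ × E => k y.2) y := hk.comp y contDiffAt_snd
  exact ((hf1.pow 2).smul ((pullBilin E).contDiff.contDiffAt.comp y hk1)).add contDiffAt_const

theorem isSpin7StructureOn_warped [IsManifold (𝓡 7) 1 M] (S : G2Structure M) {J : Set ℝ}
    {f : ℝ → ℝ} (hJ : IsWarping J f) :
    IsSpin7StructureOn modelN (warpedForm S f) (warpedMetric S f) (J ×ˢ Set.univ) := by
  have hf : ∀ p : ℝ × M, p ∈ J ×ˢ (Set.univ : Set M) → ContDiffAt ℝ ∞ f p.1 := fun p hp =>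
    hJ.smooth.contDiffAt (hJ.isOpen.mem_nhds hp.1)
  refine ⟨fun p hp => ?_, fun p hp => ?_, fun p hp => ?_⟩
  · rw [extChartAt_modelN_self]
    exact (contDiffAt_coneForm (y := (p.1, extChartAt (𝓡 7) p.2 p.2)) (hf p hp)
      (S.smooth_form p.2 trivial)
      (S.smooth_dual p.2 trivial)).congr_of_eventuallyEq (localForm_warpedForm_eventuallyEq S f p)
  · rw [extChartAt_modelN_self]
    exact (contDiffAt_coneMetric (y := (p.1, extChartAt (𝓡 7) p.2 p.2)) (hf p hp)
      (S.smooth_metric p.2 trivial)).congr_of_eventuallyEq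
        (localBilin_warpedMetric_eventuallyEq S f p)
  · obtain ⟨u, h1, h2, h3⟩ := S.adapted p.2
    refine ⟨coneEquiv u (f p.1) (hJ.ne_zero _ hp.1), ?_, fun v w => ?_⟩
    · rw [Phi0_comp_coneEquiv, warpedForm_eq, h1, h2]
    · rw [inner_coneEquiv, warpedMetric_apply, h3]

theorem isOrthonormalBasis_coneBasis (S : G2Structure M) (f : ℝ → ℝ) (p : ℝ × M)
    (u : Euc 7 ≃L[ℝ] Euc 7) (hu : ∀ v w, S.metric p.2 v w = inner ℝ (u v) (u w))
    (hc : f p.1 ≠ 0) : IsOrthonormalBasis (warpedMetric S f p) (coneBasis u (f p.1) hc) := by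
  intro i j
  rw [warpedMetric_apply, hu, ← inner_coneEquiv u (f p.1) hc, coneEquiv_coneBasis,
    coneEquiv_coneBasis, EuclideanSpace.inner_single_left]
  simp

/-- The projection to `ℝ⁷` of the frame of the cone, normalized independently of the
warping function. -/
def fiberFrame (u : Euc 7 ≃L[ℝ] Euc 7) : Fin 8 → Euc 7 :=
  Fin.snoc (α := fun _ => Euc 7) (fun i : Fin 7 => u.symm (EuclideanSpace.single i 1)) 0

theorem snd_coneBasis (u : Euc 7 ≃L[ℝ] Euc 7) (c : ℝ) (hc : c ≠ 0) (i : Fin 8) :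
    (coneBasis u c hc i).2 = c⁻¹ • fiberFrame u i := by
  refine Fin.lastCases ?_ (fun i => ?_) i
  · have h7 : Fin.last 7 = (7 : Fin 8) := rfl
    simp only [fiberFrame, Fin.snoc_last, smul_zero]
    rw [h7, coneBasis_seven]
  · rw [coneBasis_castSucc, fiberFrame, Fin.snoc_castSucc]

theorem fst_coneBasis (u : Euc 7 ≃L[ℝ] Euc 7) (c : ℝ) (hc : c ≠ 0) (i : Fin 8) :
    (coneBasis u c hc i).1 = if i = 7 then 1 else 0 := by
  refine Fin.lastCases ?_ (fun i => ?_) i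
  · have h7 : Fin.last 7 = (7 : Fin 8) := rfl
    rw [h7, coneBasis_seven, if_pos rfl]
  · rw [coneBasis_castSucc, if_neg]
    simp [Fin.ext_iff, i.isLt.ne]

theorem fiberFrame_seven (u : Euc 7 ≃L[ℝ] Euc 7) : fiberFrame u 7 = 0 :=
  Fin.snoc_last (α := fun _ => Euc 7) _ _

/-- The scalar product of `dt ∧ Φ` with `dΦ`. -/
theorem formInner_dt_wedge_warpedForm [IsManifold (𝓡 7) 1 M] (S : G2Structure M) {f : ℝ → ℝ}
    {f' : ℝ} (p : ℝ × M) (hf : HasDerivAt f f' p.1) (u : Euc 7 ≃L[ℝ] Euc 7) (hc : f p.1 ≠ 0) :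
    formInner (coneBasis u (f p.1) hc) (wedge (.fst ℝ ℝ (Euc 7)) (warpedForm S f p))
      (dForm modelN (warpedForm S f) p) =
      (1 / (Nat.factorial 4 : ℝ)) * (f p.1)⁻¹ * ∑ i : Fin 4 → Fin 8,
        S.dual p.2 (fun a => fiberFrame u (i a)) *
          (dForm (𝓡 7) S.form p.2 (fun a => fiberFrame u (i a)) +
            4 * f' * S.dual p.2 (fun a => fiberFrame u (i a))) := by
  set b := coneBasis u (f p.1) hc with hb
  set c := f p.1 with hcdef
  have hscale : ∀ {k : ℕ} (η : Euc 7 [⋀^Fin k]→L[ℝ] ℝ) (i : Fin k → Fin 8),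
      η (fun a => (b (i a)).2) = c⁻¹ ^ k * η (fun a => fiberFrame u (i a)) := fun {k} η i => by
    simp only [hb, snd_coneBasis]
    have := η.toMultilinearMap.map_smul_univ (fun _ => c⁻¹) (fun a => fiberFrame u (i a))
    simpa using this
  -- `b 7 = ∂t` is the only frame vector on which `dt` does not vanish.
  rw [formInner_wedge, Finset.sum_eq_single 7]
  rotate_left
  · intro j _ hj
    have : ContinuousLinearMap.fst ℝ ℝ (Euc 7) (b j) = 0 := by
      rw [ContinuousLinearMap.coe_fst', hb, fst_coneBasis, if_neg hj]
    rw [this, zero_mul]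
  · simp
  have h7 : b 7 = (1, 0) := coneBasis_seven u c hc
  rw [h7, ContinuousLinearMap.coe_fst', one_mul, formInner, mul_assoc]
  congr 1
  rw [Finset.mul_sum]
  refine Finset.sum_congr rfl fun i _ => ?_
  -- If the index 7 occurs, the fiber frame contains a zero vector and the five-form receives `∂t`
  -- twice, so both sides vanish. Otherwise `dt` vanishes on all the arguments, and the powers of
  -- `f` cancel against the scaling of the frame, up to one factor `f⁻¹`.
  by_cases hi : ∃ a, i a = 7
  · obtain ⟨a, ha⟩ := hi
    have hz : ∀ η : Euc 7 [⋀^Fin 4]→L[ℝ] ℝ, η (fun a => fiberFrame u (i a)) = 0 := fun η =>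
      η.map_coord_zero a (by rw [ha, fiberFrame_seven])
    have hz2 : (dForm modelN (warpedForm S f) p).curryLeft (1, 0) (fun a => b (i a)) = 0 := by
      rw [curryLeft_apply_apply]
      refine map_eq_zero_of_eq _ _ (i := 0) (j := a.succ) ?_ (Fin.succ_ne_zero a).symm
      simp [ha, h7]
    rw [hz, hz2]
    ring
  · push Not at hi
    have hfst : ∀ a, (b (i a)).1 = 0 := fun a => by
      rw [hb, fst_coneBasis, if_neg (hi a)]
    have hΦ : warpedForm S f p (fun a => b (i a)) = S.dual p.2 (fun a => fiberFrame u (i a)) := by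
      rw [warpedForm_eq]
      simp only [ContinuousAlternatingMap.add_apply, ContinuousAlternatingMap.smul_apply,
        wedgeRight, wedge_apply, ContinuousLinearMap.coe_fst', hfst, zero_mul, mul_zero,
        Finset.sum_const_zero, smul_zero, zero_add]
      have := hscale (S.dual p.2) i
      change c ^ 4 * S.dual p.2 (fun a => (b (i a)).2) = _
      rw [this]
      field_simp
    have hd : (dForm modelN (warpedForm S f) p).curryLeft (1, 0) (fun a => b (i a)) =
        c⁻¹ * (dForm (𝓡 7) S.form p.2 (fun a => fiberFrame u (i a)) +
            4 * f' * S.dual p.2 (fun a => fiberFrame u (i a))) := by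
      rw [dForm_warpedForm S p hf, curryLeft_apply_apply, ContinuousAlternatingMap.add_apply,
        ContinuousAlternatingMap.smul_apply, wedge_apply, Fin.sum_univ_succ]
      have e1 : ∀ η : Euc 7 [⋀^Fin 5]→L[ℝ] ℝ, (η.compContinuousLinearMap (.snd ℝ ℝ (Euc 7)))
          (Matrix.vecCons (1, 0) fun a => b (i a)) = 0 := fun η =>
        η.map_coord_zero 0 rfl
      rw [e1]
      simp only [Matrix.cons_val_zero, Matrix.cons_val_succ, ContinuousLinearMap.coe_fst', hfst,
        zero_mul, mul_zero, Finset.sum_const_zero, smul_zero, add_zero, Fin.val_zero, pow_zero,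
        one_mul]
      have e2 := hscale (c ^ 3 • dForm (𝓡 7) S.form p.2 + (4 * c ^ 3 * f') • S.dual p.2) i
      refine Eq.trans ?_ (e2.trans ?_)
      · rfl
      · simp only [ContinuousAlternatingMap.add_apply, ContinuousAlternatingMap.smul_apply,
          smul_eq_mul]
        field_simp
    rw [hΦ, hd]
    ring

end Structure

/-! ### Levi-Civita connection and curvature in a chart. -/

section Curvature

variable {E : Type*} [NormedAddCommGroup E] [NormedSpace ℝ E]

theorem isInvertible_of_nondegenerate [FiniteDimensional ℝ E] {g : E →L[ℝ] E →L[ℝ] ℝ} (hg : ∀ v, g v = 0 → v = 0) :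
    g.IsInvertible := by
  have hinj : Function.Injective (g : E →ₗ[ℝ] E →L[ℝ] ℝ) :=
    (injective_iff_map_eq_zero _).mpr hg
  have hdim : Module.finrank ℝ E = Module.finrank ℝ (E →L[ℝ] ℝ) := by
    rw [← Subspace.dual_finrank_eq (K := ℝ) (V := E)]
    exact LinearEquiv.finrank_eq LinearMap.toContinuousLinearMap
  refine ⟨(LinearMap.linearEquivOfInjective (g : E →ₗ[ℝ] E →L[ℝ] ℝ) hinj
    hdim).toContinuousLinearEquiv, ?_⟩
  ext v w
  rfl

theorem christoffel_apply (g : E → E →L[ℝ] E →L[ℝ] ℝ) (y u v : E) :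
    christoffel g y u v = (g y).inverse (koszul g y u v) := rfl

/-- By nondegeneracy a guessed Christoffel symbol need only be checked against the Koszul formula;
no metric is ever inverted explicitly. -/
theorem christoffel_eq {g : E → E →L[ℝ] E →L[ℝ] ℝ} {y : E} (hg : (g y).IsInvertible) {u v z : E}
    (h : ∀ w, g y z w = koszul g y u v w) : christoffel g y u v = z := by
  have h' : koszul g y u v = g y z := by
    ext w
    exact (h w).symm
  obtain ⟨e, he⟩ := hg
  rw [christoffel_apply, h', ← he, ContinuousLinearMap.inverse_equiv]
  exact e.symm_apply_apply z

theorem contDiffAt_koszul {g : E → E →L[ℝ] E →L[ℝ] ℝ} {y : E} (hg : ContDiffAt ℝ 2 g y) :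
    ContDiffAt ℝ 1 (koszul g) y := by
  have hD : ContDiffAt ℝ 1 (fderiv ℝ g) y := hg.fderiv_right (by norm_num)
  have hfl : ContDiffAt ℝ 1 (fun z => (fderiv ℝ g z).flip) y :=
    (ContinuousLinearMap.flipₗᵢ ℝ E E (E →L[ℝ] ℝ)).toContinuousLinearEquiv.contDiff.contDiffAt.comp
      y hD
  have hF := (ContinuousLinearMap.compL ℝ E (E →L[ℝ] E →L[ℝ] ℝ) (E →L[ℝ] E →L[ℝ] ℝ)
    ((ContinuousLinearMap.flipₗᵢ ℝ E E ℝ).toContinuousLinearEquiv :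
      (E →L[ℝ] E →L[ℝ] ℝ) →L[ℝ] (E →L[ℝ] E →L[ℝ] ℝ))).contDiff.contDiffAt.comp y hfl
  exact ((hD.add hfl).sub hF).const_smul (1 / 2 : ℝ)

theorem differentiableAt_christoffel [FiniteDimensional ℝ E] {g : E → E →L[ℝ] E →L[ℝ] ℝ} {y : E}
    (hg : ContDiffAt ℝ 2 g y) (hinv : (g y).IsInvertible) :
    DifferentiableAt ℝ (christoffel g) y := by
  have h1 : ContDiffAt ℝ 1 (fun z => (g z).inverse) y :=
    hinv.contDiffAt_map_inverse.comp y (hg.of_le (by norm_num))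
  have h2 := (ContinuousLinearMap.compL ℝ E (E →L[ℝ] ℝ) E).contDiff.contDiffAt.comp y h1
  exact (h2.clm_comp (contDiffAt_koszul hg)).differentiableAt (by norm_num)

theorem fderiv_christoffel_apply {g : E → E →L[ℝ] E →L[ℝ] ℝ} {y : E}
    (h : DifferentiableAt ℝ (christoffel g) y) (u v w : E) :
    fderiv ℝ (christoffel g) y u v w = fderiv ℝ (fun z => christoffel g z v w) y u := by
  have h1 : HasFDerivAt (fun z => christoffel g z v w) _ y :=
    (h.hasFDerivAt.clm_apply (hasFDerivAt_const v y)).clm_apply (hasFDerivAt_const w y)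
  rw [h1.fderiv]
  simp

/-- Replaces the derivative of the tensor by derivatives of its scalar components, for which
explicit formulas are available. -/
theorem koszul_eq_of_hasFDerivAt {g : E → E →L[ℝ] E →L[ℝ] ℝ} {y : E}
    (hg : DifferentiableAt ℝ g y) (u v w : E) :
    koszul g y u v w = (1 / 2) * (fderiv ℝ (fun z => g z v w) y u +
      fderiv ℝ (fun z => g z u w) y v - fderiv ℝ (fun z => g z u v) y w) := by
  have h1 : ∀ a b c : E, fderiv ℝ g y a b c = fderiv ℝ (fun z => g z b c) y a := by
    intro a b c
    have h1 : HasFDerivAt (fun z => g z b c) _ y :=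
      (hg.hasFDerivAt.clm_apply (hasFDerivAt_const b y)).clm_apply (hasFDerivAt_const c y)
    rw [h1.fderiv]
    simp
  rw [koszul_apply, h1, h1, h1]

/-- Curvature depends only on the germ of the metric. The chart expression of a warped metric is
known to be a cone metric only near the point. -/
theorem ricci_congr {g g' : E → E →L[ℝ] E →L[ℝ] ℝ} {y : E} (h : g =ᶠ[nhds y] g') (v w : E) :
    ricci g y v w = ricci g' y v w := by
  have hΓ : christoffel g =ᶠ[nhds y] christoffel g' := by
    filter_upwards [h.eventuallyEq_nhds] with z hz
    simp only [christoffel, koszul]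
    rw [hz.fderiv_eq, hz.eq_of_nhds]
  rw [ricci, ricci]
  congr 1
  ext u
  simp only [curvatureEnd, curvature, LinearMap.coe_mk, AddHom.coe_mk]
  rw [hΓ.fderiv_eq, hΓ.eq_of_nhds]

theorem scalarCurvature_eq_of_ricci [FiniteDimensional ℝ E] {g : E → E →L[ℝ] E →L[ℝ] ℝ} {y : E} {c : ℝ}
    (hinv : (g y).IsInvertible) (hsymm : ∀ v w, g y v w = g y w v)
    (h : ∀ v w, ricci g y v w = c * g y v w) :
    scalarCurvature g y = c * Module.finrank ℝ E := by
  obtain ⟨e, he⟩ := hinv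
  have hterm : ∀ i, ricci g y (Module.finBasis ℝ E i)
      ((g y).inverse (LinearMap.toContinuousLinearMap ((Module.finBasis ℝ E).coord i))) = c := by
    intro i
    rw [h, hsymm, ← he, ContinuousLinearMap.inverse_equiv]
    simp
  simp [scalarCurvature, hterm, mul_comm]

theorem eventually_isInvertible [FiniteDimensional ℝ E] {g : E → E →L[ℝ] E →L[ℝ] ℝ} {y : E} (hg : ContinuousAt g y)
    (hinv : (g y).IsInvertible) : ∀ᶠ z in nhds y, (g z).IsInvertible := by
  obtain ⟨e, he⟩ := hinv
  have h := hg.preimage_mem_nhds (by rw [← he]; exact e.nhds)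
  filter_upwards [h] with z hz
  obtain ⟨e', he'⟩ := hz
  exact ⟨e', he'⟩

end Curvature

/-! ### Ricci curvature of a warped product in the direction `∂t`. -/

section RadialRicci

variable {E : Type*} [NormedAddCommGroup E] [NormedSpace ℝ E]

theorem isInvertible_coneMetric [FiniteDimensional ℝ E] {f : ℝ → ℝ} {k : E → E →L[ℝ] E →L[ℝ] ℝ} {y : ℝ × E}
    (hf : f y.1 ≠ 0) (hk : ∀ v, k y.2 v = 0 → v = 0) : (coneMetric f k y).IsInvertible := by
  refine isInvertible_of_nondegenerate fun v hv => ?_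
  have h : ∀ w : ℝ × E, f y.1 ^ 2 * k y.2 v.2 w.2 + v.1 * w.1 = 0 := fun w => by
    rw [← coneMetric_apply, hv]
    rfl
  have h1 := h (1, 0)
  simp only [_root_.map_zero, mul_zero, zero_add, mul_one] at h1
  refine Prod.ext h1 (hk _ ?_)
  ext w
  have h2 := h (0, w)
  simpa [hf] using h2

theorem fderiv_coneMetric_dt {f : ℝ → ℝ} {f' : ℝ} {k : E → E →L[ℝ] E →L[ℝ] ℝ} {y : ℝ × E}
    (hf : HasDerivAt f f' y.1) (hg : DifferentiableAt ℝ (coneMetric f k) y) (v w : ℝ × E) :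
    fderiv ℝ (fun z => coneMetric f k z v w) y (1, 0) = 2 * f y.1 * f' * k y.2 v.2 w.2 := by
  have h1 : DifferentiableAt ℝ (fun z => coneMetric f k z v w) y :=
    (hg.clm_apply (differentiableAt_const v)).clm_apply (differentiableAt_const w)
  have hline : HasDerivAt (fun s : ℝ => (s, y.2)) ((1 : ℝ), (0 : E)) y.1 :=
    (hasDerivAt_id y.1).prodMk (hasDerivAt_const y.1 y.2)
  have h2 : HasDerivAt (fun s : ℝ => coneMetric f k (s, y.2) v w)
      (fderiv ℝ (fun z => coneMetric f k z v w) y (1, 0)) y.1 :=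
    HasFDerivAt.comp_hasDerivAt (f := fun s : ℝ => (s, y.2)) y.1 h1.hasFDerivAt hline
  have h3 : HasDerivAt (fun s : ℝ => f s ^ 2 * k y.2 v.2 w.2 + v.1 * w.1)
      (2 * f y.1 * f' * k y.2 v.2 w.2) y.1 :=
    (((hf.pow 2).mul_const (k y.2 v.2 w.2)).add_const (v.1 * w.1)).congr_deriv (by norm_num)
  exact h2.unique h3

theorem fderiv_coneMetric_dt_left (f : ℝ → ℝ) (k : E → E →L[ℝ] E →L[ℝ] ℝ) (y u w : ℝ × E) :
    fderiv ℝ (fun z => coneMetric f k z (1, 0) w) y u = 0 := by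
  have : (fun z => coneMetric f k z (1, 0) w) = fun _ => w.1 := by
    funext z
    simp [coneMetric_apply]
  rw [this, fderiv_const_apply]
  rfl

theorem fderiv_coneMetric_dt_right (f : ℝ → ℝ) (k : E → E →L[ℝ] E →L[ℝ] ℝ) (y u w : ℝ × E) :
    fderiv ℝ (fun z => coneMetric f k z w (1, 0)) y u = 0 := by
  have : (fun z => coneMetric f k z w (1, 0)) = fun _ => w.1 := by
    funext z
    simp [coneMetric_apply]
  rw [this, fderiv_const_apply]
  rfl

/-- The components `g(∂t, ·)` are constant, so only the `t`-derivative `2 f f' k` survives in the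
Koszul formula and no derivative of the fiber metric enters. -/
theorem christoffel_coneMetric_dt_right {f : ℝ → ℝ} {f' : ℝ} {k : E → E →L[ℝ] E →L[ℝ] ℝ}
    {y : ℝ × E} (hf : HasDerivAt f f' y.1) (hf0 : f y.1 ≠ 0)
    (hg : DifferentiableAt ℝ (coneMetric f k) y) (hinv : (coneMetric f k y).IsInvertible)
    (u : ℝ × E) :
    christoffel (coneMetric f k) y u (1, 0) = (0, (f' / f y.1) • u.2) := by
  refine christoffel_eq hinv fun w => ?_
  rw [koszul_eq_of_hasFDerivAt hg, fderiv_coneMetric_dt_left, fderiv_coneMetric_dt_right,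
    fderiv_coneMetric_dt hf hg, coneMetric_apply]
  simp only [map_smul, _root_.smul_apply, smul_eq_mul]
  field_simp
  ring

theorem christoffel_coneMetric_dt_left {f : ℝ → ℝ} {f' : ℝ} {k : E → E →L[ℝ] E →L[ℝ] ℝ}
    {y : ℝ × E} (hf : HasDerivAt f f' y.1) (hf0 : f y.1 ≠ 0)
    (hg : DifferentiableAt ℝ (coneMetric f k) y) (hinv : (coneMetric f k y).IsInvertible)
    (u : ℝ × E) :
    christoffel (coneMetric f k) y (1, 0) u = (0, (f' / f y.1) • u.2) := by
  refine christoffel_eq hinv fun w => ?_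
  rw [koszul_eq_of_hasFDerivAt hg, fderiv_coneMetric_dt_left, fderiv_coneMetric_dt_left,
    fderiv_coneMetric_dt hf hg, coneMetric_apply]
  simp only [map_smul, _root_.smul_apply, smul_eq_mul]
  field_simp
  ring

/-- The radial Ricci curvature of a warped product vanishes where the warping function is
affine. -/
theorem ricci_coneMetric_dt_dt [FiniteDimensional ℝ E] {f : ℝ → ℝ} {a : ℝ} {k : E → E →L[ℝ] E →L[ℝ] ℝ}
    {y : ℝ × E} (hf : ∀ᶠ t in nhds y.1, HasDerivAt f a t) (hf0 : f y.1 ≠ 0)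
    (hg : ContDiffAt ℝ 2 (coneMetric f k) y) (hinv : (coneMetric f k y).IsInvertible) :
    ricci (coneMetric f k) y (1, 0) (1, 0) = 0 := by
  have hfy : HasDerivAt f a y.1 := hf.self_of_nhds
  have hgd : DifferentiableAt ℝ (coneMetric f k) y := hg.differentiableAt (by norm_num)
  -- `R(u, ∂t)∂t` involves only Christoffel symbols with one argument `∂t`, so it is the same for
  -- every fiber metric.
  have hev : ∀ᶠ z in nhds y, ∀ u, christoffel (coneMetric f k) z u (1, 0) =
      (0, (a / f z.1) • u.2) := by
    have e1 : ∀ᶠ z : ℝ × E in nhds y, HasDerivAt f a z.1 := continuous_fst.continuousAt.eventually hf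
    have e2 : ∀ᶠ z : ℝ × E in nhds y, f z.1 ≠ 0 :=
      (hfy.continuousAt.comp continuous_fst.continuousAt).eventually_ne hf0
    have e3 : ∀ᶠ z in nhds y, ContDiffAt ℝ 2 (coneMetric f k) z := hg.eventually (by decide)
    have e4 := eventually_isInvertible hgd.continuousAt hinv
    filter_upwards [e1, e2, e3, e4] with z h1 h2 h3 h4 u
    exact christoffel_coneMetric_dt_right h1 h2 (h3.differentiableAt (by norm_num)) h4 u
  have hΓ := differentiableAt_christoffel hg hinv
  rw [ricci]
  convert map_zero (LinearMap.trace ℝ (ℝ × E))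
  refine LinearMap.ext fun u => ?_
  change curvature (coneMetric f k) y u (1, 0) (1, 0) = 0
  rw [curvature, fderiv_christoffel_apply hΓ, fderiv_christoffel_apply hΓ]
  have d1 : (fun z => christoffel (coneMetric f k) z (1, 0) (1, 0)) =ᶠ[nhds y] fun _ => 0 := by
    filter_upwards [hev] with z hz
    rw [hz]
    simp
  have d2 : (fun z => christoffel (coneMetric f k) z u (1, 0)) =ᶠ[nhds y]
      fun z => (0, (a / f z.1) • u.2) := by
    filter_upwards [hev] with z hz
    rw [hz]
  have hq : HasFDerivAt (fun z : ℝ × E => ((0 : ℝ), (a / f z.1) • u.2)) _ y :=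
    (hasFDerivAt_const (0 : ℝ) y).prodMk
      (((((hasDerivAt_const y.1 a).div hfy hf0).comp_hasFDerivAt y
        (hasFDerivAt_fst (𝕜 := ℝ) (E := ℝ) (F := E) (p := y)))).smul_const u.2)
  -- On the fiber component of `u`, `R(u, ∂t)∂t` acts as `-(f'/f)' - (f'/f)² = -f''/f`, which is
  -- zero for constant `f' = a`.
  rw [d1.fderiv_eq, d2.fderiv_eq, hq.fderiv, d1.eq_of_nhds, hev.self_of_nhds,
    christoffel_coneMetric_dt_left hfy hf0 hgd hinv]
  refine Prod.ext ?_ ?_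
  · simp
  · simp [smul_smul, ← sub_smul, ← neg_smul]
    left
    field_simp
    ring

end RadialRicci

/-! ### Balanced Einstein warped structures cannot have negative scalar curvature. -/

section Nonexistence

variable {M : Type*} [TopologicalSpace M] [ChartedSpace (Euc 7) M]

theorem isInvertible_warpedMetric (S : G2Structure M) {f : ℝ → ℝ} (p : ℝ × M) (hf : f p.1 ≠ 0) :
    (warpedMetric S f p).IsInvertible := by
  obtain ⟨u, -, -, hu⟩ := S.adapted p.2
  refine isInvertible_of_nondegenerate fun v hv => ?_
  have h := warpedMetric_apply S f p v v
  rw [hv, hu, ← inner_coneEquiv u (f p.1) hf] at h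
  exact (coneEquiv u (f p.1) hf).map_eq_zero_iff.mp (inner_self_eq_zero.mp h.symm)

theorem warpedMetric_symm (S : G2Structure M) (f : ℝ → ℝ) (p : ℝ × M) (v w : ℝ × Euc 7) :
    warpedMetric S f p v w = warpedMetric S f p w v := by
  obtain ⟨u, -, -, hu⟩ := S.adapted p.2
  rw [warpedMetric_apply, warpedMetric_apply, hu, hu, real_inner_comm, mul_comm v.1]

theorem psi0_single :
    psi0 (fun a => EuclideanSpace.single (![0, 1, 2, 3] a : Fin 7) (1 : ℝ)) = 1 := by
  simp [psi0, dx_apply, Matrix.det_succ_row_zero, Fin.sum_univ_succ, Fin.succAbove]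

/-- The sum is a positive multiple of `|*φ|²`; the component along `e¹²³⁴` equals 1. Positivity
permits solving the torsion equation for `f'`. -/
theorem sum_dual_sq_pos (S : G2Structure M) (x : M) (u : Euc 7 ≃L[ℝ] Euc 7)
    (hu : S.dual x = psi0.compContinuousLinearMap (u : Euc 7 →L[ℝ] Euc 7)) :
    0 < ∑ i : Fin 4 → Fin 8, S.dual x (fun a => fiberFrame u (i a)) ^ 2 := by
  refine Finset.sum_pos' (fun i _ => sq_nonneg _) ⟨fun a => (![0, 1, 2, 3] a : Fin 7).castSucc,
    Finset.mem_univ _, ?_⟩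
  have h : S.dual x (fun a => fiberFrame u ((![0, 1, 2, 3] a : Fin 7).castSucc)) = 1 := by
    rw [hu, ← psi0_single]
    refine congrArg psi0 (funext fun a => ?_)
    simp [fiberFrame, Fin.snoc_castSucc]
  rw [h]
  norm_num

variable [IsManifold (𝓡 7) 1 M]

instance isManifold_modelN : IsManifold modelN 1 (ℝ × M) :=
  IsManifold.prod (I := 𝓘(ℝ, ℝ)) (I' := 𝓡 7) ℝ M

theorem scalAt_warpedMetric (S : G2Structure M) {f : ℝ → ℝ} {p : ℝ × M} {c : ℝ}
    (hf : f p.1 ≠ 0)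
    (h : ∀ v w, ricciAt modelN (warpedMetric S f) p v w = c * warpedMetric S f p v w) :
    scalAt modelN (warpedMetric S f) p = c * 8 := by
  have hself : localBilin modelN (warpedMetric S f) p (extChartAt modelN p p) =
      warpedMetric S f p := localBilin_self modelN _ p
  rw [scalAt, scalarCurvature_eq_of_ricci (c := c)]
  · norm_num [Module.finrank_prod]
  · rw [hself]
    exact isInvertible_warpedMetric S p hf
  · rw [hself]
    exact warpedMetric_symm S f p
  · rw [hself]
    exact h

theorem ricciAt_dt_dt_eq_zero (S : G2Structure M) {f : ℝ → ℝ} {p : ℝ × M} {a : ℝ}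
    (hf0 : f p.1 ≠ 0) (hsm : ContDiffAt ℝ ∞ f p.1) (hf : ∀ᶠ t in nhds p.1, HasDerivAt f a t) :
    ricciAt modelN (warpedMetric S f) p (1, 0) (1, 0) = 0 := by
  have hev := localBilin_warpedMetric_eventuallyEq S f p
  rw [ricciAt, extChartAt_modelN_self, ricci_congr hev]
  refine ricci_coneMetric_dt_dt hf hf0 ?_ ?_
  · exact (contDiffAt_coneMetric (y := (p.1, extChartAt (𝓡 7) p.2 p.2)) hsm
      (S.smooth_metric p.2 trivial)).of_le ENat.LEInfty.out
  · have h : localBilin modelN (warpedMetric S f) p (extChartAt modelN p p) =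
      warpedMetric S f p := localBilin_self modelN _ p
    rw [extChartAt_modelN_self, hev.eq_of_nhds] at h
    rw [h]
    exact isInvertible_warpedMetric S p hf0

/-- The `dt`-component of the equation `λ₁ = 0`. -/
theorem sum_dual_dForm_of_torsion (S : G2Structure M) {f : ℝ → ℝ} {f' : ℝ} {J : Set ℝ}
    {l₁ : (p : ℝ × M) → ℝ × Euc 7 →L[ℝ] ℝ} {l₅ : FormField (ℝ × Euc 7) (ℝ × M) 5}
    (hT : IsTorsionOn modelN (warpedForm S f) (warpedMetric S f) (J ×ˢ Set.univ) l₁ l₅)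
    {p : ℝ × M} (hp : p.1 ∈ J) (hl : l₁ p = 0) (hf : HasDerivAt f f' p.1) (hc : f p.1 ≠ 0)
    (u : Euc 7 ≃L[ℝ] Euc 7) (hu : ∀ v w, S.metric p.2 v w = inner ℝ (u v) (u w)) :
    ∑ i : Fin 4 → Fin 8, S.dual p.2 (fun a => fiberFrame u (i a)) *
          dForm (𝓡 7) S.form p.2 (fun a => fiberFrame u (i a)) =
      -(4 * f') * ∑ i : Fin 4 → Fin 8, S.dual p.2 (fun a => fiberFrame u (i a)) ^ 2 := by
  obtain ⟨h1, h2⟩ := hT p ⟨hp, trivial⟩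
  have hz : wedge (l₁ p) (warpedForm S f p) = 0 := by
    rw [hl]
    simpa using wedge_smul_left 0 (0 : ℝ × Euc 7 →L[ℝ] ℝ) (warpedForm S f p)
  rw [hz, zero_add] at h1
  rw [← h1] at h2
  -- Since `λ₁ = 0`, `dΦ` itself lies in `Λ⁵₄₈`; it is tested against `dt ∧ Φ`.
  have h3 := h2 _ (isOrthonormalBasis_coneBasis S f p u hu hc) (.fst ℝ ℝ (Euc 7))
  rw [formInner_dt_wedge_warpedForm S p hf u hc] at h3
  have h4 := (mul_eq_zero.mp h3).resolve_left (by positivity)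
  rw [Finset.mul_sum, ← sub_eq_zero, ← Finset.sum_sub_distrib, ← h4]
  exact Finset.sum_congr rfl fun i _ => by ring

end Nonexistence

/-- Vanishing `λ₁` makes `f` affine, an affine `f` makes `Ric(∂t, ∂t)` vanish, and the Einstein
equation then gives scalar curvature zero. -/
theorem not_isEinsteinWarpedSpin7_Y2_neg {M : Type*} [TopologicalSpace M]
    [ChartedSpace (Euc 7) M] [IsManifold (𝓡 7) 1 M] (S : G2Structure M) (J : Set ℝ) (f : ℝ → ℝ) :
    ¬IsEinsteinWarpedSpin7 S J f Spin7Class.Y2 (-1) := by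
  -- The point where `λ₅ ≠ 0` supplies the point `p₀.2` of the fiber at which all computations take
  -- place.
  rintro ⟨hJ, -, ⟨c, hc⟩, hs, l₁, l₅, hT, hl₁, ⟨p₀, -, -⟩⟩
  have hl : ∀ p ∈ J ×ˢ (Set.univ : Set M), l₁ p = 0 := by
    intro p hp
    by_contra hne
    exact hl₁ ⟨p, hp, hne⟩
  obtain ⟨u, -, hu2, hu3⟩ := S.adapted p₀.2
  set Q := ∑ i : Fin 4 → Fin 8, S.dual p₀.2 (fun a => fiberFrame u (i a)) ^ 2 with hQ
  set P := ∑ i : Fin 4 → Fin 8, S.dual p₀.2 (fun a => fiberFrame u (i a)) *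
          dForm (𝓡 7) S.form p₀.2 (fun a => fiberFrame u (i a)) with hP
  have hQpos : 0 < Q := sum_dual_sq_pos S p₀.2 u hu2
  have hsm : ∀ t ∈ J, ContDiffAt ℝ ∞ f t := fun t ht =>
    hJ.smooth.contDiffAt (hJ.isOpen.mem_nhds ht)
  -- `P` and `Q` are computed in a frame of the fiber alone, so they are independent of `t`, and `P
  -- = -4 f'(t) Q` holds for every `t`.
  have hderiv : ∀ t ∈ J, HasDerivAt f (-(P / (4 * Q))) t := by
    intro t ht
    have hd : HasDerivAt f (deriv f t) t := ((hsm t ht).differentiableAt (by simp)).hasDerivAt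
    have h := sum_dual_dForm_of_torsion S hT (p := (t, p₀.2)) ht (hl _ ⟨ht, trivial⟩) hd
      (hJ.ne_zero t ht) u hu3
    have : deriv f t = -(P / (4 * Q)) := by
      have h' : P = -(4 * deriv f t) * Q := h
      rw [h']
      field_simp
    rwa [this] at hd
  obtain ⟨t, ht⟩ := hJ.nonempty
  have hp : ((t, p₀.2) : ℝ × M) ∈ J ×ˢ (Set.univ : Set M) := ⟨ht, trivial⟩
  have hr := ricciAt_dt_dt_eq_zero S (p := (t, p₀.2)) (hJ.ne_zero t ht) (hsm t ht)
    (a := -(P / (4 * Q))) (by filter_upwards [hJ.isOpen.mem_nhds ht] with s hs using hderiv s hs)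
  rw [hc _ hp, warpedMetric_apply] at hr
  have hc0 : c = 0 := by simpa using hr
  have hscal := scalAt_warpedMetric S (p := (t, p₀.2)) (c := c) (hJ.ne_zero t ht) (hc _ hp)
  have := hs _ hp
  rw [hscal, hc0] at this
  simp at this

/-! ### Warped products over the round sphere with constant curvature. -/

section Sphere

/-- The conformal factor `2 / (1 + |x|²)` of the round metric in stereographic coordinates. -/
def stereo {n : ℕ} (x : Euc n) : ℝ := 2 / (1 + ‖x‖ ^ 2)

theorem stereo_pos {n : ℕ} (x : Euc n) : 0 < stereo x := by
  unfold stereo; positivity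

/-- The only relation between the conformal factor and `|x|²`; later computations use it to
eliminate `|x|²`. -/
theorem stereo_mul {n : ℕ} (x : Euc n) : stereo x * inner ℝ x x = 2 - stereo x := by
  have : 1 + ‖x‖ ^ 2 ≠ 0 := by positivity
  rw [stereo, real_inner_self_eq_norm_sq]
  field_simp
  ring

theorem hasFDerivAt_stereo {n : ℕ} (x : Euc n) :
    HasFDerivAt stereo (-(stereo x ^ 2) • innerSL ℝ x) x := by
  have h0 : 1 + ‖x‖ ^ 2 ≠ 0 := by positivity
  have h1 : HasFDerivAt (fun x : Euc n => 1 + ‖x‖ ^ 2) (2 • innerSL ℝ x) x :=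
    ((hasStrictFDerivAt_norm_sq x).hasFDerivAt).const_add 1
  have h2 := (hasDerivAt_inv h0).comp_hasFDerivAt x h1
  have h3 := h2.const_mul 2
  refine (h3.congr_fderiv ?_).congr_of_eventuallyEq (Filter.Eventually.of_forall fun z => ?_)
  · ext v
    simp only [stereo, _root_.smul_apply, smul_eq_mul, nsmul_eq_mul]
    field_simp
    norm_num
  · simp [stereo, div_eq_mul_inv]

theorem contDiff_stereo {n : ℕ} : ContDiff ℝ ∞ (stereo (n := n)) := by
  unfold stereo
  refine contDiff_const.div (contDiff_const.add (contDiff_norm_sq ℝ)) fun x => ?_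
  positivity

/-- The round metric in stereographic coordinates. -/
def roundMetric (n : ℕ) (x : Euc n) : Euc n →L[ℝ] Euc n →L[ℝ] ℝ := stereo x ^ 2 • innerSL ℝ

theorem roundMetric_apply {n : ℕ} (x v w : Euc n) :
    roundMetric n x v w = stereo x ^ 2 * inner ℝ v w := rfl

theorem contDiff_roundMetric {n : ℕ} : ContDiff ℝ ∞ (roundMetric n) :=
  (contDiff_stereo.pow 2).smul contDiff_const

variable {n : ℕ} {f : ℝ → ℝ} {f' : ℝ → ℝ}

/-- The Christoffel symbols of `dt² + f² g`, where `g` is the round metric. -/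
theorem christoffel_coneMetric_round {y : ℝ × Euc n} (hf : HasDerivAt f (f' y.1) y.1)
    (hf0 : f y.1 ≠ 0) (u v : ℝ × Euc n) :
    christoffel (coneMetric f (roundMetric n)) y u v =
      (-(f y.1 * f' y.1 * stereo y.2 ^ 2 * inner ℝ u.2 v.2),
        (f' y.1 / f y.1) • (u.1 • v.2 + v.1 • u.2) -
          stereo y.2 • (inner ℝ y.2 u.2 • v.2 + inner ℝ y.2 v.2 • u.2 -
            inner ℝ u.2 v.2 • y.2)) := by
  have hs := stereo_pos y.2
  have hinv : (coneMetric f (roundMetric n) y).IsInvertible := by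
    refine isInvertible_coneMetric hf0 fun v hv => ?_
    have : roundMetric n y.2 v v = 0 := by rw [hv]; rfl
    rw [roundMetric_apply] at this
    exact inner_self_eq_zero.mp ((mul_eq_zero.mp this).resolve_left (by positivity))
  have hF : HasFDerivAt (fun z : ℝ × Euc n => f z.1)
      (f' y.1 • ContinuousLinearMap.fst ℝ ℝ (Euc n)) y :=
    hf.comp_hasFDerivAt y (hasFDerivAt_fst (𝕜 := ℝ) (E := ℝ) (F := Euc n) (p := y))
  have hS : HasFDerivAt (fun z : ℝ × Euc n => stereo z.2)
      ((-(stereo y.2 ^ 2) • innerSL ℝ y.2).comp (ContinuousLinearMap.snd ℝ ℝ (Euc n))) y :=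
    HasFDerivAt.comp (f := Prod.snd) y (hasFDerivAt_stereo y.2)
      (hasFDerivAt_snd (𝕜 := ℝ) (E := ℝ) (F := Euc n) (p := y))
  have hg : DifferentiableAt ℝ (coneMetric f (roundMetric n)) y := by
    have hk : DifferentiableAt ℝ (fun z : ℝ × Euc n => roundMetric n z.2) y :=
      ((contDiff_roundMetric.differentiable (by simp)) y.2).comp y differentiableAt_snd
    have hk' := ((pullBilin (Euc n)).differentiableAt (x := roundMetric n y.2)).comp y hk
    exact (((hF.differentiableAt.pow 2).smul hk').add (differentiableAt_const _))
  have hd : ∀ a b c : ℝ × Euc n, fderiv ℝ (fun z => coneMetric f (roundMetric n) z b c) y a =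
      2 * f y.1 * stereo y.2 ^ 2 * (f' y.1 * a.1 - f y.1 * stereo y.2 * inner ℝ y.2 a.2) *
        inner ℝ b.2 c.2 := by
    intro a b c
    have h : HasFDerivAt (fun z => coneMetric f (roundMetric n) z b c) _ y :=
      ((hF.pow 2).mul ((hS.pow 2).mul_const (inner ℝ b.2 c.2))).add_const (b.1 * c.1)
    rw [h.fderiv]
    simp
    ring
  refine christoffel_eq hinv fun w => ?_
  rw [koszul_eq_of_hasFDerivAt hg, hd, hd, hd, coneMetric_apply, roundMetric_apply]
  simp only [inner_sub_left, inner_add_left, real_inner_smul_left]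
  rw [real_inner_comm w.2 v.2, real_inner_comm w.2 u.2]
  field_simp
  ring

/-- The metric `dt² + f² g` has constant sectional curvature `K` if `g` is the round metric,
`f'' = -K f` and `(f')² + K f² = 1`. -/
theorem curvature_coneMetric_round {K : ℝ} {y : ℝ × Euc n}
    (hf : ∀ᶠ t in nhds y.1, HasDerivAt f (f' t) t) (hf0 : f y.1 ≠ 0)
    (hf2 : HasDerivAt f' (-(K * f y.1)) y.1) (hK : f' y.1 ^ 2 + K * f y.1 ^ 2 = 1)
    (hsm : ContDiffAt ℝ ∞ f y.1) (u v w : ℝ × Euc n) :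
    curvature (coneMetric f (roundMetric n)) y u v w =
      (K * coneMetric f (roundMetric n) y v w) • u -
        (K * coneMetric f (roundMetric n) y u w) • v := by
  have hfy : HasDerivAt f (f' y.1) y.1 := hf.self_of_nhds
  have hs := stereo_pos y.2
  have hinv : (coneMetric f (roundMetric n) y).IsInvertible := by
    refine isInvertible_coneMetric hf0 fun v hv => ?_
    have : roundMetric n y.2 v v = 0 := by rw [hv]; rfl
    rw [roundMetric_apply] at this
    exact inner_self_eq_zero.mp ((mul_eq_zero.mp this).resolve_left (by positivity))
  have hg2 : ContDiffAt ℝ 2 (coneMetric f (roundMetric n)) y :=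
    (contDiffAt_coneMetric hsm contDiff_roundMetric.contDiffAt).of_le ENat.LEInfty.out
  have hΓ := differentiableAt_christoffel hg2 hinv
  have hev : ∀ᶠ z in nhds y, ∀ a b, christoffel (coneMetric f (roundMetric n)) z a b =
      (-(f z.1 * f' z.1 * stereo z.2 ^ 2 * inner ℝ a.2 b.2),
        (f' z.1 / f z.1) • (a.1 • b.2 + b.1 • a.2) -
          stereo z.2 • (inner ℝ z.2 a.2 • b.2 + inner ℝ z.2 b.2 • a.2 -
            inner ℝ a.2 b.2 • z.2)) := by
    have e1 : ∀ᶠ z : ℝ × Euc n in nhds y, HasDerivAt f (f' z.1) z.1 :=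
      continuous_fst.continuousAt.eventually hf
    have e2 : ∀ᶠ z : ℝ × Euc n in nhds y, f z.1 ≠ 0 :=
      (hfy.continuousAt.comp continuous_fst.continuousAt).eventually_ne hf0
    filter_upwards [e1, e2] with z h1 h2 a b
    exact christoffel_coneMetric_round h1 h2 a b
  have hF : HasFDerivAt (fun z : ℝ × Euc n => f z.1)
      (f' y.1 • ContinuousLinearMap.fst ℝ ℝ (Euc n)) y :=
    hfy.comp_hasFDerivAt y (hasFDerivAt_fst (𝕜 := ℝ) (E := ℝ) (F := Euc n) (p := y))
  have hF' : HasFDerivAt (fun z : ℝ × Euc n => f' z.1)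
      ((-(K * f y.1)) • ContinuousLinearMap.fst ℝ ℝ (Euc n)) y :=
    hf2.comp_hasFDerivAt y (hasFDerivAt_fst (𝕜 := ℝ) (E := ℝ) (F := Euc n) (p := y))
  have hQ : HasFDerivAt (fun z : ℝ × Euc n => f' z.1 / f z.1)
      ((-K - (f' y.1 / f y.1) ^ 2) • ContinuousLinearMap.fst ℝ ℝ (Euc n)) y := by
    refine ((hf2.div hfy hf0).comp_hasFDerivAt y
      (hasFDerivAt_fst (𝕜 := ℝ) (E := ℝ) (F := Euc n) (p := y))).congr_fderiv ?_
    congr 1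
    field_simp
  have hS : HasFDerivAt (fun z : ℝ × Euc n => stereo z.2)
      ((-(stereo y.2 ^ 2) • innerSL ℝ y.2).comp (ContinuousLinearMap.snd ℝ ℝ (Euc n))) y :=
    HasFDerivAt.comp (f := Prod.snd) y (hasFDerivAt_stereo y.2)
      (hasFDerivAt_snd (𝕜 := ℝ) (E := ℝ) (F := Euc n) (p := y))
  have hX : HasFDerivAt (fun z : ℝ × Euc n => z.2) (ContinuousLinearMap.snd ℝ ℝ (Euc n)) y :=
    hasFDerivAt_snd (𝕜 := ℝ) (E := ℝ) (F := Euc n) (p := y)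
  have hI : ∀ a : Euc n, HasFDerivAt (fun z : ℝ × Euc n => inner ℝ z.2 a)
      ((innerSL ℝ a).comp (ContinuousLinearMap.snd ℝ ℝ (Euc n))) y := fun a => by
    have := HasFDerivAt.comp (f := Prod.snd) y (innerSL ℝ a).hasFDerivAt hX
    refine this.congr_of_eventuallyEq (Filter.Eventually.of_forall fun z => ?_)
    exact real_inner_comm _ _
  -- Here `f'' = -K f` has been inserted: `(f f')' = f'² - K f²` and `(f'/f)' = -K - (f'/f)²`.
  have hdΓ : ∀ a b c : ℝ × Euc n, fderiv ℝ (christoffel (coneMetric f (roundMetric n))) y a b c =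
      (-((f' y.1 ^ 2 - K * f y.1 ^ 2) * a.1 * stereo y.2 ^ 2 * inner ℝ b.2 c.2 -
          2 * f y.1 * f' y.1 * stereo y.2 ^ 3 * inner ℝ y.2 a.2 * inner ℝ b.2 c.2),
        ((-K - (f' y.1 / f y.1) ^ 2) * a.1) • (b.1 • c.2 + c.1 • b.2) +
          (stereo y.2 ^ 2 * inner ℝ y.2 a.2) • (inner ℝ y.2 b.2 • c.2 + inner ℝ y.2 c.2 • b.2 -
            inner ℝ b.2 c.2 • y.2) -
          stereo y.2 • (inner ℝ b.2 a.2 • c.2 + inner ℝ c.2 a.2 • b.2 -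
            inner ℝ b.2 c.2 • a.2)) := by
    intro a b c
    rw [fderiv_christoffel_apply hΓ]
    have h1 : (fun z => christoffel (coneMetric f (roundMetric n)) z b c) =ᶠ[nhds y] _ :=
      hev.mono fun z hz => hz b c
    have h2 := ((((hF.mul hF').mul (hS.pow 2)).mul_const (inner ℝ b.2 c.2)).neg).prodMk
      ((hQ.smul_const (b.1 • c.2 + c.1 • b.2)).sub
        (hS.smul ((((hI b.2).smul_const c.2).add ((hI c.2).smul_const b.2)).sub
          (hX.const_smul (inner ℝ b.2 c.2)))))
    rw [h1.fderiv_eq]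
    refine (congrArg (fun L : (ℝ × Euc n) →L[ℝ] (ℝ × Euc n) => L a) h2.fderiv).trans ?_
    refine Prod.ext ?_ ?_
    · simp
      ring
    · ext i
      simp
      ring
  rw [curvature, hdΓ, hdΓ, hev.self_of_nhds, hev.self_of_nhds, hev.self_of_nhds,
    hev.self_of_nhds]
  have hr := stereo_mul y.2
  simp only [coneMetric_apply, roundMetric_apply, inner_sub_right, inner_add_right,
    real_inner_smul_right]
  rw [real_inner_comm v.2 u.2, real_inner_comm w.2 u.2, real_inner_comm w.2 v.2]
  refine Prod.ext ?_ ?_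
  · simp only [Prod.fst_add, Prod.fst_sub, Prod.smul_fst, smul_eq_mul]
    rw [real_inner_comm y.2 u.2, real_inner_comm y.2 v.2]
    field_simp
    ring
  · ext i
    simp only [Prod.snd_add, Prod.snd_sub, Prod.smul_snd, PiLp.add_apply, PiLp.sub_apply,
      PiLp.smul_apply, smul_eq_mul]
    rw [real_inner_comm y.2 u.2, real_inner_comm y.2 v.2]
    field_simp
    -- `hr` eliminates `|y|²` from the quadratic terms of the fiber connection, and `hK` matches the
    -- curvature 1 of the fiber with `f'² + K f²`.
    linear_combination
      (-(f y.1 ^ 2 * stereo y.2 * (inner ℝ w.2 v.2 * u.2 i - inner ℝ w.2 u.2 * v.2 i))) * hr -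
      (f y.1 ^ 2 * stereo y.2 ^ 2 * (inner ℝ w.2 v.2 * u.2 i - inner ℝ w.2 u.2 * v.2 i)) * hK

/-- The trace of `u ↦ K g(v, w) u - K g(u, w) v` in dimension `n + 1` is `K (n + 1) g(v, w) - K g(v,
w)`. -/
theorem ricci_coneMetric_round {K : ℝ} {y : ℝ × Euc n}
    (hf : ∀ᶠ t in nhds y.1, HasDerivAt f (f' t) t) (hf0 : f y.1 ≠ 0)
    (hf2 : HasDerivAt f' (-(K * f y.1)) y.1) (hK : f' y.1 ^ 2 + K * f y.1 ^ 2 = 1)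
    (hsm : ContDiffAt ℝ ∞ f y.1) (v w : ℝ × Euc n) :
    ricci (coneMetric f (roundMetric n)) y v w =
      K * n * coneMetric f (roundMetric n) y v w := by
  have hlin : curvatureEnd (coneMetric f (roundMetric n)) y v w =
      (K * coneMetric f (roundMetric n) y v w) • LinearMap.id -
        K • ((coneMetric f (roundMetric n) y).flip w).toLinearMap.smulRight v := by
    refine LinearMap.ext fun u => ?_
    change curvature _ _ _ _ _ = _
    rw [curvature_coneMetric_round hf hf0 hf2 hK hsm]
    simp [smul_smul]
  rw [ricci, hlin, map_sub, map_smul, map_smul, LinearMap.trace_id, LinearMap.trace_smulRight]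
  simp [Module.finrank_prod]
  ring

end Sphere

/-! ### Evaluation of wedge products and constant forms on explicit tuples. -/

section Evaluation

variable {E : Type*} [NormedAddCommGroup E] [NormedSpace ℝ E]

theorem wedge_apply_three (α : E →L[ℝ] ℝ) (η : E [⋀^Fin 2]→L[ℝ] ℝ) (a b c : E) :
    wedge α η ![a, b, c] = α a * η ![b, c] - α b * η ![a, c] + α c * η ![a, b] := by
  have h0 : (0 : Fin 3).removeNth ![a, b, c] = ![b, c] := by ext i; fin_cases i <;> rfl
  have h1 : (1 : Fin 3).removeNth ![a, b, c] = ![a, c] := by ext i; fin_cases i <;> rfl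
  have h2 : (2 : Fin 3).removeNth ![a, b, c] = ![a, b] := by ext i; fin_cases i <;> rfl
  rw [wedge_apply, Fin.sum_univ_three, h0, h1, h2]
  simp
  ring

theorem wedge_apply_four (α : E →L[ℝ] ℝ) (η : E [⋀^Fin 3]→L[ℝ] ℝ) (a b c d : E) :
    wedge α η ![a, b, c, d] = α a * η ![b, c, d] - α b * η ![a, c, d] + α c * η ![a, b, d]
      - α d * η ![a, b, c] := by
  have h0 : (0 : Fin 4).removeNth ![a, b, c, d] = ![b, c, d] := by ext i; fin_cases i <;> rfl
  have h1 : (1 : Fin 4).removeNth ![a, b, c, d] = ![a, c, d] := by ext i; fin_cases i <;> rfl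
  have h2 : (2 : Fin 4).removeNth ![a, b, c, d] = ![a, b, d] := by ext i; fin_cases i <;> rfl
  have h3 : (3 : Fin 4).removeNth ![a, b, c, d] = ![a, b, c] := by ext i; fin_cases i <;> rfl
  rw [wedge_apply, Fin.sum_univ_four, h0, h1, h2, h3]
  simp
  ring

theorem wedge_apply_two (α : E →L[ℝ] ℝ) (η : E [⋀^Fin 1]→L[ℝ] ℝ) (a b : E) :
    wedge α η ![a, b] = α a * η ![b] - α b * η ![a] := by
  have h0 : (0 : Fin 2).removeNth ![a, b] = ![b] := by ext i; fin_cases i; rfl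
  have h1 : (1 : Fin 2).removeNth ![a, b] = ![a] := by ext i; fin_cases i; rfl
  rw [wedge_apply, Fin.sum_univ_two, h0, h1]
  simp
  ring

theorem dx_three {n : ℕ} (i j k : Fin n) (a b c : Euc n) : dx ![i, j, k] ![a, b, c] =
    a i * (b j * c k - b k * c j) - a j * (b i * c k - b k * c i) +
      a k * (b i * c j - b j * c i) := by
  rw [dx_apply, Matrix.det_fin_three]
  simp
  ring

theorem dx_four {n : ℕ} (i j k l : Fin n) (a b c d : Euc n) :
    dx ![i, j, k, l] ![a, b, c, d] =
      a i * dx ![j, k, l] ![b, c, d] - a j * dx ![i, k, l] ![b, c, d] +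
        a k * dx ![i, j, l] ![b, c, d] - a l * dx ![i, j, k] ![b, c, d] := by
  simp only [dx_apply, Matrix.det_succ_row_zero (n := 3), Fin.sum_univ_four]
  simp [Matrix.det_fin_three, Fin.succAbove]
  ring

/-- Alternating maps are determined by their values on increasing tuples of basis vectors. -/
theorem ext_of_strictMono {n k : ℕ} (b : Module.Basis (Fin n) ℝ E) {η ζ : E [⋀^Fin k]→L[ℝ] ℝ}
    (h : ∀ i : Fin k → Fin n, StrictMono i → η (fun a => b (i a)) = ζ (fun a => b (i a))) :
    η = ζ := by
  apply ContinuousAlternatingMap.toAlternatingMap_injective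
  refine Module.Basis.ext_alternating b fun i hi => ?_
  have hs : StrictMono (i ∘ Tuple.sort i) :=
    (Tuple.monotone_sort i).strictMono_of_injective (hi.comp (Tuple.sort i).injective)
  have h1 := h _ hs
  have h2 : ∀ ξ : E [⋀^Fin k]→L[ℝ] ℝ, ξ (fun a => b ((i ∘ Tuple.sort i) a)) =
      Equiv.Perm.sign (Tuple.sort i) • ξ.toAlternatingMap (fun a => b (i a)) := fun ξ =>
    ξ.toAlternatingMap.map_perm (fun a => b (i a)) (Tuple.sort i)
  rw [h2, h2] at h1
  exact smul_left_cancel _ h1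

end Evaluation

/-! ### Component tables of `phi0` and `psi0`, and the cross product. -/

section CrossProduct

/-- The standard basis vectors of `ℝ⁷`. -/
abbrev e (i : Fin 7) : Euc 7 := EuclideanSpace.single i 1

theorem ext_three {η ζ : Euc 7 [⋀^Fin 3]→L[ℝ] ℝ}
    (h : ∀ i j k : Fin 7, i < j → j < k → η ![e i, e j, e k] = ζ ![e i, e j, e k]) : η = ζ := by
  refine ext_of_strictMono (EuclideanSpace.basisFun (Fin 7) ℝ).toBasis fun i hi => ?_
  have hv : (fun a => (EuclideanSpace.basisFun (Fin 7) ℝ).toBasis (i a)) =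
      ![e (i 0), e (i 1), e (i 2)] := by
    funext a
    fin_cases a <;> simp
  rw [hv]
  exact h _ _ _ (hi (by decide)) (hi (by decide))

theorem ext_four {η ζ : Euc 7 [⋀^Fin 4]→L[ℝ] ℝ}
    (h : ∀ i j k l : Fin 7, i < j → j < k → k < l →
      η ![e i, e j, e k, e l] = ζ ![e i, e j, e k, e l]) : η = ζ := by
  refine ext_of_strictMono (EuclideanSpace.basisFun (Fin 7) ℝ).toBasis fun i hi => ?_
  have hv : (fun a => (EuclideanSpace.basisFun (Fin 7) ℝ).toBasis (i a)) =
      ![e (i 0), e (i 1), e (i 2), e (i 3)] := by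
    funext a
    fin_cases a <;> simp
  rw [hv]
  exact h _ _ _ _ (hi (by decide)) (hi (by decide)) (hi (by decide))

/-- The increasing triples of indices. -/
def triples : List (Fin 7 × Fin 7 × Fin 7) :=
  [(0, 1, 2), (0, 1, 3), (0, 1, 4), (0, 1, 5), (0, 1, 6), (0, 2, 3), (0, 2, 4), (0, 2, 5),
   (0, 2, 6), (0, 3, 4), (0, 3, 5), (0, 3, 6), (0, 4, 5), (0, 4, 6), (0, 5, 6), (1, 2, 3),
   (1, 2, 4), (1, 2, 5), (1, 2, 6), (1, 3, 4), (1, 3, 5), (1, 3, 6), (1, 4, 5), (1, 4, 6),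
   (1, 5, 6), (2, 3, 4), (2, 3, 5), (2, 3, 6), (2, 4, 5), (2, 4, 6), (2, 5, 6), (3, 4, 5),
   (3, 4, 6), (3, 5, 6), (4, 5, 6)]

/-- The increasing quadruples of indices. -/
def quadruples : List (Fin 7 × Fin 7 × Fin 7 × Fin 7) :=
  [(0, 1, 2, 3), (0, 1, 2, 4), (0, 1, 2, 5), (0, 1, 2, 6), (0, 1, 3, 4), (0, 1, 3, 5),
   (0, 1, 3, 6), (0, 1, 4, 5), (0, 1, 4, 6), (0, 1, 5, 6), (0, 2, 3, 4), (0, 2, 3, 5),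
   (0, 2, 3, 6), (0, 2, 4, 5), (0, 2, 4, 6), (0, 2, 5, 6), (0, 3, 4, 5), (0, 3, 4, 6),
   (0, 3, 5, 6), (0, 4, 5, 6), (1, 2, 3, 4), (1, 2, 3, 5), (1, 2, 3, 6), (1, 2, 4, 5),
   (1, 2, 4, 6), (1, 2, 5, 6), (1, 3, 4, 5), (1, 3, 4, 6), (1, 3, 5, 6), (1, 4, 5, 6),
   (2, 3, 4, 5), (2, 3, 4, 6), (2, 3, 5, 6), (2, 4, 5, 6), (3, 4, 5, 6)]

theorem mem_triples : ∀ i j k : Fin 7, i < j → j < k → (i, j, k) ∈ triples := by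
  unfold triples; decide

set_option maxRecDepth 4000 in
theorem mem_quadruples : ∀ i j k l : Fin 7, i < j → j < k → k < l →
    (i, j, k, l) ∈ quadruples := by
  unfold quadruples; decide

/-- The cross product of `ℝ⁷`, with `⟨a × b, c⟩ = φ(a, b, c)`. -/
def cross (a b : Euc 7) : Euc 7 := WithLp.toLp 2 fun i => phi0 ![a, b, e i]

theorem phi0_basis :
    phi0 ![e 0, e 1, e 2] = 0 ∧ phi0 ![e 0, e 1, e 3] = 0 ∧ phi0 ![e 0, e 1, e 4] = 0 ∧
    phi0 ![e 0, e 1, e 5] = 0 ∧ phi0 ![e 0, e 1, e 6] = 1 ∧ phi0 ![e 0, e 2, e 3] = 0 ∧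
    phi0 ![e 0, e 2, e 4] = 1 ∧ phi0 ![e 0, e 2, e 5] = 0 ∧ phi0 ![e 0, e 2, e 6] = 0 ∧
    phi0 ![e 0, e 3, e 4] = 0 ∧ phi0 ![e 0, e 3, e 5] = -1 ∧ phi0 ![e 0, e 3, e 6] = 0 ∧
    phi0 ![e 0, e 4, e 5] = 0 ∧ phi0 ![e 0, e 4, e 6] = 0 ∧ phi0 ![e 0, e 5, e 6] = 0 ∧
    phi0 ![e 1, e 2, e 3] = 0 ∧ phi0 ![e 1, e 2, e 4] = 0 ∧ phi0 ![e 1, e 2, e 5] = -1 ∧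
    phi0 ![e 1, e 2, e 6] = 0 ∧ phi0 ![e 1, e 3, e 4] = -1 ∧ phi0 ![e 1, e 3, e 5] = 0 ∧
    phi0 ![e 1, e 3, e 6] = 0 ∧ phi0 ![e 1, e 4, e 5] = 0 ∧ phi0 ![e 1, e 4, e 6] = 0 ∧
    phi0 ![e 1, e 5, e 6] = 0 ∧ phi0 ![e 2, e 3, e 4] = 0 ∧ phi0 ![e 2, e 3, e 5] = 0 ∧
    phi0 ![e 2, e 3, e 6] = 1 ∧ phi0 ![e 2, e 4, e 5] = 0 ∧ phi0 ![e 2, e 4, e 6] = 0 ∧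
    phi0 ![e 2, e 5, e 6] = 0 ∧ phi0 ![e 3, e 4, e 5] = 0 ∧ phi0 ![e 3, e 4, e 6] = 0 ∧
    phi0 ![e 3, e 5, e 6] = 0 ∧ phi0 ![e 4, e 5, e 6] = 1 := by
  refine ⟨?_, ?_, ?_, ?_, ?_, ?_, ?_, ?_, ?_, ?_, ?_, ?_, ?_, ?_, ?_, ?_, ?_, ?_, ?_, ?_, ?_, ?_, ?_, ?_, ?_, ?_, ?_, ?_, ?_, ?_, ?_, ?_, ?_, ?_, ?_⟩ <;>
    simp [phi0, dx_three]

/-- With this and the following tables, identities between contractions of `phi0` and `psi0` become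
polynomial identities in coordinates, one for each increasing tuple of indices. -/
theorem phi0_contract (p : Euc 7) :
    phi0 ![p, e 0, e 1] = p 6 ∧ phi0 ![p, e 0, e 2] = p 4 ∧ phi0 ![p, e 0, e 3] = -p 5 ∧
    phi0 ![p, e 0, e 4] = -p 2 ∧ phi0 ![p, e 0, e 5] = p 3 ∧ phi0 ![p, e 0, e 6] = -p 1 ∧
    phi0 ![p, e 1, e 2] = -p 5 ∧ phi0 ![p, e 1, e 3] = -p 4 ∧ phi0 ![p, e 1, e 4] = p 3 ∧
    phi0 ![p, e 1, e 5] = p 2 ∧ phi0 ![p, e 1, e 6] = p 0 ∧ phi0 ![p, e 2, e 3] = p 6 ∧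
    phi0 ![p, e 2, e 4] = p 0 ∧ phi0 ![p, e 2, e 5] = -p 1 ∧ phi0 ![p, e 2, e 6] = -p 3 ∧
    phi0 ![p, e 3, e 4] = -p 1 ∧ phi0 ![p, e 3, e 5] = -p 0 ∧ phi0 ![p, e 3, e 6] = p 2 ∧
    phi0 ![p, e 4, e 5] = p 6 ∧ phi0 ![p, e 4, e 6] = -p 5 ∧ phi0 ![p, e 5, e 6] = p 4 := by
  refine ⟨?_, ?_, ?_, ?_, ?_, ?_, ?_, ?_, ?_, ?_, ?_, ?_, ?_, ?_, ?_, ?_, ?_, ?_, ?_, ?_, ?_⟩ <;>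
    simp [phi0, dx_three]

theorem psi0_contract (p : Euc 7) :
    psi0 ![p, e 0, e 1, e 2] = -p 3 ∧ psi0 ![p, e 0, e 1, e 3] = p 2 ∧
    psi0 ![p, e 0, e 1, e 4] = -p 5 ∧ psi0 ![p, e 0, e 1, e 5] = p 4 ∧
    psi0 ![p, e 0, e 1, e 6] = 0 ∧ psi0 ![p, e 0, e 2, e 3] = -p 1 ∧
    psi0 ![p, e 0, e 2, e 4] = 0 ∧ psi0 ![p, e 0, e 2, e 5] = -p 6 ∧
    psi0 ![p, e 0, e 2, e 6] = p 5 ∧ psi0 ![p, e 0, e 3, e 4] = -p 6 ∧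
    psi0 ![p, e 0, e 3, e 5] = 0 ∧ psi0 ![p, e 0, e 3, e 6] = p 4 ∧
    psi0 ![p, e 0, e 4, e 5] = -p 1 ∧ psi0 ![p, e 0, e 4, e 6] = -p 3 ∧
    psi0 ![p, e 0, e 5, e 6] = -p 2 ∧ psi0 ![p, e 1, e 2, e 3] = p 0 ∧
    psi0 ![p, e 1, e 2, e 4] = -p 6 ∧ psi0 ![p, e 1, e 2, e 5] = 0 ∧
    psi0 ![p, e 1, e 2, e 6] = p 4 ∧ psi0 ![p, e 1, e 3, e 4] = 0 ∧
    psi0 ![p, e 1, e 3, e 5] = p 6 ∧ psi0 ![p, e 1, e 3, e 6] = -p 5 ∧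
    psi0 ![p, e 1, e 4, e 5] = p 0 ∧ psi0 ![p, e 1, e 4, e 6] = -p 2 ∧
    psi0 ![p, e 1, e 5, e 6] = p 3 ∧ psi0 ![p, e 2, e 3, e 4] = -p 5 ∧
    psi0 ![p, e 2, e 3, e 5] = p 4 ∧ psi0 ![p, e 2, e 3, e 6] = 0 ∧
    psi0 ![p, e 2, e 4, e 5] = -p 3 ∧ psi0 ![p, e 2, e 4, e 6] = p 1 ∧
    psi0 ![p, e 2, e 5, e 6] = p 0 ∧ psi0 ![p, e 3, e 4, e 5] = p 2 ∧
    psi0 ![p, e 3, e 4, e 6] = p 0 ∧ psi0 ![p, e 3, e 5, e 6] = -p 1 ∧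
    psi0 ![p, e 4, e 5, e 6] = 0 := by
  refine ⟨?_, ?_, ?_, ?_, ?_, ?_, ?_, ?_, ?_, ?_, ?_, ?_, ?_, ?_, ?_, ?_, ?_, ?_, ?_, ?_, ?_, ?_, ?_, ?_, ?_, ?_, ?_, ?_, ?_, ?_, ?_, ?_, ?_, ?_, ?_⟩ <;>
    simp [psi0, dx_four, dx_three]

theorem phi0_contract_two (p m : Euc 7) :
    phi0 ![p, m, e 0] = p 1 * m 6 + p 2 * m 4 - p 3 * m 5 - p 4 * m 2 + p 5 * m 3 - p 6 * m 1 ∧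
    phi0 ![p, m, e 1] = -(p 0 * m 6) - p 2 * m 5 - p 3 * m 4 + p 4 * m 3 + p 5 * m 2 + p 6 * m 0 ∧
    phi0 ![p, m, e 2] = -(p 0 * m 4) + p 1 * m 5 + p 3 * m 6 + p 4 * m 0 - p 5 * m 1 - p 6 * m 3 ∧
    phi0 ![p, m, e 3] = p 0 * m 5 + p 1 * m 4 - p 2 * m 6 - p 4 * m 1 - p 5 * m 0 + p 6 * m 2 ∧
    phi0 ![p, m, e 4] = p 0 * m 2 - p 1 * m 3 - p 2 * m 0 + p 3 * m 1 + p 5 * m 6 - p 6 * m 5 ∧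
    phi0 ![p, m, e 5] = -(p 0 * m 3) - p 1 * m 2 + p 2 * m 1 + p 3 * m 0 - p 4 * m 6 + p 6 * m 4 ∧
    phi0 ![p, m, e 6] = p 0 * m 1 - p 1 * m 0 + p 2 * m 3 - p 3 * m 2 + p 4 * m 5 - p 5 * m 4 := by
  refine ⟨?_, ?_, ?_, ?_, ?_, ?_, ?_⟩ <;>
    (simp [phi0, dx_three]; ring)

theorem psi0_contract_two (p m : Euc 7) :
    psi0 ![p, m, e 0, e 1] = p 2 * m 3 - p 3 * m 2 + p 4 * m 5 - p 5 * m 4 ∧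
    psi0 ![p, m, e 0, e 2] = -(p 1 * m 3) + p 3 * m 1 + p 5 * m 6 - p 6 * m 5 ∧
    psi0 ![p, m, e 0, e 3] = p 1 * m 2 - p 2 * m 1 + p 4 * m 6 - p 6 * m 4 ∧
    psi0 ![p, m, e 0, e 4] = -(p 1 * m 5) - p 3 * m 6 + p 5 * m 1 + p 6 * m 3 ∧
    psi0 ![p, m, e 0, e 5] = p 1 * m 4 - p 2 * m 6 - p 4 * m 1 + p 6 * m 2 ∧
    psi0 ![p, m, e 0, e 6] = p 2 * m 5 + p 3 * m 4 - p 4 * m 3 - p 5 * m 2 ∧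
    psi0 ![p, m, e 1, e 2] = p 0 * m 3 - p 3 * m 0 + p 4 * m 6 - p 6 * m 4 ∧
    psi0 ![p, m, e 1, e 3] = -(p 0 * m 2) + p 2 * m 0 - p 5 * m 6 + p 6 * m 5 ∧
    psi0 ![p, m, e 1, e 4] = p 0 * m 5 - p 2 * m 6 - p 5 * m 0 + p 6 * m 2 ∧
    psi0 ![p, m, e 1, e 5] = -(p 0 * m 4) + p 3 * m 6 + p 4 * m 0 - p 6 * m 3 ∧
    psi0 ![p, m, e 1, e 6] = p 2 * m 4 - p 3 * m 5 - p 4 * m 2 + p 5 * m 3 ∧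
    psi0 ![p, m, e 2, e 3] = p 0 * m 1 - p 1 * m 0 + p 4 * m 5 - p 5 * m 4 ∧
    psi0 ![p, m, e 2, e 4] = p 1 * m 6 - p 3 * m 5 + p 5 * m 3 - p 6 * m 1 ∧
    psi0 ![p, m, e 2, e 5] = p 0 * m 6 + p 3 * m 4 - p 4 * m 3 - p 6 * m 0 ∧
    psi0 ![p, m, e 2, e 6] = -(p 0 * m 5) - p 1 * m 4 + p 4 * m 1 + p 5 * m 0 ∧
    psi0 ![p, m, e 3, e 4] = p 0 * m 6 + p 2 * m 5 - p 5 * m 2 - p 6 * m 0 ∧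
    psi0 ![p, m, e 3, e 5] = -(p 1 * m 6) - p 2 * m 4 + p 4 * m 2 + p 6 * m 1 ∧
    psi0 ![p, m, e 3, e 6] = -(p 0 * m 4) + p 1 * m 5 + p 4 * m 0 - p 5 * m 1 ∧
    psi0 ![p, m, e 4, e 5] = p 0 * m 1 - p 1 * m 0 + p 2 * m 3 - p 3 * m 2 ∧
    psi0 ![p, m, e 4, e 6] = p 0 * m 3 + p 1 * m 2 - p 2 * m 1 - p 3 * m 0 ∧
    psi0 ![p, m, e 5, e 6] = p 0 * m 2 - p 1 * m 3 - p 2 * m 0 + p 3 * m 1 := by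
  refine ⟨?_, ?_, ?_, ?_, ?_, ?_, ?_, ?_, ?_, ?_, ?_, ?_, ?_, ?_, ?_, ?_, ?_, ?_, ?_, ?_, ?_⟩ <;>
    (simp [psi0, dx_four, dx_three]; try ring)

end CrossProduct

/-! ### Identities of `G₂`-algebra for the cross product of two vectors. -/

section Identities

theorem cross_apply (p m : Euc 7) (i : Fin 7) : cross p m i = phi0 ![p, m, e i] := rfl

theorem innerSL_single (p : Euc 7) (i : Fin 7) : innerSL ℝ p (e i) = p i := by
  simp [EuclideanSpace.inner_single_right]

theorem forall_triples {P : Fin 7 → Fin 7 → Fin 7 → Prop}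
    (h : ∀ t ∈ triples, P t.1 t.2.1 t.2.2) {i j k : Fin 7} (hij : i < j) (hjk : j < k) :
    P i j k := h _ (mem_triples i j k hij hjk)

theorem forall_quadruples {P : Fin 7 → Fin 7 → Fin 7 → Fin 7 → Prop}
    (h : ∀ t ∈ quadruples, P t.1 t.2.1 t.2.2.1 t.2.2.2) {i j k l : Fin 7} (hij : i < j)
    (hjk : j < k) (hkl : k < l) : P i j k l := h _ (mem_quadruples i j k l hij hjk hkl)

-- This and the next three identities express the contractions and wedges with `y = p × m` through
-- `p` and `m`. They serve to recognise the effect of a rotation of the plane of `p`, `m` on `phi0`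
-- and `psi0` as an expression in `y` alone.
set_option maxHeartbeats 1000000 in
theorem curryLeft_cross_psi0 (p m : Euc 7) :
    psi0.curryLeft (cross p m) =
      wedge (innerSL ℝ p) (phi0.curryLeft m) - wedge (innerSL ℝ m) (phi0.curryLeft p) := by
  refine ext_three fun i j k hij hjk => ?_
  simp only [ContinuousAlternatingMap.sub_apply, wedge_apply_three, curryLeft_apply_apply,
    innerSL_single]
  refine forall_triples (P := fun i j k => psi0 ![cross p m, e i, e j, e k] =
    p i * phi0 ![m, e j, e k] - p j * phi0 ![m, e i, e k] + p k * phi0 ![m, e i, e j] -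
      (m i * phi0 ![p, e j, e k] - m j * phi0 ![p, e i, e k] + m k * phi0 ![p, e i, e j]))
    ?_ hij hjk
  simp only [triples, List.forall_mem_cons, phi0_contract p, phi0_contract m,
    psi0_contract (cross p m), cross_apply p m, phi0_contract_two p m]
  refine ⟨?_, ?_, ?_, ?_, ?_, ?_, ?_, ?_, ?_, ?_, ?_, ?_, ?_, ?_, ?_, ?_, ?_, ?_, ?_, ?_, ?_, ?_,
    ?_, ?_, ?_, ?_, ?_, ?_, ?_, ?_, ?_, ?_, ?_, ?_, ?_, List.forall_mem_nil _⟩ <;> ring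

set_option maxHeartbeats 1000000 in
theorem wedge_cross_phi0 (p m : Euc 7) :
    wedge (innerSL ℝ (cross p m)) phi0 =
      wedge (innerSL ℝ m) (psi0.curryLeft p) - wedge (innerSL ℝ p) (psi0.curryLeft m) := by
  refine ext_four fun i j k l hij hjk hkl => ?_
  simp only [ContinuousAlternatingMap.sub_apply, wedge_apply_four, curryLeft_apply_apply,
    innerSL_single]
  refine forall_quadruples (P := fun i j k l => cross p m i * phi0 ![e j, e k, e l] -
      cross p m j * phi0 ![e i, e k, e l] + cross p m k * phi0 ![e i, e j, e l] -
      cross p m l * phi0 ![e i, e j, e k] =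
    m i * psi0 ![p, e j, e k, e l] - m j * psi0 ![p, e i, e k, e l] +
      m k * psi0 ![p, e i, e j, e l] - m l * psi0 ![p, e i, e j, e k] -
    (p i * psi0 ![m, e j, e k, e l] - p j * psi0 ![m, e i, e k, e l] +
      p k * psi0 ![m, e i, e j, e l] - p l * psi0 ![m, e i, e j, e k])) ?_ hij hjk hkl
  simp only [quadruples, List.forall_mem_cons, phi0_basis, psi0_contract p, psi0_contract m,
    cross_apply p m, phi0_contract_two p m]
  refine ⟨?_, ?_, ?_, ?_, ?_, ?_, ?_, ?_, ?_, ?_, ?_, ?_, ?_, ?_, ?_, ?_, ?_, ?_, ?_, ?_, ?_, ?_,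
    ?_, ?_, ?_, ?_, ?_, ?_, ?_, ?_, ?_, ?_, ?_, ?_, ?_, List.forall_mem_nil _⟩ <;> ring

theorem inner_eq_sum_seven (p m : Euc 7) : inner ℝ p m =
    p 0 * m 0 + p 1 * m 1 + p 2 * m 2 + p 3 * m 3 + p 4 * m 4 + p 5 * m 5 + p 6 * m 6 := by
  simp [PiLp.inner_apply, Fin.sum_univ_seven, mul_comm]

-- The Gram determinant is `|p × m|²`. In the application `p ⟂ m` and `|p| = 1`, so the coefficient
-- on the left is `|y|²`.
set_option maxHeartbeats 2000000 in
theorem gram_smul_phi0 (p m : Euc 7) :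
    (inner ℝ p p * inner ℝ m m - inner ℝ p m ^ 2 : ℝ) • phi0 =
      (inner ℝ m m : ℝ) • wedge (innerSL ℝ p) (phi0.curryLeft p) +
      (inner ℝ p p : ℝ) • wedge (innerSL ℝ m) (phi0.curryLeft m) -
      (inner ℝ p m : ℝ) • (wedge (innerSL ℝ p) (phi0.curryLeft m) +
        wedge (innerSL ℝ m) (phi0.curryLeft p)) +
      wedge (innerSL ℝ (cross p m)) (phi0.curryLeft (cross p m)) -
      (2 : ℝ) • wedge (innerSL ℝ p) (wedge (innerSL ℝ m) ((phi0.curryLeft p).curryLeft m)) := by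
  refine ext_three fun i j k hij hjk => ?_
  simp only [ContinuousAlternatingMap.sub_apply, ContinuousAlternatingMap.add_apply,
    ContinuousAlternatingMap.smul_apply, smul_eq_mul, wedge_apply_three, wedge_apply_two,
    curryLeft_apply_apply, innerSL_single]
  set y := cross p m with hy
  refine forall_triples (P := fun i j k =>
    (inner ℝ p p * inner ℝ m m - inner ℝ p m ^ 2 : ℝ) * phi0 ![e i, e j, e k] =
      inner ℝ m m * (p i * phi0 ![p, e j, e k] - p j * phi0 ![p, e i, e k] +
        p k * phi0 ![p, e i, e j]) +
      inner ℝ p p * (m i * phi0 ![m, e j, e k] - m j * phi0 ![m, e i, e k] +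
        m k * phi0 ![m, e i, e j]) -
      inner ℝ p m * (p i * phi0 ![m, e j, e k] - p j * phi0 ![m, e i, e k] +
        p k * phi0 ![m, e i, e j] + (m i * phi0 ![p, e j, e k] - m j * phi0 ![p, e i, e k] +
        m k * phi0 ![p, e i, e j])) +
      (y i * phi0 ![y, e j, e k] - y j * phi0 ![y, e i, e k] + y k * phi0 ![y, e i, e j]) -
      2 * (p i * (m j * phi0 ![p, m, e k] - m k * phi0 ![p, m, e j]) -
        p j * (m i * phi0 ![p, m, e k] - m k * phi0 ![p, m, e i]) +
        p k * (m i * phi0 ![p, m, e j] - m j * phi0 ![p, m, e i])))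
    ?_ hij hjk
  simp only [triples, List.forall_mem_cons, phi0_basis, phi0_contract p, phi0_contract m,
    phi0_contract y]
  simp only [hy, cross_apply p m, phi0_contract_two p m, inner_eq_sum_seven]
  refine ⟨?_, ?_, ?_, ?_, ?_, ?_, ?_, ?_, ?_, ?_, ?_, ?_, ?_, ?_, ?_, ?_, ?_, ?_, ?_, ?_, ?_, ?_,
    ?_, ?_, ?_, ?_, ?_, ?_, ?_, ?_, ?_, ?_, ?_, ?_, ?_, List.forall_mem_nil _⟩ <;> ring

set_option maxHeartbeats 2000000 in
theorem wedge_cross_psi0 (p m : Euc 7) :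
    wedge (innerSL ℝ (cross p m)) (psi0.curryLeft (cross p m)) =
      (inner ℝ m m : ℝ) • wedge (innerSL ℝ p) (psi0.curryLeft p) +
      (inner ℝ p p : ℝ) • wedge (innerSL ℝ m) (psi0.curryLeft m) -
      (inner ℝ p m : ℝ) • (wedge (innerSL ℝ p) (psi0.curryLeft m) +
        wedge (innerSL ℝ m) (psi0.curryLeft p)) -
      (2 : ℝ) • wedge (innerSL ℝ p) (wedge (innerSL ℝ m) ((psi0.curryLeft p).curryLeft m)) := by
  refine ext_four fun i j k l hij hjk hkl => ?_
  simp only [ContinuousAlternatingMap.sub_apply, ContinuousAlternatingMap.add_apply,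
    ContinuousAlternatingMap.smul_apply, smul_eq_mul, wedge_apply_four, wedge_apply_three,
    curryLeft_apply_apply, innerSL_single]
  set y := cross p m with hy
  refine forall_quadruples (P := fun i j k l =>
    y i * psi0 ![y, e j, e k, e l] - y j * psi0 ![y, e i, e k, e l] +
        y k * psi0 ![y, e i, e j, e l] - y l * psi0 ![y, e i, e j, e k] =
      inner ℝ m m * (p i * psi0 ![p, e j, e k, e l] - p j * psi0 ![p, e i, e k, e l] +
        p k * psi0 ![p, e i, e j, e l] - p l * psi0 ![p, e i, e j, e k]) +
      inner ℝ p p * (m i * psi0 ![m, e j, e k, e l] - m j * psi0 ![m, e i, e k, e l] +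
        m k * psi0 ![m, e i, e j, e l] - m l * psi0 ![m, e i, e j, e k]) -
      inner ℝ p m * (p i * psi0 ![m, e j, e k, e l] - p j * psi0 ![m, e i, e k, e l] +
        p k * psi0 ![m, e i, e j, e l] - p l * psi0 ![m, e i, e j, e k] +
        (m i * psi0 ![p, e j, e k, e l] - m j * psi0 ![p, e i, e k, e l] +
        m k * psi0 ![p, e i, e j, e l] - m l * psi0 ![p, e i, e j, e k])) -
      2 * (p i * (m j * psi0 ![p, m, e k, e l] - m k * psi0 ![p, m, e j, e l] +
          m l * psi0 ![p, m, e j, e k]) -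
        p j * (m i * psi0 ![p, m, e k, e l] - m k * psi0 ![p, m, e i, e l] +
          m l * psi0 ![p, m, e i, e k]) +
        p k * (m i * psi0 ![p, m, e j, e l] - m j * psi0 ![p, m, e i, e l] +
          m l * psi0 ![p, m, e i, e j]) -
        p l * (m i * psi0 ![p, m, e j, e k] - m j * psi0 ![p, m, e i, e k] +
          m k * psi0 ![p, m, e i, e j]))) ?_ hij hjk hkl
  simp only [quadruples, List.forall_mem_cons, psi0_contract p, psi0_contract m,
    psi0_contract y, psi0_contract_two p m]
  simp only [hy, cross_apply p m, phi0_contract_two p m, inner_eq_sum_seven]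
  refine ⟨?_, ?_, ?_, ?_, ?_, ?_, ?_, ?_, ?_, ?_, ?_, ?_, ?_, ?_, ?_, ?_, ?_, ?_, ?_, ?_, ?_, ?_,
    ?_, ?_, ?_, ?_, ?_, ?_, ?_, ?_, ?_, ?_, ?_, ?_, ?_, List.forall_mem_nil _⟩ <;> ring

end Identities

/-! ### Pullback of forms under a perturbation of the identity of rank at most two. -/

section Shear
variable {E : Type*} [NormedAddCommGroup E] [NormedSpace ℝ E]

theorem curryLeft_wedge {k : ℕ} (α : E →L[ℝ] ℝ) (η : E [⋀^Fin (k + 1)]→L[ℝ] ℝ) (a : E) :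
    (wedge α η).curryLeft a = α a • η - wedge α (η.curryLeft a) := by
  ext v
  rw [curryLeft_apply_apply, wedge_apply, Fin.sum_univ_succ]
  simp only [ContinuousAlternatingMap.sub_apply, ContinuousAlternatingMap.smul_apply, wedge_apply]
  have h : ∀ i : Fin (k+1), Fin.removeNth (α := fun _ => E) i.succ (Matrix.vecCons a v) =
      Matrix.vecCons a (Fin.removeNth i v) := by
    intro i
    ext j
    refine Fin.cases ?_ (fun j => ?_) j <;> simp [Fin.removeNth]
  simp [pow_succ, h, sub_eq_add_neg, curryLeft_apply_apply]

theorem curryLeft_self {k : ℕ} (η : E [⋀^Fin (k + 2)]→L[ℝ] ℝ) (a : E) :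
    (η.curryLeft a).curryLeft a = 0 := by
  simp

theorem curryLeft_neg {k : ℕ} (η : E [⋀^Fin (k + 1)]→L[ℝ] ℝ) (a : E) :
    (-η).curryLeft a = -η.curryLeft a := rfl

theorem curryLeft_comm {k : ℕ} (η : E [⋀^Fin (k + 2)]→L[ℝ] ℝ) (a b : E) :
    (η.curryLeft a).curryLeft b = - (η.curryLeft b).curryLeft a := by
  have := curryLeft_self η (a + b)
  simp only [map_add, curryLeft_add, _root_.add_apply, curryLeft_self] at this
  rw [eq_neg_iff_add_eq_zero]
  simpa [add_comm] using this
theorem ext_curryLeft {k : ℕ} {η ζ : E [⋀^Fin (k + 1)]→L[ℝ] ℝ}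
    (h : ∀ a, η.curryLeft a = ζ.curryLeft a) : η = ζ := by
  ext v
  have := congrArg (fun ξ => ξ (Matrix.vecTail v)) (h (Matrix.vecHead v))
  simpa [curryLeft_apply_apply] using this

theorem wedge_zero_right {k : ℕ} (α : E →L[ℝ] ℝ) : wedge α (0 : E [⋀^Fin k]→L[ℝ] ℝ) = 0 :=
  (wedgeCLM k α).map_zero

theorem wedge_neg_right {k : ℕ} (α : E →L[ℝ] ℝ) (η : E [⋀^Fin k]→L[ℝ] ℝ) :
    wedge α (-η) = -wedge α η := (wedgeCLM k α).map_neg η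

theorem wedge_sub_right {k : ℕ} (α : E →L[ℝ] ℝ) (η ζ : E [⋀^Fin k]→L[ℝ] ℝ) :
    wedge α (η - ζ) = wedge α η - wedge α ζ := (wedgeCLM k α).map_sub η ζ

theorem wedge_sub_left {k : ℕ} (α β : E →L[ℝ] ℝ) (η : E [⋀^Fin k]→L[ℝ] ℝ) :
    wedge (α - β) η = wedge α η - wedge β η := by
  rw [sub_eq_add_neg, ← neg_one_smul ℝ β, wedge_add_left, wedge_smul_left]
  module

theorem wedge_wedge_comm {k : ℕ} (α β : E →L[ℝ] ℝ) (η : E [⋀^Fin k]→L[ℝ] ℝ) :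
    wedge α (wedge β η) = -wedge β (wedge α η) := by
  have h := wedge_wedge_self (α + β) η
  simp only [wedge_add_left, wedge_add_right, wedge_wedge_self] at h
  rw [eq_neg_iff_add_eq_zero]
  simpa [add_comm] using h

theorem compContinuousLinearMap_curryLeft {F : Type*} [NormedAddCommGroup F] [NormedSpace ℝ F]
    {k : ℕ} (η : F [⋀^Fin (k + 1)]→L[ℝ] ℝ) (T : E →L[ℝ] F) (a : E) : (η.compContinuousLinearMap T).curryLeft a =
      (η.curryLeft (T a)).compContinuousLinearMap T := by
  ext v
  simp only [curryLeft_apply_apply, compContinuousLinearMap_apply]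
  congr 1
  ext j
  refine Fin.cases ?_ (fun j => ?_) j <;> simp

/-- The map `x ↦ x + α(x) p + β(x) m`. -/
def shear (α β : E →L[ℝ] ℝ) (p m : E) : E →L[ℝ] E :=
  ContinuousLinearMap.id ℝ E + α.smulRight p + β.smulRight m

theorem shear_apply (α β : E →L[ℝ] ℝ) (p m x : E) :
    shear α β p m x = x + α x • p + β x • m := rfl

theorem compContinuousLinearMap_shear_one (α β : E →L[ℝ] ℝ) (p m : E) (η : E [⋀^Fin 1]→L[ℝ] ℝ) :
    η.compContinuousLinearMap (shear α β p m) =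
      η + wedge α (η.curryLeft p) + wedge β (η.curryLeft m) := by
  ext v
  obtain ⟨a, rfl⟩ : ∃ a, v = ![a] := ⟨v 0, by ext i; fin_cases i; rfl⟩
  have h : ⇑(shear α β p m) ∘ ![a] = ![a + α a • p + β a • m] := by
    ext i; fin_cases i; rfl
  rw [compContinuousLinearMap_apply, h, vecCons_add, vecCons_add, vecCons_smul, vecCons_smul]
  simp [wedge_apply, curryLeft_apply_apply]

theorem compContinuousLinearMap_shear_curryLeft {k : ℕ} (α β : E →L[ℝ] ℝ) (p m : E)
    (η : E [⋀^Fin (k + 1)]→L[ℝ] ℝ) (a : E) :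
    (η.compContinuousLinearMap (shear α β p m)).curryLeft a =
      (η.curryLeft a).compContinuousLinearMap (shear α β p m) +
      α a • (η.curryLeft p).compContinuousLinearMap (shear α β p m) +
      β a • (η.curryLeft m).compContinuousLinearMap (shear α β p m) := by
  rw [compContinuousLinearMap_curryLeft, shear_apply, map_add, map_add, map_smul, map_smul]
  rfl

/-- Expanding in each slot, terms with `α` or `β` used twice vanish by antisymmetry, so the
expansion stops at `α ∧ β`. The induction on the degree contracts both sides with an arbitrary
vector; degree 1 is separate since it admits no double contraction. -/
theorem compContinuousLinearMap_shear {k : ℕ} (α β : E →L[ℝ] ℝ) (p m : E)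
    (η : E [⋀^Fin (k + 2)]→L[ℝ] ℝ) :
    η.compContinuousLinearMap (shear α β p m) =
      η + wedge α (η.curryLeft p) + wedge β (η.curryLeft m) +
        wedge α (wedge β ((η.curryLeft p).curryLeft m)) := by
  induction k with
  | zero =>
    refine ext_curryLeft fun a => ?_
    rw [compContinuousLinearMap_shear_curryLeft]
    have hz : (wedge β ((η.curryLeft p).curryLeft m)).curryLeft a =
        β a • (η.curryLeft p).curryLeft m := by
      ext v
      simp [curryLeft_apply_apply, wedge_apply]
    have h1 : ∀ ζ : E [⋀^Fin (0 + 1)]→L[ℝ] ℝ, _ := compContinuousLinearMap_shear_one α β p m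
    simp only [curryLeft_add, _root_.add_apply, curryLeft_wedge, hz, h1,
      curryLeft_self, curryLeft_comm η a p,
      curryLeft_comm η a m, curryLeft_comm η m p, wedge_neg_right, wedge_smul_right,
      wedge_zero_right]
    module
  | succ k ih =>
    refine ext_curryLeft fun a => ?_
    rw [compContinuousLinearMap_shear_curryLeft, ih, ih, ih]
    have hA : ((η.curryLeft a).curryLeft p).curryLeft m =
        ((η.curryLeft p).curryLeft m).curryLeft a := by
      rw [curryLeft_comm η a p, curryLeft_comm (η.curryLeft p) m a, curryLeft_neg]
    have hB : ((η.curryLeft p).curryLeft p).curryLeft m = 0 := by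
      rw [curryLeft_self]; rfl
    have hC : ((η.curryLeft m).curryLeft p).curryLeft m = 0 := by
      rw [curryLeft_comm η m p, curryLeft_neg, curryLeft_self, neg_zero]
    simp only [curryLeft_add, _root_.add_apply, curryLeft_wedge, hA, hB, hC]
    simp only [curryLeft_self, curryLeft_comm η a p,
      curryLeft_comm η a m, curryLeft_comm η m p, wedge_neg_right, wedge_smul_right,
      wedge_zero_right, wedge_sub_right]
    module

end Shear

/-! ### A family of orthogonal transforms of `phi0` parametrised by a vector. -/

theorem cross_cross (y p : Euc 7) :
    cross p (cross y p) = (inner ℝ p p : ℝ) • y - (inner ℝ p y : ℝ) • p := by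
  have h : ∀ i, cross p (cross y p) i = (inner ℝ p p : ℝ) * y i - (inner ℝ p y : ℝ) * p i := by
    simp only [Fin.forall_fin_succ, Fin.forall_fin_zero, inner_eq_sum_seven]
    simp only [Fin.succ_zero_eq_one, Fin.succ_one_eq_two, Fin.reduceSucc, cross_apply,
      phi0_contract_two p (cross y p), phi0_contract_two y p]
    refine ⟨?_, ?_, ?_, ?_, ?_, ?_, ?_, trivial⟩ <;> ring
  ext i
  simp [h]

theorem inner_cross_right (y p : Euc 7) : inner ℝ p (cross y p) = 0 := by
  simp only [inner_eq_sum_seven, cross_apply, phi0_contract_two y p]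
  ring

theorem inner_cross_cross (y p : Euc 7) : inner ℝ (cross y p) (cross y p) =
    inner ℝ y y * inner ℝ p p - inner ℝ y p ^ 2 := by
  simp only [inner_eq_sum_seven, cross_apply, phi0_contract_two y p]
  ring

theorem exists_unit_orthogonal (y : Euc 7) : ∃ p : Euc 7, inner ℝ p p = 1 ∧ inner ℝ p y = 0 := by
  have h : (ℝ ∙ y)ᗮ ≠ ⊥ := by
    intro h
    have h1 := Submodule.finrank_add_finrank_orthogonal (𝕜 := ℝ) (ℝ ∙ y)
    rw [h, finrank_bot, finrank_euclideanSpace_fin] at h1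
    have := finrank_span_le_card (R := ℝ) ({y} : Set (Euc 7))
    simp at this
    omega
  obtain ⟨q, hq, hq0⟩ := Submodule.exists_mem_ne_zero_of_ne_bot h
  refine ⟨‖q‖⁻¹ • q, ?_, ?_⟩
  · have : ‖q‖ ≠ 0 := norm_ne_zero_iff.2 hq0
    simp only [inner_smul_left, inner_smul_right, real_inner_self_eq_norm_sq]
    simp
    field_simp
  · rw [inner_smul_left, Submodule.mem_orthogonal_singleton_iff_inner_left.1 hq, mul_zero]

/-- `O` rotates one plane and fixes its orthogonal complement. The plane is spanned by `p` and `m`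
with `p × m = y` (for `y = 0` the map is the identity); the rank-two pullback formula gives the
effect in terms of `p` and `m`, and the cross product identities remove both vectors in favour of
`y`. -/
theorem exists_orthogonal_phi0_psi0 (y : Euc 7) :
    ∃ O : Euc 7 ≃L[ℝ] Euc 7, (∀ v w, inner ℝ (O v) (O w) = inner ℝ v w) ∧
      (1 + inner ℝ y y : ℝ) • phi0.compContinuousLinearMap (O : Euc 7 →L[ℝ] Euc 7) =
        (1 - inner ℝ y y : ℝ) • phi0 + (2 : ℝ) • psi0.curryLeft y +
          (2 : ℝ) • wedge (innerSL ℝ y) (phi0.curryLeft y) ∧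
      (1 + inner ℝ y y : ℝ) • psi0.compContinuousLinearMap (O : Euc 7 →L[ℝ] Euc 7) =
        (1 + inner ℝ y y : ℝ) • psi0 - (2 : ℝ) • wedge (innerSL ℝ y) phi0 -
          (2 : ℝ) • wedge (innerSL ℝ y) (psi0.curryLeft y) := by
  obtain ⟨p, hp, hpy⟩ := exists_unit_orthogonal y
  -- For a unit vector `p ⟂ y`, the vector `m = y × p` satisfies `p × m = y`, `m ⟂ p` and `|m| =
  -- |y|`.
  have hym : cross p (cross y p) = y := by rw [cross_cross, hp, hpy]; simp
  have hpm := inner_cross_right y p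
  have hmm := inner_cross_cross y p
  rw [real_inner_comm p y, hpy, hp] at hmm
  generalize cross y p = m at *
  have hmm : inner ℝ m m = inner ℝ y y := by rw [hmm]; ring
  have h1 := curryLeft_cross_psi0 p m
  have h2 := wedge_cross_phi0 p m
  have h3 := gram_smul_phi0 p m
  have h4 := wedge_cross_psi0 p m
  have hr : 1 + inner ℝ y y ≠ (0 : ℝ) := by
    have := real_inner_self_nonneg (x := y)
    positivity
  rw [hym] at h1 h2 h3 h4
  rw [hp, hmm, hpm] at h3 h4
  generalize inner ℝ y y = r at *
  -- With `r = |y|²` the map `id + α ⊗ p + β ⊗ m` sends `p` to `((1 - r) p + 2 m)/(1 + r)` and `m`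
  -- to `((1 - r) m - 2 r p)/(1 + r)`: a rotation whose half-angle has tangent `|y|`.
  let α : Euc 7 →L[ℝ] ℝ := (2 / (1 + r)) • ((-r) • innerSL ℝ p - innerSL ℝ m)
  let β : Euc 7 →L[ℝ] ℝ := (2 / (1 + r)) • (innerSL ℝ p - innerSL ℝ m)
  have hO : ∀ v w, inner ℝ (shear α β p m v) (shear α β p m w) = inner ℝ v w := by
    intro v w
    have ha : ∀ x, α x = 2 / (1 + r) * (-r * inner ℝ p x - inner ℝ m x) := fun _ => rfl
    have hb : ∀ x, β x = 2 / (1 + r) * (inner ℝ p x - inner ℝ m x) := fun _ => rfl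
    simp only [shear_apply, inner_add_left, inner_add_right, real_inner_smul_left,
      real_inner_smul_right, hp, hmm, hpm, real_inner_comm p m, real_inner_comm p v,
      real_inner_comm m v, ha, hb]
    field_simp
    ring
  have hinj : Function.Injective (shear α β p m).toLinearMap := by
    rw [← LinearMap.ker_eq_bot, LinearMap.ker_eq_bot']
    intro v hv
    have h := hO v v
    have hv' : shear α β p m v = 0 := hv
    rw [hv', inner_zero_left] at h
    exact inner_self_eq_zero.1 h.symm
  refine ⟨(LinearEquiv.ofInjectiveEndo _ hinj).toContinuousLinearEquiv, hO, ?_⟩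
  have hT : (((LinearEquiv.ofInjectiveEndo _ hinj).toContinuousLinearEquiv :
      Euc 7 ≃L[ℝ] Euc 7) : Euc 7 →L[ℝ] Euc 7) = shear α β p m := by
    ext v : 1
    rfl
  have key : ∀ {k : ℕ} (η : Euc 7 [⋀^Fin (k + 2)]→L[ℝ] ℝ),
      (1 + r) • η.compContinuousLinearMap (shear α β p m) = (1 + r) • η -
        (2 * r) • wedge (innerSL ℝ p) (η.curryLeft p) -
        (2 : ℝ) • wedge (innerSL ℝ m) (η.curryLeft p) +
        (2 : ℝ) • wedge (innerSL ℝ p) (η.curryLeft m) -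
        (2 : ℝ) • wedge (innerSL ℝ m) (η.curryLeft m) +
        (4 : ℝ) • wedge (innerSL ℝ p) (wedge (innerSL ℝ m) ((η.curryLeft p).curryLeft m)) := by
    intro k η
    rw [compContinuousLinearMap_shear]
    simp only [α, β, wedge_smul_left, wedge_sub_left, wedge_smul_right, wedge_sub_right,
      wedge_wedge_self, wedge_wedge_comm (innerSL ℝ m) (innerSL ℝ p)]
    match_scalars <;> field_simp <;> ring
  rw [hT]
  constructor
  · rw [key (k := 1) phi0]
    linear_combination (norm := module) (-2 : ℝ) • h1 + (2 : ℝ) • h3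
  · rw [key (k := 2) psi0]
    linear_combination (norm := module) (2 : ℝ) • h2 + (2 : ℝ) • h4

/-! ### The fiber `ℝ⁷`, where chart expressions are the tensors themselves. -/

section EuclideanFiber

variable {E : Type*} [NormedAddCommGroup E] [NormedSpace ℝ E]

theorem mfderiv_extChartAt_symm_modelSpace (x y : Euc 7) :
    mfderiv 𝓘(ℝ, Euc 7) (𝓡 7) (extChartAt (𝓡 7) x).symm y = ContinuousLinearMap.id ℝ (Euc 7) := by
  have h : HasMFDerivAt 𝓘(ℝ, Euc 7) (𝓡 7) (extChartAt (𝓡 7) x).symm y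
    (ContinuousLinearMap.id ℝ (Euc 7)) := hasMFDerivAt_id y
  exact h.mfderiv

theorem localForm_modelSpace {k : ℕ} (η : FormField (Euc 7) (Euc 7) k) (x : Euc 7) :
    localForm (𝓡 7) η x = η := by
  ext y v
  rw [localForm]
  erw [mfderiv_extChartAt_symm_modelSpace]
  rfl

theorem localBilin_modelSpace (g : BilinField (Euc 7) (Euc 7)) (x : Euc 7) :
    localBilin (𝓡 7) g x = g := by
  ext y v w
  rw [localBilin]
  erw [mfderiv_extChartAt_symm_modelSpace]
  rfl

theorem dForm_modelSpace {k : ℕ} (η : FormField (Euc 7) (Euc 7) k) :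
    dForm (𝓡 7) η = extDeriv η := by
  ext x v
  simp only [dForm, localForm_modelSpace, extChartAt_model_space_eq_id,
    PartialEquiv.refl_coe, id]

theorem smoothFormOn_modelSpace {k : ℕ} {η : FormField (Euc 7) (Euc 7) k}
    (h : ContDiff ℝ ∞ η) : SmoothFormOn (𝓡 7) η Set.univ := by
  intro x _
  rw [localForm_modelSpace]
  exact h.contDiffAt

theorem smoothBilinOn_modelSpace {g : BilinField (Euc 7) (Euc 7)}
    (h : ContDiff ℝ ∞ g) : SmoothBilinOn (𝓡 7) g Set.univ := by
  intro x _
  rw [localBilin_modelSpace]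
  exact h.contDiffAt

theorem extDeriv_eq_of_hasFDerivAt {k : ℕ} {η : E → E [⋀^Fin k]→L[ℝ] ℝ}
    {D : E →L[ℝ] E [⋀^Fin k]→L[ℝ] ℝ} {x : E} (h : HasFDerivAt η D x) :
    extDeriv η x = alternatizeUncurryFin D := by
  rw [extDeriv, h.fderiv]

end EuclideanFiber

/-! ### The nearly parallel `G₂`-structure with the round metric. -/

section NearlyParallel

/-- The quadratic form-valued map `y ↦ y ∧ ι_y η`. -/
def wedgeContract {k : ℕ} (η : Euc 7 [⋀^Fin (k + 1)]→L[ℝ] ℝ) (y : Euc 7) :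
    Euc 7 [⋀^Fin (k + 1)]→L[ℝ] ℝ :=
  wedge (innerSL ℝ y) (η.curryLeft y)

/-- The continuous linear map `v ↦ v ∧ ζ`. -/
def flatWedge {k : ℕ} (ζ : Euc 7 [⋀^Fin k]→L[ℝ] ℝ) : Euc 7 →L[ℝ] Euc 7 [⋀^Fin (k + 1)]→L[ℝ] ℝ :=
  (alternatizeUncurryFinCLM ℝ (Euc 7) ℝ).comp
    (((ContinuousLinearMap.smulRightL ℝ (Euc 7) (Euc 7 [⋀^Fin k]→L[ℝ] ℝ)).flip ζ).comp (innerSL ℝ))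

theorem flatWedge_apply {k : ℕ} (ζ : Euc 7 [⋀^Fin k]→L[ℝ] ℝ) (v : Euc 7) :
    flatWedge ζ v = wedge (innerSL ℝ v) ζ := rfl

/-- The one-form dual to the position vector is `d(|y|²/2)`, so its wedge product with a constant
form is closed. -/
theorem alternatizeUncurryFin_flatWedge {k : ℕ} (ζ : Euc 7 [⋀^Fin k]→L[ℝ] ℝ) :
    alternatizeUncurryFin (flatWedge ζ) = 0 := by
  refine alternatizeUncurryFin_alternatizeUncurryFinCLM_comp_of_symmetric fun u v => ?_
  change (inner ℝ u v : ℝ) • ζ = (inner ℝ v u : ℝ) • ζ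
  rw [real_inner_comm]

theorem hasFDerivAt_wedgeContract {k : ℕ} (η : Euc 7 [⋀^Fin (k + 1)]→L[ℝ] ℝ) (y : Euc 7) :
    HasFDerivAt (wedgeContract η)
      (flatWedge (η.curryLeft y) + (wedgeCLM k (innerSL ℝ y)).comp η.curryLeft) y := by
  let B : Euc 7 →L[ℝ] (Euc 7 [⋀^Fin k]→L[ℝ] ℝ) →L[ℝ] Euc 7 [⋀^Fin (k + 1)]→L[ℝ] ℝ :=
    (ContinuousLinearMap.compL ℝ _ _ _ (alternatizeUncurryFinCLM ℝ (Euc 7) ℝ)).comp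
      ((ContinuousLinearMap.smulRightL ℝ (Euc 7) (Euc 7 [⋀^Fin k]→L[ℝ] ℝ)).comp (innerSL ℝ))
  have h := B.hasFDerivAt_of_bilinear (hasFDerivAt_id y) (η.curryLeft.hasFDerivAt (x := y))
  refine HasFDerivAt.congr_fderiv h ?_
  ext v : 1
  exact add_comm _ _

theorem contDiff_wedgeContract {k : ℕ} (η : Euc 7 [⋀^Fin (k + 1)]→L[ℝ] ℝ) :
    ContDiff ℝ ∞ (wedgeContract η) := by
  have : wedgeContract η = fun y => (alternatizeUncurryFinCLM ℝ (Euc 7) ℝ)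
    ((ContinuousLinearMap.smulRightL ℝ (Euc 7) (Euc 7 [⋀^Fin k]→L[ℝ] ℝ)) (innerSL ℝ y)
      (η.curryLeft y)) := rfl
  rw [this]
  exact (ContinuousLinearMap.contDiff _).comp (((ContinuousLinearMap.contDiff _).comp
    (ContinuousLinearMap.contDiff _)).clm_apply (ContinuousLinearMap.contDiff _))

/-- The nearly parallel three-form of the round seven-sphere in stereographic coordinates. -/
def sphereForm (y : Euc 7) : Euc 7 [⋀^Fin 3]→L[ℝ] ℝ :=
  (stereo y ^ 4 - stereo y ^ 3) • phi0 + stereo y ^ 4 • psi0.curryLeft y +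
    stereo y ^ 4 • wedgeContract phi0 y

/-- The Hodge dual of `sphereForm`. -/
def sphereDual (y : Euc 7) : Euc 7 [⋀^Fin 4]→L[ℝ] ℝ :=
  stereo y ^ 4 • psi0 - stereo y ^ 5 • flatWedge phi0 y - stereo y ^ 5 • wedgeContract psi0 y

theorem contDiff_sphereForm : ContDiff ℝ ∞ sphereForm := by
  have h := contDiff_stereo (n := 7)
  exact ((((h.pow 4).sub (h.pow 3)).smul contDiff_const).add
    ((h.pow 4).smul psi0.curryLeft.contDiff)).add ((h.pow 4).smul (contDiff_wedgeContract phi0))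

theorem contDiff_sphereDual : ContDiff ℝ ∞ sphereDual := by
  have h := contDiff_stereo (n := 7)
  exact (((h.pow 4).smul contDiff_const).sub ((h.pow 5).smul (flatWedge phi0).contDiff)).sub
    ((h.pow 5).smul (contDiff_wedgeContract psi0))

/-- Writing `s` for `stereo` and `y` also for its dual one-form, the ingredients are `ds = -s² y`,
`d(ι_y ψ₀) = 4 ψ₀` and `d(y ∧ ι_y φ₀) = -3 y ∧ φ₀`; the terms `±3 s⁴ y ∧ φ₀` cancel. -/
theorem extDeriv_sphereForm : extDeriv sphereForm = (4 : ℝ) • sphereDual := by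
  ext y : 1
  have h := hasFDerivAt_stereo y
  have hD := ((((h.pow 4).sub (h.pow 3)).smul (hasFDerivAt_const phi0 y)).add
    ((h.pow 4).smul (psi0.curryLeft.hasFDerivAt (x := y)))).add
    ((h.pow 4).smul (hasFDerivAt_wedgeContract phi0 y))
  rw [extDeriv_eq_of_hasFDerivAt (η := sphereForm) hD]
  have hw : ∀ {k : ℕ} (α : Euc 7 →L[ℝ] ℝ) (ζ : Euc 7 [⋀^Fin k]→L[ℝ] ℝ),
      alternatizeUncurryFin (α.smulRight ζ) = wedge α ζ := fun _ _ => rfl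
  have h3 : alternatizeUncurryFin phi0.curryLeft = (3 : ℝ) • phi0 := by
    rw [alternatizeUncurryFin_curryLeft]; module
  have h4 : alternatizeUncurryFin psi0.curryLeft = (4 : ℝ) • psi0 := by
    rw [alternatizeUncurryFin_curryLeft]; module
  simp only [alternatizeUncurryFin_add, alternatizeUncurryFin_smul, hw, smul_zero, zero_add,
    alternatizeUncurryFin_flatWedge, alternatizeUncurryFin_wedgeCLM_comp, h3, h4,
    wedge_smul_left, wedge_smul_right, wedge_sub_left, wedgeContract, wedge_wedge_self]
  simp only [Pi.smul_apply, sphereDual, flatWedge_apply, wedgeContract]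
  module

/-- The dual form is exact by the preceding equation. -/
theorem extDeriv_sphereDual : extDeriv sphereDual = 0 := by
  have h : sphereDual = (4⁻¹ : ℝ) • extDeriv sphereForm := by
    rw [extDeriv_sphereForm, smul_smul]; norm_num
  ext y : 1
  rw [h, extDeriv_smul, extDeriv_extDeriv_apply contDiff_sphereForm.contDiffAt, smul_zero]
  · rfl
  · simp [minSmoothness_of_isRCLikeNormedField, ENat.LEInfty.out]

/-- The coframe is `O` composed with scaling by `s = stereo y`. Since `2/(1 + |y|²) = s`, the
coefficient `(1 - |y|²)/(1 + |y|²)` of `phi0` is `s - 1`, which with the factor `s³` accounts for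
`s⁴ - s³` in `sphereForm`. -/
theorem exists_adapted_sphere (y : Euc 7) : ∃ u : Euc 7 ≃L[ℝ] Euc 7,
    sphereForm y = phi0.compContinuousLinearMap (u : Euc 7 →L[ℝ] Euc 7) ∧
      sphereDual y = psi0.compContinuousLinearMap (u : Euc 7 →L[ℝ] Euc 7) ∧
        ∀ v w, roundMetric 7 y v w = inner ℝ (u v) (u w) := by
  obtain ⟨O, hO, h3, h4⟩ := exists_orthogonal_phi0_psi0 y
  have hs := (stereo_pos y).ne'
  have hm := stereo_mul y
  have hr : inner ℝ y y = 2 / stereo y - 1 := by field_simp; linear_combination hm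
  rw [hr] at h3 h4
  have hc : ∀ {k : ℕ} (η : Euc 7 [⋀^Fin k]→L[ℝ] ℝ), η.compContinuousLinearMap
      (((ContinuousLinearEquiv.smulLeft (Units.mk0 _ hs)).trans O : Euc 7 ≃L[ℝ] Euc 7) :
        Euc 7 →L[ℝ] Euc 7) =
      stereo y ^ k • η.compContinuousLinearMap (O : Euc 7 →L[ℝ] Euc 7) := by
    intro k η
    ext v
    have := (η.compContinuousLinearMap (O : Euc 7 →L[ℝ] Euc 7)).map_smul_univ
      (fun _ => stereo y) v
    rw [Finset.prod_const, Finset.card_univ, Fintype.card_fin, smul_eq_mul] at this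
    exact this
  refine ⟨(ContinuousLinearEquiv.smulLeft (Units.mk0 _ hs)).trans O, ?_, ?_, ?_⟩
  · rw [hc]
    simp only [sphereForm, wedgeContract]
    linear_combination (norm := skip) (-(stereo y ^ 4 / 2)) • h3
    match_scalars <;> field_simp <;> ring
  · rw [hc]
    simp only [sphereDual, wedgeContract, flatWedge_apply]
    linear_combination (norm := skip) (-(stereo y ^ 5 / 2)) • h4
    match_scalars <;> field_simp <;> ring
  · intro v w
    have hu : ∀ v, ((ContinuousLinearEquiv.smulLeft (Units.mk0 _ hs)).trans O) v =
      O (stereo y • v) := fun _ => rfl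
    rw [hu, hu, hO, roundMetric_apply, real_inner_smul_left, real_inner_smul_right]
    ring

/-- The nearly parallel `G₂`-structure of the round seven-sphere minus a point. -/
def sphereG2 : G2Structure (Euc 7) where
  form := sphereForm
  metric := roundMetric 7
  dual := sphereDual
  smooth_form := smoothFormOn_modelSpace contDiff_sphereForm
  smooth_metric := smoothBilinOn_modelSpace contDiff_roundMetric
  smooth_dual := smoothFormOn_modelSpace contDiff_sphereDual
  adapted := exists_adapted_sphere

end NearlyParallel

/-! ### Einstein warped structures over fibers with the round metric. -/

section Einstein

/-- The `G₂`-structure `h³ φ₀` conformal to the flat one whose metric is the round metric. -/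
def conformalG2 : G2Structure (Euc 7) where
  form y := stereo y ^ 3 • phi0
  metric := roundMetric 7
  dual y := stereo y ^ 4 • psi0
  smooth_form := smoothFormOn_modelSpace ((contDiff_stereo.pow 3).smul contDiff_const)
  smooth_metric := smoothBilinOn_modelSpace contDiff_roundMetric
  smooth_dual := smoothFormOn_modelSpace ((contDiff_stereo.pow 4).smul contDiff_const)
  adapted y := by
    have hs := (stereo_pos y).ne'
    refine ⟨ContinuousLinearEquiv.smulLeft (Units.mk0 _ hs), ?_, ?_, ?_⟩
    · ext v
      have h := phi0.map_smul_univ (fun _ => stereo y) v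
      rw [Finset.prod_const, Finset.card_univ, Fintype.card_fin] at h
      exact h.symm
    · ext v
      have h := psi0.map_smul_univ (fun _ => stereo y) v
      rw [Finset.prod_const, Finset.card_univ, Fintype.card_fin] at h
      exact h.symm
    · intro v w
      have hu : ∀ v, (ContinuousLinearEquiv.smulLeft (Units.mk0 _ hs) : Euc 7 ≃L[ℝ] Euc 7) v =
        stereo y • v := fun _ => rfl
      rw [hu, hu, roundMetric_apply, real_inner_smul_left, real_inner_smul_right]
      ring

variable {S : G2Structure (Euc 7)} {J : Set ℝ} {f f' : ℝ → ℝ} {K : ℝ}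

theorem ricciAt_warpedMetric_round (hS : S.metric = roundMetric 7) (hJ : IsWarping J f)
    (hf : ∀ t ∈ J, HasDerivAt f (f' t) t) (hf2 : ∀ t ∈ J, HasDerivAt f' (-(K * f t)) t)
    (hK : ∀ t ∈ J, f' t ^ 2 + K * f t ^ 2 = 1) {p : ℝ × Euc 7} (hp : p ∈ J ×ˢ Set.univ)
    (v w : ℝ × Euc 7) :
    ricciAt modelN (warpedMetric S f) p v w = 7 * K * warpedMetric S f p v w := by
  have hnhds := hJ.isOpen.mem_nhds hp.1
  have hcone : localBilin modelN (warpedMetric S f) p =ᶠ[nhds (p.1, p.2)]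
      coneMetric f (roundMetric 7) := by
    have h := localBilin_warpedMetric_eventuallyEq S f p
    rw [localBilin_modelSpace, hS] at h
    exact h
  have h := ricci_coneMetric_round (y := (p.1, p.2)) (n := 7) (K := K)
    (Filter.eventually_of_mem hnhds hf)
    (hJ.ne_zero _ hp.1) (hf2 _ hp.1) (hK _ hp.1) (hJ.smooth.contDiffAt hnhds) v w
  rw [ricciAt, extChartAt_modelN_self]
  refine (ricci_congr hcone v w).trans (h.trans ?_)
  rw [coneMetric_apply, warpedMetric_apply, hS]
  norm_num [mul_comm]

/-- The metric condition depends only on `f`: here `Ric = 7 K g` and the scalar curvature is `56 K`.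
What remains for each example is its torsion. -/
theorem isEinsteinWarpedSpin7_of_torsion (hS : S.metric = roundMetric 7) (hJ : IsWarping J f)
    (hf : ∀ t ∈ J, HasDerivAt f (f' t) t) (hf2 : ∀ t ∈ J, HasDerivAt f' (-(K * f t)) t)
    (hK : ∀ t ∈ J, f' t ^ 2 + K * f t ^ 2 = 1) {c : Spin7Class}
    (l₁ : (p : ℝ × Euc 7) → ℝ × Euc 7 →L[ℝ] ℝ) (l₅ : FormField (ℝ × Euc 7) (ℝ × Euc 7) 5)
    (hT : IsTorsionOn modelN (warpedForm S f) (warpedMetric S f) (J ×ˢ Set.univ) l₁ l₅)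
    (hc : c.IsStrict (∃ p ∈ J ×ˢ (Set.univ : Set (Euc 7)), l₁ p ≠ 0)
      (∃ p ∈ J ×ˢ (Set.univ : Set (Euc 7)), l₅ p ≠ 0)) :
    IsEinsteinWarpedSpin7 S J f c (SignType.sign K) := by
  refine ⟨hJ, isSpin7StructureOn_warped S hJ,
    ⟨7 * K, fun p hp => ricciAt_warpedMetric_round hS hJ hf hf2 hK hp⟩,
    fun p hp => ?_, l₁, l₅, hT, hc⟩
  rw [scalAt_warpedMetric S (hJ.ne_zero _ hp.1)
    (ricciAt_warpedMetric_round hS hJ hf hf2 hK hp)]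
  rw [show 7 * K * 8 = 56 * K by ring, sign_mul, sign_pos (by norm_num), one_mul]

end Einstein

/-! ### Torsion forms of warped structures. -/

section Torsion

variable {M : Type*} [TopologicalSpace M] [ChartedSpace (Euc 7) M]

theorem wedge_fst_warpedForm (S : G2Structure M) (f : ℝ → ℝ) (p : ℝ × M) :
    wedge (.fst ℝ ℝ (Euc 7)) (warpedForm S f p) =
      f p.1 ^ 4 • wedge (.fst ℝ ℝ (Euc 7))
        ((S.dual p.2).compContinuousLinearMap (.snd ℝ ℝ (Euc 7))) := by
  rw [warpedForm_eq, wedge_add_right, wedgeRight, wedge_smul_right, wedge_smul_right,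
    wedge_smul_right, wedge_wedge_self, smul_zero, smul_zero, zero_add]

theorem memLambda48_zero {E : Type*} [NormedAddCommGroup E] [NormedSpace ℝ E]
    (g : E →L[ℝ] E →L[ℝ] ℝ) (Φ : E [⋀^Fin 4]→L[ℝ] ℝ) : MemLambda48 g Φ 0 := by
  intro b _ α
  simp [formInner]

/-- A warped product over a nearly parallel fiber is locally conformal parallel. -/
theorem isTorsionOn_of_nearlyParallel [IsManifold (𝓡 7) 1 M] (S : G2Structure M)
    (h3 : ∀ x, dForm (𝓡 7) S.form x = (4 : ℝ) • S.dual x) (h4 : ∀ x, dForm (𝓡 7) S.dual x = 0)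
    {J : Set ℝ} {f f' : ℝ → ℝ} (hJ : IsWarping J f) (hf : ∀ t ∈ J, HasDerivAt f (f' t) t) :
    IsTorsionOn modelN (warpedForm S f) (warpedMetric S f) (J ×ˢ Set.univ)
      (fun p => (4 * (1 + f' p.1) / f p.1) • ContinuousLinearMap.fst ℝ ℝ (Euc 7)) (fun _ => 0) := by
  intro p hp
  refine ⟨?_, memLambda48_zero _ _⟩
  have h0 := hJ.ne_zero _ hp.1
  have hz : (0 : Euc 7 [⋀^Fin 5]→L[ℝ] ℝ).compContinuousLinearMap
    (ContinuousLinearMap.snd ℝ ℝ (Euc 7)) = 0 := rfl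
  -- `dΦ = 4 f³ (1 + f') dt ∧ ψ` while `dt ∧ Φ = f⁴ dt ∧ ψ`; the quotient is the coefficient of
  -- `λ₁`.
  rw [dForm_warpedForm S p (hf _ hp.1), h3, h4, wedge_smul_left, wedge_fst_warpedForm, hz,
    smul_smul, ← add_smul, smul_zero]
  have hs : ∀ c : ℝ, (c • S.dual p.2).compContinuousLinearMap (ContinuousLinearMap.snd ℝ ℝ (Euc 7))
    = c • (S.dual p.2).compContinuousLinearMap (ContinuousLinearMap.snd ℝ ℝ (Euc 7)) := fun _ => rfl
  rw [hs, wedge_smul_right, smul_smul]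
  congr 2
  field_simp

/-- `IsTorsionOn` is a pointwise condition, so the orthogonal splitting may be chosen point by
point; outside `J` the value of `λ₁` is immaterial and set to 0. -/
theorem exists_isTorsionOn (S : G2Structure M) {J : Set ℝ} {f : ℝ → ℝ} (hJ : IsWarping J f) :
    ∃ (l₁ : (p : ℝ × M) → ℝ × Euc 7 →L[ℝ] ℝ) (l₅ : FormField (ℝ × Euc 7) (ℝ × M) 5),
      IsTorsionOn modelN (warpedForm S f) (warpedMetric S f) (J ×ˢ Set.univ) l₁ l₅ := by
  have h : ∀ p : ℝ × M, ∃ α : ℝ × Euc 7 →L[ℝ] ℝ, p.1 ∈ J →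
      MemLambda48 (warpedMetric S f p) (warpedForm S f p)
        (dForm modelN (warpedForm S f) p - wedge α (warpedForm S f p)) := by
    intro p
    by_cases hp : p.1 ∈ J
    · obtain ⟨u, -, -, hu⟩ := S.adapted p.2
      obtain ⟨α, hα⟩ := exists_memLambda48
        (isOrthonormalBasis_coneBasis S f p u hu (hJ.ne_zero _ hp)) (warpedForm S f p)
        (dForm modelN (warpedForm S f) p)
      exact ⟨α, fun _ => hα⟩
    · exact ⟨0, fun h => absurd h hp⟩
  choose l₁ hl using h
  exact ⟨l₁, fun p => dForm modelN (warpedForm S f) p - wedge (l₁ p) (warpedForm S f p),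
    fun p hp => ⟨(add_sub_cancel _ _).symm, hl p hp.1⟩⟩

end Torsion

/-! ### The conformally flat structure has both torsion forms nonzero. -/

section Conformal

theorem dForm_conformalG2_form (y : Euc 7) :
    dForm (𝓡 7) conformalG2.form y = (-3 * stereo y ^ 4) • wedge (innerSL ℝ y) phi0 := by
  rw [dForm_modelSpace]
  have h := ((hasFDerivAt_stereo y).pow 3).smul (hasFDerivAt_const phi0 y)
  rw [extDeriv_eq_of_hasFDerivAt (η := conformalG2.form) h]
  have hw : ∀ {k : ℕ} (α : Euc 7 →L[ℝ] ℝ) (ζ : Euc 7 [⋀^Fin k]→L[ℝ] ℝ),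
      alternatizeUncurryFin (α.smulRight ζ) = wedge α ζ := fun _ _ => rfl
  rw [smul_zero, zero_add, hw, wedge_smul_left, wedge_smul_left, smul_smul]
  congr 1
  simp
  ring

theorem dForm_conformalG2_dual (y : Euc 7) :
    dForm (𝓡 7) conformalG2.dual y = (-4 * stereo y ^ 5) • wedge (innerSL ℝ y) psi0 := by
  rw [dForm_modelSpace]
  have h := ((hasFDerivAt_stereo y).pow 4).smul (hasFDerivAt_const psi0 y)
  rw [extDeriv_eq_of_hasFDerivAt (η := conformalG2.dual) h]
  have hw : ∀ {k : ℕ} (α : Euc 7 →L[ℝ] ℝ) (ζ : Euc 7 [⋀^Fin k]→L[ℝ] ℝ),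
      alternatizeUncurryFin (α.smulRight ζ) = wedge α ζ := fun _ _ => rfl
  rw [smul_zero, zero_add, hw, wedge_smul_left, wedge_smul_left, smul_smul]
  congr 1
  simp
  ring

variable {J : Set ℝ} {f f' : ℝ → ℝ} {l₁ : (p : ℝ × Euc 7) → ℝ × Euc 7 →L[ℝ] ℝ}
  {l₅ : FormField (ℝ × Euc 7) (ℝ × Euc 7) 5}

/-- The conformal factor is critical at the origin, so `dφ = 0` there, and `λ₁ = 0` would leave `f'
|ψ|² = 0`. -/
theorem conformalG2_torsion_one_ne_zero (hJ : IsWarping J f)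
    (hT : IsTorsionOn modelN (warpedForm conformalG2 f) (warpedMetric conformalG2 f)
      (J ×ˢ Set.univ) l₁ l₅) {t f' : ℝ} (ht : t ∈ J) (hf : HasDerivAt f f' t) (hf' : f' ≠ 0) :
    l₁ (t, 0) ≠ 0 := by
  intro hl
  obtain ⟨u, -, hu4, hu⟩ := conformalG2.adapted 0
  have h := sum_dual_dForm_of_torsion conformalG2 hT (p := (t, 0)) ht hl hf (hJ.ne_zero _ ht) u hu
  have hpos := sum_dual_sq_pos conformalG2 0 u hu4
  have hz : dForm (𝓡 7) conformalG2.form 0 = 0 := by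
    rw [dForm_conformalG2_form, _root_.map_zero, ← zero_smul ℝ (0 : Euc 7 →L[ℝ] ℝ), wedge_smul_left,
      zero_smul, smul_zero]
  simp only [hz, ContinuousAlternatingMap.coe_zero, Pi.zero_apply, mul_zero, Finset.sum_const_zero] at h
  have := mul_eq_zero.1 h.symm
  rcases this with h | h
  · exact hf' (by linarith)
  · exact hpos.ne' h

/-- Suppose `dΦ = β ∧ Φ` at a point over `e 0`, where `stereo = 1`, and let `b` be the fiber part of
`β`. Restriction to the fiber gives `dψ = b ∧ ψ`, hence `b(e 0) = -4`. Contraction with `∂t` gives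
`dφ = b ∧ φ` modulo `ψ`, hence `b(e 0) = -3`. -/
theorem conformalG2_torsion_five_ne_zero (hJ : IsWarping J f)
    (hT : IsTorsionOn modelN (warpedForm conformalG2 f) (warpedMetric conformalG2 f)
      (J ×ˢ Set.univ) l₁ l₅) {t f' : ℝ} (ht : t ∈ J) (hf : HasDerivAt f f' t) :
    l₅ (t, e 0) ≠ 0 := by
  intro hl
  obtain ⟨h, -⟩ := hT (t, e 0) ⟨ht, trivial⟩
  have h0 := hJ.ne_zero _ ht
  have hs : stereo (e 0) = 1 := by simp [stereo]; norm_num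
  rw [hl, add_zero, dForm_warpedForm conformalG2 (t, e 0) hf, warpedForm_eq,
    dForm_conformalG2_form, dForm_conformalG2_dual] at h
  simp only [conformalG2, hs, one_pow, mul_one, one_smul] at h
  set β := l₁ (t, e 0)
  set b : Euc 7 →L[ℝ] ℝ := β.comp (.inr ℝ ℝ (Euc 7)) with hb
  have hfi : (ContinuousLinearMap.fst ℝ ℝ (Euc 7)).comp (.inr ℝ ℝ (Euc 7)) = 0 := by
    ext v; rfl
  have hsi : ∀ {k : ℕ} (η : Euc 7 [⋀^Fin k]→L[ℝ] ℝ),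
      (η.compContinuousLinearMap (.snd ℝ ℝ (Euc 7))).compContinuousLinearMap
        (.inr ℝ ℝ (Euc 7)) = η := fun _ => rfl
  have hadd : ∀ {k : ℕ} (η ζ : (ℝ × Euc 7) [⋀^Fin k]→L[ℝ] ℝ),
      (η + ζ).compContinuousLinearMap (.inr ℝ ℝ (Euc 7)) =
        η.compContinuousLinearMap (.inr ℝ ℝ (Euc 7)) +
          ζ.compContinuousLinearMap (.inr ℝ ℝ (Euc 7)) := fun _ _ => rfl
  have hsub : ∀ {k : ℕ} (η ζ : (ℝ × Euc 7) [⋀^Fin k]→L[ℝ] ℝ),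
      (η - ζ).compContinuousLinearMap (.inr ℝ ℝ (Euc 7)) =
        η.compContinuousLinearMap (.inr ℝ ℝ (Euc 7)) -
          ζ.compContinuousLinearMap (.inr ℝ ℝ (Euc 7)) := fun _ _ => rfl
  have hsm : ∀ {k : ℕ} (c : ℝ) (η : (ℝ × Euc 7) [⋀^Fin k]→L[ℝ] ℝ),
      (c • η).compContinuousLinearMap (.inr ℝ ℝ (Euc 7)) =
        c • η.compContinuousLinearMap (.inr ℝ ℝ (Euc 7)) := fun _ _ => rfl
  have hc : ∀ {k : ℕ} (η : Euc 7 [⋀^Fin (k + 1)]→L[ℝ] ℝ),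
      (η.compContinuousLinearMap (.snd ℝ ℝ (Euc 7))).curryLeft ((1, 0) : ℝ × Euc 7) = 0 := by
    intro k η
    rw [compContinuousLinearMap_curryLeft]
    have : (ContinuousLinearMap.snd ℝ ℝ (Euc 7)) ((1, 0) : ℝ × Euc 7) = 0 := rfl
    rw [this, _root_.map_zero]
    rfl
  have hw0 : ∀ {k : ℕ} (η : Euc 7 [⋀^Fin k]→L[ℝ] ℝ), wedge 0 η = 0 := by
    intro k η
    simpa using wedge_smul_left 0 (0 : Euc 7 →L[ℝ] ℝ) η
  have hf1 : (ContinuousLinearMap.fst ℝ ℝ (Euc 7)) ((1, 0) : ℝ × Euc 7) = 1 := rfl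
  have hA := congrArg (fun η => η.compContinuousLinearMap (.inr ℝ ℝ (Euc 7))) h
  have hB := congrArg (fun η => (η.curryLeft ((1, 0) : ℝ × Euc 7)).compContinuousLinearMap
    (.inr ℝ ℝ (Euc 7))) h
  have hcs : ∀ {k : ℕ} (c : ℝ) (η : (ℝ × Euc 7) [⋀^Fin (k + 1)]→L[ℝ] ℝ) v,
    (c • η).curryLeft v = c • η.curryLeft v := fun _ _ _ => rfl
  simp only [wedgeRight, hadd, hsub, hsm, wedge_compContinuousLinearMap, hfi, hsi, hw0, smul_zero,
    zero_add, ← hb, wedge_smul_right, wedge_add_right, curryLeft_add, _root_.add_apply, hcs,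
    curryLeft_wedge, hc, hf1, one_smul, wedge_zero_right, sub_zero, add_zero] at hA hB
  -- This tuple isolates `α(e 0)` through the term `e³⁴⁵⁶` of `psi0`.
  have hψ : ∀ α : Euc 7 →L[ℝ] ℝ,
      (wedge α psi0).curryLeft (e 0) ![e 2, e 3, e 4, e 5] = α (e 0) := by
    intro α
    rw [curryLeft_wedge, ContinuousAlternatingMap.sub_apply, ContinuousAlternatingMap.smul_apply,
      wedge_apply_four]
    simp only [curryLeft_apply_apply, psi0_contract (e 0), psi0_contract (e 2)]
    simp
  -- This tuple isolates `α(e 0)` through the term `e³⁴⁷` of `phi0`, and `psi0` vanishes on it,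
  -- which removes `f'` and `β(∂t)`.
  have hφ : ∀ α : Euc 7 →L[ℝ] ℝ, wedge α phi0 ![e 0, e 2, e 3, e 6] = α (e 0) := by
    intro α
    rw [wedge_apply_four]
    simp [phi0_basis]
  have hψ0 : psi0 ![e 0, e 2, e 3, e 6] = 0 := by
    simp [psi0_contract (e 0)]
  have h00 : innerSL ℝ (e 0) (e 0) = 1 := by simp
  have hA' := congrArg (fun η => η.curryLeft (e 0) ![e 2, e 3, e 4, e 5])
    (smul_right_injective _ (pow_ne_zero 4 h0) hA)
  have hB' := congrArg (fun η => η ![e 0, e 2, e 3, e 6]) hB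
  have hA'' : (-4 : ℝ) * (wedge (innerSL ℝ (e 0)) psi0).curryLeft (e 0) ![e 2, e 3, e 4, e 5] =
    (wedge b psi0).curryLeft (e 0) ![e 2, e 3, e 4, e 5] := hA'
  simp only [zero_sub, ContinuousAlternatingMap.add_apply, ContinuousAlternatingMap.smul_apply,
    ContinuousAlternatingMap.neg_apply, hφ, hψ0, smul_eq_mul, h00] at hB'
  rw [hψ, hψ, h00] at hA''
  have : f t ^ 3 = 0 := by
    rw [← hA''] at hB'
    linear_combination hB'
  exact pow_ne_zero 3 h0 this

end Conformal

/-! ### The explicit examples. -/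

section Existence

variable {J : Set ℝ} {f f' : ℝ → ℝ} {K : ℝ}

/-- Over the nearly parallel fiber `λ₅ = 0` and `λ₁` is a nonvanishing multiple of `(1 + f') dt`, so
the type depends only on whether `f'` is identically `-1`. -/
theorem exists_of_sphereG2 (hJ : IsWarping J f)
    (hf : ∀ t ∈ J, HasDerivAt f (f' t) t) (hf2 : ∀ t ∈ J, HasDerivAt f' (-(K * f t)) t)
    (hK : ∀ t ∈ J, f' t ^ 2 + K * f t ^ 2 = 1) {c : Spin7Class}
    (hc : c.IsStrict (∃ t ∈ J, 1 + f' t ≠ 0) False) :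
    ExistsEinsteinWarped c (SignType.sign K) := by
  refine ⟨Euc 7, inferInstance, inferInstance, inferInstance, inferInstance, inferInstance,
    inferInstance, sphereG2, J, f, isEinsteinWarpedSpin7_of_torsion rfl hJ hf hf2 hK _ _
    (isTorsionOn_of_nearlyParallel sphereG2 (fun x => ?_) (fun x => ?_) hJ hf) ?_⟩
  · rw [dForm_modelSpace]
    exact congrFun extDeriv_sphereForm x
  · rw [dForm_modelSpace]
    exact congrFun extDeriv_sphereDual x
  · convert hc using 1
    · refine ⟨fun ⟨p, hp, h⟩ => ⟨p.1, hp.1, fun h0 => h ?_⟩,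
        fun ⟨t, ht, h⟩ => ⟨(t, 0), ⟨ht, trivial⟩, fun h0 => ?_⟩⟩
      · simp [h0]
      · have h1 := congrArg (fun l => l ((1, 0) : ℝ × Euc 7)) h0
        have h2 : 4 * (1 + f' t) / f t * 1 = 0 := h1
        have := hJ.ne_zero t ht
        field_simp at h2
        exact h (by linarith)
    · simp

theorem exists_of_conformalG2 (hJ : IsWarping J f)
    (hf : ∀ t ∈ J, HasDerivAt f (f' t) t) (hf2 : ∀ t ∈ J, HasDerivAt f' (-(K * f t)) t)
    (hK : ∀ t ∈ J, f' t ^ 2 + K * f t ^ 2 = 1) {t : ℝ} (ht : t ∈ J) (hft : f' t ≠ 0) :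
    ExistsEinsteinWarped .Y (SignType.sign K) := by
  obtain ⟨l₁, l₅, hT⟩ := exists_isTorsionOn conformalG2 hJ
  exact ⟨Euc 7, inferInstance, inferInstance, inferInstance, inferInstance, inferInstance,
    inferInstance, conformalG2, J, f, isEinsteinWarpedSpin7_of_torsion rfl hJ hf hf2 hK l₁ l₅ hT
      ⟨⟨(t, 0), ⟨ht, trivial⟩, conformalG2_torsion_one_ne_zero hJ hT ht (hf t ht) hft⟩,
        ⟨(t, e 0), ⟨ht, trivial⟩, conformalG2_torsion_five_ne_zero hJ hT ht (hf t ht)⟩⟩⟩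

theorem isWarping_id : IsWarping (Set.Ioi 0) fun t : ℝ => t where
  isOpen := isOpen_Ioi
  ordConnected := Set.ordConnected_Ioi
  nonempty := Set.nonempty_Ioi
  smooth := contDiffOn_id
  ne_zero t ht := ne_of_gt ht
  nonconstant := by
    rintro ⟨c, hc⟩
    have h1 := hc 1 (by norm_num)
    have h2 := hc 2 (by norm_num)
    linarith

theorem isWarping_neg : IsWarping (Set.Ioi 0) fun t : ℝ => -t where
  isOpen := isOpen_Ioi
  ordConnected := Set.ordConnected_Ioi
  nonempty := Set.nonempty_Ioi
  smooth := contDiff_neg.contDiffOn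
  ne_zero t ht := neg_ne_zero.2 (ne_of_gt ht)
  nonconstant := by
    rintro ⟨c, hc⟩
    have h1 := hc 1 (by norm_num)
    have h2 := hc 2 (by norm_num)
    linarith

theorem isWarping_sin : IsWarping (Set.Ioo 0 Real.pi) Real.sin where
  isOpen := isOpen_Ioo
  ordConnected := Set.ordConnected_Ioo
  nonempty := Set.nonempty_Ioo.2 Real.pi_pos
  smooth := Real.contDiff_sin.contDiffOn
  ne_zero t ht := (Real.sin_pos_of_mem_Ioo ht).ne'
  nonconstant := by
    have hπ := Real.pi_pos
    rintro ⟨c, hc⟩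
    have h1 := hc (Real.pi / 2) ⟨by linarith, by linarith⟩
    have h2 := hc (Real.pi / 6) ⟨by linarith, by linarith⟩
    rw [Real.sin_pi_div_two] at h1
    rw [Real.sin_pi_div_six] at h2
    linarith

theorem isWarping_sinh : IsWarping (Set.Ioi 0) Real.sinh where
  isOpen := isOpen_Ioi
  ordConnected := Set.ordConnected_Ioi
  nonempty := Set.nonempty_Ioi
  smooth := Real.contDiff_sinh.contDiffOn
  ne_zero t ht := (Real.sinh_pos_iff.2 ht).ne'
  nonconstant := by
    rintro ⟨c, hc⟩
    have h1 := hc 1 (by norm_num)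
    have h2 := hc 2 (by norm_num)
    have := Real.sinh_injective (h1.trans h2.symm)
    norm_num at this

/-- The sign in `f = -t` matches `dφ = +4ψ`: it makes `1 + f'` vanish. -/
theorem exists_P_zero : ExistsEinsteinWarped .P 0 := by
  have h := exists_of_sphereG2 (f' := fun _ => -1) (K := 0) (c := .P) isWarping_neg
    (fun t _ => (hasDerivAt_id t).neg) (fun t _ => by simpa using hasDerivAt_const t (-1 : ℝ))
    (fun t _ => by norm_num) ⟨by norm_num, not_false⟩
  rwa [sign_zero] at h

/-- The metric is the same flat one as for `f = -t`, but now `1 + f' = 2`, so the structure is no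
longer parallel. -/
theorem exists_Y1_zero : ExistsEinsteinWarped .Y1 0 := by
  have h := exists_of_sphereG2 (f' := fun _ => 1) (K := 0) (c := .Y1) isWarping_id
    (fun t _ => hasDerivAt_id t) (fun t _ => by simpa using hasDerivAt_const t (1 : ℝ))
    (fun t _ => by norm_num) ⟨⟨1, by norm_num, by norm_num⟩, not_false⟩
  rwa [sign_zero] at h

theorem exists_Y_zero : ExistsEinsteinWarped .Y 0 := by
  have h := exists_of_conformalG2 (f' := fun _ => 1) (K := 0) isWarping_id
    (fun t _ => hasDerivAt_id t) (fun t _ => by simpa using hasDerivAt_const t (1 : ℝ))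
    (fun t _ => by norm_num) (t := 1) (by norm_num) (by norm_num)
  rwa [sign_zero] at h

theorem exists_Y1_pos : ExistsEinsteinWarped .Y1 1 := by
  have hπ := Real.pi_pos
  have h := exists_of_sphereG2 (f' := Real.cos) (K := 1) (c := .Y1) isWarping_sin
    (fun t _ => Real.hasDerivAt_sin t) (fun t _ => by simpa using Real.hasDerivAt_cos t)
    (fun t _ => by rw [one_mul, Real.cos_sq_add_sin_sq])
    ⟨⟨Real.pi / 2, ⟨by linarith, by linarith⟩, by simp⟩, not_false⟩
  rwa [sign_one] at h

theorem exists_Y_pos : ExistsEinsteinWarped .Y 1 := by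
  have hπ := Real.pi_pos
  have h := exists_of_conformalG2 (f' := Real.cos) (K := 1) isWarping_sin
    (fun t _ => Real.hasDerivAt_sin t) (fun t _ => by simpa using Real.hasDerivAt_cos t)
    (fun t _ => by rw [one_mul, Real.cos_sq_add_sin_sq])
    (t := Real.pi / 3) ⟨by linarith, by linarith⟩ (by norm_num [Real.cos_pi_div_three])
  rwa [sign_one] at h

theorem exists_Y1_neg : ExistsEinsteinWarped .Y1 (-1) := by
  have h := exists_of_sphereG2 (f' := Real.cosh) (K := -1) (c := .Y1) isWarping_sinh
    (fun t _ => Real.hasDerivAt_sinh t) (fun t _ => by simpa using Real.hasDerivAt_cosh t)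
    (fun t _ => by linear_combination Real.cosh_sq_sub_sinh_sq t)
    ⟨⟨1, by norm_num, by have := Real.cosh_pos 1; positivity⟩, not_false⟩
  rwa [sign_neg (by norm_num)] at h

theorem exists_Y_neg : ExistsEinsteinWarped .Y (-1) := by
  have h := exists_of_conformalG2 (f' := Real.cosh) (K := -1) isWarping_sinh
    (fun t _ => Real.hasDerivAt_sinh t) (fun t _ => by simpa using Real.hasDerivAt_cosh t)
    (fun t _ => by linear_combination Real.cosh_sq_sub_sinh_sq t)
    (t := 1) (by norm_num) (Real.cosh_pos 1).ne'
  rwa [sign_neg (by norm_num)] at h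

end Existence

/-! ### Types excluded by the scalar curvature formula. -/

section Admissible

/-- With `λ₁ = 0` the formula reduces to `-|λ₅|²/2`, which is negative. -/
theorem not_admissible_Y2_of_nonneg {s : SignType} (hs : 0 ≤ s) :
    ¬Spin7Class.Y2.Admissible s := by
  rintro ⟨a, b, d, -, hb, ⟨ha, hb0⟩, hd, rfl⟩
  have ha : a = 0 := not_not.1 ha
  rw [sign_nonneg_iff, ha, hd ha] at hs
  exact hb0 (by linarith)

theorem not_admissible_P {s : SignType} (hs : s ≠ 0) : ¬Spin7Class.P.Admissible s := by
  rintro ⟨a, b, d, -, -, ⟨ha, hb⟩, hd, rfl⟩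
  have ha : a = 0 := not_not.1 ha
  have hb : b = 0 := not_not.1 hb
  apply hs
  rw [ha, hb, hd ha]
  simp

end Admissible

end WarpedSpin7

end

theorem theorem7p7 :
    (∀ c : WarpedSpin7.Spin7Class, c.Admissible 0 → WarpedSpin7.ExistsEinsteinWarped c 0) ∧
    (∀ c : WarpedSpin7.Spin7Class, c.Admissible 1 → WarpedSpin7.ExistsEinsteinWarped c 1) ∧
    (∀ c : WarpedSpin7.Spin7Class, c.Admissible (-1) → c ≠ WarpedSpin7.Spin7Class.Y2 →
      WarpedSpin7.ExistsEinsteinWarped c (-1)) ∧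
    (∀ (M : Type*) [TopologicalSpace M] [ChartedSpace (WarpedSpin7.Euc 7) M]
      [IsManifold (𝓡 7) ∞ M] (S : WarpedSpin7.G2Structure M) (J : Set ℝ) (f : ℝ → ℝ),
      ¬WarpedSpin7.IsEinsteinWarpedSpin7 S J f WarpedSpin7.Spin7Class.Y2 (-1)) := by
  refine ⟨fun c hc => ?_, fun c hc => ?_, fun c hc hY2 => ?_, fun M _ _ _ S J f => ?_⟩
  · cases c with
    | P => exact WarpedSpin7.exists_P_zero
    | Y1 => exact WarpedSpin7.exists_Y1_zero
    | Y2 => exact absurd hc (WarpedSpin7.not_admissible_Y2_of_nonneg le_rfl)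
    | Y => exact WarpedSpin7.exists_Y_zero
  · cases c with
    | P => exact absurd hc (WarpedSpin7.not_admissible_P (by decide))
    | Y1 => exact WarpedSpin7.exists_Y1_pos
    | Y2 => exact absurd hc (WarpedSpin7.not_admissible_Y2_of_nonneg (by decide))
    | Y => exact WarpedSpin7.exists_Y_pos
  · cases c with
    | P => exact absurd hc (WarpedSpin7.not_admissible_P (by decide))
    | Y1 => exact WarpedSpin7.exists_Y1_neg
    | Y2 => exact absurd rfl hY2
    | Y => exact WarpedSpin7.exists_Y_neg
  · have : IsManifold (𝓡 7) 1 M := IsManifold.of_le (n := ∞) ENat.LEInfty.out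
    exact WarpedSpin7.not_isEinsteinWarpedSpin7_Y2_neg S J f
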